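/- Let $\mathbb F\in\{\mathbb R,\mathbb C\}$ and $0<p\le 1$. For a sequence $\delta=(d_n)_{n\ge1}$ of integers with $d_n\ge 2$ put $\sigma(k)=2+\sum_{j=1}^{k-1}d_j$ and $$\mathbf x_k=\mathbf e_k-d_k^{-1/p}\sum_{j=\sigma(k)}^{\sigma(k+1)-1}\mathbf e_j\in\ell_p,\qquad k\in\mathbb N,$$ and let $\mathbb X_p(\delta)$ be the closed linear span of $(\mathbf x_k)_{k=1}^\infty$ in $\ell_p$. A basis of a quasi-Banach space $\mathbb Y$ is a sequence $\mathcal B=(\mathbf y_n)_{n=1}^\infty$ with dense linear span and $0<\inf_n\|\mathbf y_n\|\le\sup_n\|\mathbf y_n\|<\infty$ that has biorthogonal functionals $\mathbf y_n^*\in\mathbb Y^*$ which separate the points of $\mathbb Y$ and satisfy $\sup_n\|\mathbf y_n^*\|<\infty$. For finite $A\subset\mathbb N$ let $S_A(f)=\sum_{n\in A}\mathbf y_n^*(f)\,\mathbf y_n$. The basis is a Schauder basis if every $f\in\mathbb Y$ has a unique convergent expansion $f=\sum_{n=1}^\infty a_n\mathbf y_n$. It is almost greedy if there is a constant $C$ such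 that $\|f-S_A(f)\|\le C\|f-S_D(f)\|$ for all $f\in\mathbb Y$, all finite $A\subset\mathbb N$ such that $|\mathbf y_n^*(f)|\ge|\mathbf y_k^*(f)|$ whenever $n\in A$ and $k\notin A$, and all $D\subset\mathbb N$ with $|D|\le|A|$. Its conditionality constants are $k_m[\mathcal B,\mathbb Y]=\sup_{|A|\le m}\|S_A\|$. Let $\phi\colon[0,\infty)\to[0,\infty)$ be a concave non-decreasing function with $\phi(0)=0$ that is not identically zero (for instance, any concave strictly increasing function with $\phi(0)=0$). (1) $\ell_p$ has an almost greedy Schauder basis $\mathcal B$ with $k_m[\mathcal B,\ell_p]\approx\phi(\log m)^{1/p}$ for $m\ge2$. (2) If, moreover, $\phi$ is unbounded, then for every sequence $\delta$ of integers in $[2,\infty)$ the space $\mathbb Y=\mathbb X_p(\delta)$ has an almost greedy Schauder basis $\mathcal B$ with $k_m[\mathcal B,\mathbb Y]\approx\phi(\log m)^{1/p}$ for $m\ge2$. Here $a_m\approx b_m$ means that there are constants $0<c\le C<\infty$, independent of $m$, with $c\,b_m\le a_m\le C\,b_m$. -/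

import Mathlib

open Filter Topology
open scoped ENNReal

/-! ### Bases of quasi-normed spaces

The definitions below are for a vector space `Y` over `𝕜` whose topology is given by a
quasi-norm `‖·‖` (for example `ℓ_p` with `0 < p ≤ 1`, where `‖·‖` need not be subadditive): a
sequence `f_N` converges to `f` when `‖f - f_N‖ → 0`, and a linear functional is continuous exactly
when it is bounded by a multiple of `‖·‖`. Sequences are indexed by `ℕ = {0, 1, 2, …}`. -/

/-- A semi-normalized fundamental `M`-bounded Markushevich basis of `Y`: a sequence `vec` that
generates `Y`, together with its (uniformly bounded, total) biorthogonal functionals `coord`. -/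
structure QBasis (𝕜 : Type*) [RCLike 𝕜] (Y : Type*) [AddCommGroup Y] [Module 𝕜 Y] [Norm Y] where
  vec : ℕ → Y
  coord : ℕ → Y →ₗ[𝕜] 𝕜
  biorthogonal : ∀ i j, coord i (vec j) = if i = j then 1 else 0
  seminormalized : ∃ a b : ℝ, 0 < a ∧ ∀ n, a ≤ ‖vec n‖ ∧ ‖vec n‖ ≤ b
  coord_bounded : ∃ C : ℝ, ∀ n f, ‖coord n f‖ ≤ C * ‖f‖
  fundamental : ∀ f : Y, ∀ ε : ℝ, 0 < ε → ∃ g ∈ Submodule.span 𝕜 (Set.range vec), ‖f - g‖ < ε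
  total : ∀ f : Y, (∀ n, coord n f = 0) → f = 0

namespace QBasis

variable {𝕜 : Type*} [RCLike 𝕜] {Y : Type*} [AddCommGroup Y] [Module 𝕜 Y] [Norm Y]

/-- `B` is a Schauder basis: every `f` has a unique norm-convergent expansion `f = ∑ aₙ yₙ`. -/
def IsSchauder (B : QBasis 𝕜 Y) : Prop :=
  ∀ f : Y, ∃! a : ℕ → 𝕜,
    Tendsto (fun N : ℕ => ‖f - ∑ n ∈ Finset.range N, a n • B.vec n‖) atTop (𝓝 0)

/-- The coordinate projection `S_A(f) = ∑_{n ∈ A} yₙ*(f) yₙ`. -/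
def proj (B : QBasis 𝕜 Y) (A : Finset ℕ) (f : Y) : Y :=
  ∑ n ∈ A, B.coord n f • B.vec n

/-- `A` is a greedy set of `f`, that is, `S_A(f)` is a greedy sum of `f` of order `|A|`. -/
def IsGreedySet (B : QBasis 𝕜 Y) (f : Y) (A : Finset ℕ) : Prop :=
  ∀ n ∈ A, ∀ k ∉ A, ‖B.coord k f‖ ≤ ‖B.coord n f‖

/-- `B` is almost greedy: up to a constant, greedy sums approximate as well as any coordinate
projection of at most the same order. -/
def IsAlmostGreedy (B : QBasis 𝕜 Y) : Prop :=
  ∃ C : ℝ, ∀ (f : Y) (A D : Finset ℕ), B.IsGreedySet f A → D.card ≤ A.card →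
    ‖f - B.proj A f‖ ≤ C * ‖f - B.proj D f‖

/-- The conditionality constant `k_m = sup_{|A| ≤ m} ‖S_A‖`, where `‖S_A‖` is the operator
quasi-norm `sup_{‖f‖ ≤ 1} ‖S_A(f)‖`. -/
noncomputable def condConst (B : QBasis 𝕜 Y) (m : ℕ) : ℝ≥0∞ :=
  ⨆ (A : Finset ℕ) (_ : A.card ≤ m) (f : Y) (_ : ‖f‖ ≤ 1), ENNReal.ofReal ‖B.proj A f‖

/-- `k_m ≈ g m` for `m ≥ 2`. -/
def CondConstEquiv (B : QBasis 𝕜 Y) (g : ℕ → ℝ) : Prop :=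
  ∃ c C : ℝ, 0 < c ∧ 0 < C ∧ ∀ m : ℕ, 2 ≤ m →
    ENNReal.ofReal (c * g m) ≤ B.condConst m ∧ B.condConst m ≤ ENNReal.ofReal (C * g m)

end QBasis

/-! ### The spaces `ℓ_p` and `X_p(δ)` -/

/-- The sequence space `ℓ_p` over `𝕜` with its quasi-norm `(∑ |x(n)|^p)^{1/p}`. -/
abbrev EllP (𝕜 : Type*) [RCLike 𝕜] (p : ℝ) : Type _ :=
  lp (fun _ : ℕ => 𝕜) (ENNReal.ofReal p)

/-- The smallest closed subspace of `ℓ_p` containing `S`. -/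
noncomputable def closedSpan {𝕜 : Type*} [RCLike 𝕜] {p : ℝ} (S : Set (EllP 𝕜 p)) :
    Submodule 𝕜 (EllP 𝕜 p) :=
  sInf {V | S ⊆ V ∧ ∀ f : EllP 𝕜 p, (∀ ε : ℝ, 0 < ε → ∃ g ∈ V, ‖f - g‖ < ε) → f ∈ V}

/-- The unit vector `e_j`. -/
noncomputable def unitVec (𝕜 : Type*) [RCLike 𝕜] (p : ℝ) (j : ℕ) : EllP 𝕜 p :=
  lp.single (ENNReal.ofReal p) j (1 : 𝕜)

/-- `σ(k) = 1 + ∑_{j < k} d_j`. Indices start at `0`, so the integer intervals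
`[σ(k), σ(k+1))`, of lengths `d_k`, partition `{1, 2, …}`, and `k < σ(k)`. -/
def blockStart (δ : ℕ → ℕ) (k : ℕ) : ℕ :=
  1 + ∑ j ∈ Finset.range k, δ j

/-- The Lindenstrauss vector `x_k = e_k - d_k^{-1/p} ∑_{σ(k) ≤ j < σ(k+1)} e_j`. -/
noncomputable def lindVec (𝕜 : Type*) [RCLike 𝕜] (p : ℝ) (δ : ℕ → ℕ) (k : ℕ) : EllP 𝕜 p :=
  unitVec 𝕜 p k - (((δ k : ℝ) ^ (-(1 / p)) : ℝ) : 𝕜) •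
    ∑ j ∈ Finset.Ico (blockStart δ k) (blockStart δ (k + 1)), unitVec 𝕜 p j

/-- The space `X_p(δ)`: the closed linear span of `(x_k)` in `ℓ_p`. -/
noncomputable def LindSpace (𝕜 : Type*) [RCLike 𝕜] (p : ℝ) (δ : ℕ → ℕ) :
    Submodule 𝕜 (EllP 𝕜 p) :=
  closedSpan (Set.range (lindVec 𝕜 p δ))

/-- `X_p(δ)` carries the quasi-norm of `ℓ_p`. -/
noncomputable instance LindSpace.instNorm (𝕜 : Type*) [RCLike 𝕜] (p : ℝ) (δ : ℕ → ℕ) :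
    Norm (LindSpace 𝕜 p δ) :=
  ⟨fun x => ‖(x : EllP 𝕜 p)‖⟩

/-! ### The `p`-energy of a sequence -/

section Energy

variable {𝕜 : Type*} [RCLike 𝕜] {p : ℝ}

/-! Everything is read off a forest on `ℕ` in which a node hands fractions of its `p`-energy to its
children: at most one half to any single child, at most the whole to all of them. The vectors are
`x_k = e_k - ∑ w_j e_j` over the children `j` of `k`, with `w_j ^ p` the fraction given to `j`. If
`f = diff a` is the combination of the `x_k` with coefficients `a`, then `|a_k|^p ≤ |f_k|^p + mass k
* |a_(parent k)|^p`, and the basis properties come from bookkeeping with this inequality. Energy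
leaving a set of nodes must have entered it, which bounds partial sums and greedy sums
(`pen_diff_restr_le`). Since no child gets more than half, many large coefficients force a large
energy (`card_mul_le_pen_diff`). Together these give almost greediness for every such forest
(`pen_diff_sub_greedy_le`).

The conditionality constants depend on how fast the forest branches. Unrolling the inequality for
`R` generations gives `∑_A |a_k|^p ≤ (R + K) * pen (diff a)` as soon as `|A|` times the mass
reaching a node from its `R`-th ancestor is at most `K`. If level `l` of a tree has `2 ^ n l` nodes
and `n` is superadditive up to an additive constant, then `R` may be the number of levels with at
most about `m` nodes. This is sharp: spreading a unit mass from the root evenly through `L` levels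
gives a combination of energy at most `2`, and keeping only the even levels destroys all
cancellation and leaves energy at least `L`. Taking for `n` a discrete inverse of `φ`, whose
concavity gives the superadditivity, yields `k_m ^ p ≈ φ(log m)`.

In `ℓ_p` one takes disjoint copies of the tree truncated at growing heights: the trees are then
finite, so the vectors span all of `ℓ_p`. For bounded `φ` the unit vectors suffice.

For `X_p(δ)` one needs that all these spaces are isomorphic, so that the tree may be chosen freely.
The nodes of the tree of `δ` are identified with nested subintervals of `[0,1)` and `e_k` with the
`L_p`-normalized indicator. Then `X_p(δ)` is the kernel of the synthesis map from `ℓ_p` to `L_p`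
(`mem_lindSpace_iff`): by summation by parts, what a truncation leaves on the boundary of the tree
is isometric to a tail of the series. Normalized indicators of one tree lift boundedly to the other
by decomposing an interval into maximal intervals of the other tree. Hence the pull-back of the two
synthesis maps is isomorphic to both `X_p(δ) ⊕ ℓ_p` and `X_p(δ') ⊕ ℓ_p`, and since each space
absorbs a copy of `ℓ_p` (`absorption`), `X_p(δ)` and `X_p(δ')` are isomorphic. -/

/-- The `p`-energy `∑ |f(j)|^p` of a scalar sequence. -/
noncomputable def pen (p : ℝ) (f : ℕ → 𝕜) : ℝ≥0∞ := ∑' j, ‖f j‖ₑ ^ p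

lemma enorm_add_rpow_le (hp0 : 0 < p) (hp1 : p ≤ 1) (x y : 𝕜) :
    ‖x + y‖ₑ ^ p ≤ ‖x‖ₑ ^ p + ‖y‖ₑ ^ p :=
  (ENNReal.rpow_le_rpow (enorm_add_le x y) hp0.le).trans
    (ENNReal.rpow_add_le_add_rpow _ _ hp0.le hp1)

lemma enorm_sub_rpow_le (hp0 : 0 < p) (hp1 : p ≤ 1) (x y : 𝕜) :
    ‖x - y‖ₑ ^ p ≤ ‖x‖ₑ ^ p + ‖y‖ₑ ^ p := by
  rw [sub_eq_add_neg]
  refine (enorm_add_rpow_le hp0 hp1 _ _).trans ?_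
  rw [enorm_neg]

lemma enorm_rpow_eq_ofReal (hp0 : 0 < p) (z : 𝕜) : ‖z‖ₑ ^ p = ENNReal.ofReal (‖z‖ ^ p) := by
  rw [← ofReal_norm, ENNReal.ofReal_rpow_of_nonneg (norm_nonneg _) hp0.le]

lemma enorm_rpow_ne_top (hp0 : 0 < p) (z : 𝕜) : ‖z‖ₑ ^ p ≠ ∞ := by
  rw [enorm_rpow_eq_ofReal hp0]; exact ENNReal.ofReal_ne_top

@[simp] lemma enorm_zero_rpow (hp0 : 0 < p) : ‖(0 : 𝕜)‖ₑ ^ p = 0 := by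
  simp [hp0]

lemma ENNReal.sum_rpow_le_sum_rpow {ι : Type*} (hp0 : 0 < p) (hp1 : p ≤ 1) (f : ι → ℝ≥0∞)
    (s : Finset ι) : (∑ i ∈ s, f i) ^ p ≤ ∑ i ∈ s, f i ^ p := by
  classical
  induction s using Finset.induction_on with
  | empty => simp [hp0]
  | insert a s ha ih =>
    rw [Finset.sum_insert ha, Finset.sum_insert ha]
    exact (ENNReal.rpow_add_le_add_rpow _ _ hp0.le hp1).trans (by gcongr)

lemma ENNReal.tsum_rpow_le_tsum_rpow {ι : Type*} (hp0 : 0 < p) (hp1 : p ≤ 1) (f : ι → ℝ≥0∞) :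
    (∑' i, f i) ^ p ≤ ∑' i, f i ^ p := by
  have h1 : Tendsto (fun s : Finset ι => (∑ i ∈ s, f i) ^ p) atTop (𝓝 ((∑' i, f i) ^ p)) :=
    (ENNReal.continuous_rpow_const.tendsto _).comp ENNReal.summable.hasSum
  exact le_of_tendsto' h1 fun s =>
    (ENNReal.sum_rpow_le_sum_rpow hp0 hp1 f s).trans (ENNReal.sum_le_tsum s)

lemma enorm_tsum_rpow_le {ι : Type*} (hp0 : 0 < p) (hp1 : p ≤ 1) (f : ι → 𝕜) :
    ‖∑' i, f i‖ₑ ^ p ≤ ∑' i, ‖f i‖ₑ ^ p :=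
  (ENNReal.rpow_le_rpow enorm_tsum_le_tsum_enorm hp0.le).trans
    (ENNReal.tsum_rpow_le_tsum_rpow hp0 hp1 _)

lemma ENNReal.tsum_ite_mem (A : Finset ℕ) (g : ℕ → ℝ≥0∞) :
    ∑' j, (if j ∈ A then g j else 0) = ∑ j ∈ A, g j := by
  rw [tsum_eq_sum (s := A) (fun j hj => if_neg hj)]
  exact Finset.sum_congr rfl fun j hj => if_pos hj

lemma pen_add_le (hp0 : 0 < p) (hp1 : p ≤ 1) (f g : ℕ → 𝕜) :
    pen p (f + g) ≤ pen p f + pen p g := by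
  unfold pen
  rw [← ENNReal.tsum_add]
  exact ENNReal.tsum_le_tsum fun j => enorm_add_rpow_le hp0 hp1 _ _

lemma pen_neg (f : ℕ → 𝕜) : pen p (-f) = pen p f := by
  simp [pen]

lemma pen_sub_le (hp0 : 0 < p) (hp1 : p ≤ 1) (f g : ℕ → 𝕜) :
    pen p (f - g) ≤ pen p f + pen p g := by
  rw [sub_eq_add_neg, ← pen_neg g]; exact pen_add_le hp0 hp1 _ _

lemma pen_smul (hp0 : 0 < p) (c : 𝕜) (f : ℕ → 𝕜) : pen p (c • f) = ‖c‖ₑ ^ p * pen p f := by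
  unfold pen
  rw [← ENNReal.tsum_mul_left]
  refine tsum_congr fun j => ?_
  rw [Pi.smul_apply, smul_eq_mul, enorm_mul, ENNReal.mul_rpow_of_nonneg _ _ hp0.le]

lemma pen_single (hp0 : 0 < p) (k : ℕ) : pen p (Pi.single k (1 : 𝕜)) = 1 := by
  unfold pen
  rw [tsum_eq_single k]
  · simp
  · intro j hj; simp [hj, hp0]

lemma sum_le_pen (f : ℕ → 𝕜) (s : Finset ℕ) : ∑ j ∈ s, ‖f j‖ₑ ^ p ≤ pen p f :=
  ENNReal.sum_le_tsum s

/-- The restriction of a sequence to a finite set. -/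
def restr (A : Finset ℕ) : (ℕ → 𝕜) →ₗ[𝕜] (ℕ → 𝕜) where
  toFun a := fun k => if k ∈ A then a k else 0
  map_add' a b := by funext k; by_cases h : k ∈ A <;> simp [h]
  map_smul' c a := by funext k; by_cases h : k ∈ A <;> simp [h]

lemma restr_apply (A : Finset ℕ) (a : ℕ → 𝕜) (k : ℕ) :
    restr A a k = if k ∈ A then a k else 0 := rfl

lemma restr_eq_sum (A : Finset ℕ) (a : ℕ → 𝕜) :
    restr A a = ∑ k ∈ A, a k • Pi.single k (1 : 𝕜) := by
  funext j
  simp [restr_apply, Finset.sum_apply, Pi.single_apply]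

lemma pen_restr (hp0 : 0 < p) (A : Finset ℕ) (a : ℕ → 𝕜) :
    pen p (restr A a) = ∑ k ∈ A, ‖a k‖ₑ ^ p := by
  rw [← ENNReal.tsum_ite_mem]
  refine tsum_congr fun j => ?_
  by_cases h : j ∈ A <;> simp [restr_apply, h, hp0]

/-- Sequences of finite energy are approximated by their restrictions. -/
lemma tendsto_pen_sub_restr (hp0 : 0 < p) {f : ℕ → 𝕜} (hf : pen p f ≠ ∞) :
    Tendsto (fun A : Finset ℕ => pen p (f - restr A f)) atTop (𝓝 0) := by
  refine (ENNReal.tendsto_tsum_compl_atTop_zero hf).congr fun A => ?_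
  unfold pen
  refine (tsum_subtype {x | x ∉ A} (fun j => ‖f j‖ₑ ^ p)).trans (tsum_congr fun j => ?_)
  by_cases h : j ∈ A <;> simp [restr_apply, h, hp0]

end Energy

/-! ### Weighted forests -/

/-- A forest structure on `ℕ` in which every node `k` receives the fraction `mass k` of its
parent. Roots have `mass k = 0`. -/
structure MassForest where
  parent : ℕ → ℕ
  mass : ℕ → NNReal
  parent_lt : ∀ k, mass k ≠ 0 → parent k < k
  mass_le : ∀ k, mass k ≤ 1 / 2
  sum_mass_le : ∀ u, ∑' k, (if parent k = u then (mass k : ℝ≥0∞) else 0) ≤ 1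

namespace MassForest

variable {𝕜 : Type*} [RCLike 𝕜] {p : ℝ} (F : MassForest)

/-- The coefficient with which a node occurs in the vector of its parent. -/
noncomputable def weight (𝕜 : Type*) [RCLike 𝕜] (p : ℝ) (k : ℕ) : 𝕜 :=
  (((F.mass k : ℝ) ^ (1 / p) : ℝ) : 𝕜)

lemma enorm_weight_rpow (hp0 : 0 < p) (k : ℕ) : ‖F.weight 𝕜 p k‖ₑ ^ p = F.mass k := by
  rw [enorm_rpow_eq_ofReal hp0, weight, RCLike.norm_ofReal,
    abs_of_nonneg (by positivity), ← Real.rpow_mul (by positivity), one_div,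
    inv_mul_cancel₀ hp0.ne', Real.rpow_one]
  simp

lemma enorm_weight_mul_rpow (hp0 : 0 < p) (k : ℕ) (z : 𝕜) :
    ‖F.weight 𝕜 p k * z‖ₑ ^ p = F.mass k * ‖z‖ₑ ^ p := by
  rw [enorm_mul, ENNReal.mul_rpow_of_nonneg _ _ hp0.le, enorm_weight_rpow F hp0]

lemma weight_eq_zero (hp0 : 0 < p) {k : ℕ} (h : F.mass k = 0) : F.weight 𝕜 p k = 0 := by
  simp [weight, h, hp0.ne']

/-- The sequence `∑ aₖ xₖ`, where `xₖ = eₖ - ∑ wⱼ eⱼ` (sum over the children `j` of `k`). -/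
noncomputable def diff (𝕜 : Type*) [RCLike 𝕜] (p : ℝ) : (ℕ → 𝕜) →ₗ[𝕜] (ℕ → 𝕜) where
  toFun a := fun j => a j - F.weight 𝕜 p j * a (F.parent j)
  map_add' a b := by funext j; simp; ring
  map_smul' c a := by funext j; simp; ring

lemma diff_apply (a : ℕ → 𝕜) (j : ℕ) :
    F.diff 𝕜 p a j = a j - F.weight 𝕜 p j * a (F.parent j) := rfl

/-- The inverse of `diff`. -/
noncomputable def solFun (𝕜 : Type*) [RCLike 𝕜] (p : ℝ) (f : ℕ → 𝕜) (k : ℕ) : 𝕜 :=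
  f k + if F.parent k < k then F.weight 𝕜 p k * solFun 𝕜 p f (F.parent k) else 0
termination_by k

/-- The guard in `solFun` only secures termination: it can fail only at a node of mass zero, where
the weight vanishes. -/
lemma solFun_eq (hp0 : 0 < p) (f : ℕ → 𝕜) (k : ℕ) :
    F.solFun 𝕜 p f k = f k + F.weight 𝕜 p k * F.solFun 𝕜 p f (F.parent k) := by
  rw [solFun]
  split_ifs with h
  · rfl
  · have : F.mass k = 0 := by
      by_contra h'; exact h (F.parent_lt k h')
    simp [F.weight_eq_zero hp0 this]

lemma eq_of_diff_eq (hp0 : 0 < p) {a b : ℕ → 𝕜} (h : F.diff 𝕜 p a = F.diff 𝕜 p b) : a = b := by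
  funext k
  induction k using Nat.strong_induction_on with
  | _ k ih =>
    have hk := congrFun h k
    simp only [diff_apply] at hk
    by_cases hq : F.mass k = 0
    · simpa [F.weight_eq_zero hp0 hq] using hk
    · rw [ih _ (F.parent_lt k hq)] at hk
      exact sub_left_injective hk

lemma diff_solFun (hp0 : 0 < p) (f : ℕ → 𝕜) : F.diff 𝕜 p (F.solFun 𝕜 p f) = f := by
  funext k
  rw [diff_apply, F.solFun_eq hp0 f k]; ring

/-- `diff` as a linear automorphism of the space of all sequences. -/
noncomputable def diffEquiv (𝕜 : Type*) [RCLike 𝕜] (hp0 : 0 < p) : (ℕ → 𝕜) ≃ₗ[𝕜] (ℕ → 𝕜) :=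
  LinearEquiv.ofBijective (F.diff 𝕜 p)
    ⟨fun _ _ h => F.eq_of_diff_eq hp0 h, fun f => ⟨_, F.diff_solFun hp0 f⟩⟩

lemma enorm_rpow_le_diff (hp0 : 0 < p) (hp1 : p ≤ 1) (a : ℕ → 𝕜) (k : ℕ) :
    ‖a k‖ₑ ^ p ≤ ‖F.diff 𝕜 p a k‖ₑ ^ p + F.mass k * ‖a (F.parent k)‖ₑ ^ p := by
  rw [← F.enorm_weight_mul_rpow hp0]
  have : a k = F.diff 𝕜 p a k + F.weight 𝕜 p k * a (F.parent k) := by rw [diff_apply]; ring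
  conv_lhs => rw [this]
  exact enorm_add_rpow_le hp0 hp1 _ _

/-- Conservation of energy: the children of a node jointly receive no more than the node has. -/
lemma tsum_mass_mul_le (G : ℕ → ℝ≥0∞) : ∑' k, F.mass k * G (F.parent k) ≤ ∑' u, G u := by
  have : ∀ k, (F.mass k : ℝ≥0∞) * G (F.parent k)
      = ∑' u, G u * (if F.parent k = u then (F.mass k : ℝ≥0∞) else 0) := by
    intro k
    rw [tsum_eq_single (F.parent k)]
    · simp [mul_comm]
    · intro u hu; simp [hu.symm]
  simp_rw [this]
  rw [ENNReal.tsum_comm]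
  refine ENNReal.tsum_le_tsum fun u => ?_
  rw [ENNReal.tsum_mul_left]
  calc _ ≤ G u * 1 := by gcongr; exact F.sum_mass_le u
    _ = G u := mul_one _

lemma pen_diff_le (hp0 : 0 < p) (hp1 : p ≤ 1) (a : ℕ → 𝕜) :
    pen p (F.diff 𝕜 p a) ≤ 2 * pen p a := by
  calc pen p (F.diff 𝕜 p a) ≤ ∑' k, (‖a k‖ₑ ^ p + F.mass k * ‖a (F.parent k)‖ₑ ^ p) := by
        refine ENNReal.tsum_le_tsum fun k => ?_
        rw [← F.enorm_weight_mul_rpow hp0]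
        exact enorm_sub_rpow_le hp0 hp1 _ _
    _ ≤ pen p a + pen p a := by
        rw [ENNReal.tsum_add]
        exact add_le_add le_rfl (F.tsum_mass_mul_le fun u => ‖a u‖ₑ ^ p)
    _ = 2 * pen p a := (two_mul _).symm

/-- If the top nodes of a finite set `A` are controlled by the increments there, then so is the
restriction to `A`: what leaves `A` has entered it. -/
lemma pen_diff_restr_le (hp0 : 0 < p) (hp1 : p ≤ 1) (A : Finset ℕ) (a : ℕ → 𝕜) {C : ℝ≥0∞}
    (hC : 1 ≤ C) (h : ∀ k ∈ A, F.parent k ∉ A → ‖a k‖ₑ ^ p ≤ C * ‖F.diff 𝕜 p a k‖ₑ ^ p) :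
    pen p (F.diff 𝕜 p (restr A a)) ≤ 2 * C * ∑ k ∈ A, ‖F.diff 𝕜 p a k‖ₑ ^ p := by
  set f := fun k => ‖F.diff 𝕜 p a k‖ₑ ^ p with hf
  set m := fun k => ‖a k‖ₑ ^ p with hm
  set E := ∑' j, (if j ∉ A ∧ F.parent j ∈ A then F.mass j * m (F.parent j) else 0) with hE
  set I := ∑ j ∈ A, (if F.parent j ∈ A then F.mass j * m (F.parent j) else 0) with hI
  have hfC : ∀ k, f k ≤ C * f k := fun k => le_mul_of_one_le_left' hC
  have h1 : pen p (F.diff 𝕜 p (restr A a)) ≤ ∑ k ∈ A, C * f k + E := by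
    rw [← ENNReal.tsum_ite_mem, ← ENNReal.tsum_add]
    refine ENNReal.tsum_le_tsum fun j => ?_
    rw [diff_apply]
    simp only [restr_apply]
    by_cases hj : j ∈ A <;> by_cases hpj : F.parent j ∈ A
    · simp only [hj, hpj, if_true]
      exact le_add_right (hfC j)
    · simp only [hj, hpj, if_true, if_false, mul_zero, sub_zero]
      exact le_add_right (h j hj hpj)
    · simp only [hj, hpj, if_true, if_false, zero_sub, enorm_neg, not_false_eq_true, and_self,
        zero_add]
      rw [F.enorm_weight_mul_rpow hp0]
    · simp [hj, hpj, hp0]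
  -- `E` is the energy passed out of `A` and `I` the energy passed on inside `A`. The nodes of `A`
  -- carry at least `E + I` and at most what enters plus `I`; cancelling the finite `I` bounds `E`.
  have h2 : E + I ≤ ∑ k ∈ A, m k := by
    rw [hI, ← ENNReal.tsum_ite_mem, ← ENNReal.tsum_add, ← ENNReal.tsum_ite_mem]
    refine le_trans (ENNReal.tsum_le_tsum fun j => ?_)
      (F.tsum_mass_mul_le fun k => if k ∈ A then m k else 0)
    by_cases hj : j ∈ A <;> by_cases hpj : F.parent j ∈ A <;> simp [hj, hpj]
  have h3 : ∑ k ∈ A, m k ≤ ∑ k ∈ A, C * f k + I := by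
    rw [hI, ← Finset.sum_add_distrib]
    refine Finset.sum_le_sum fun k hk => ?_
    by_cases hpk : F.parent k ∈ A
    · simp only [hpk, if_true]
      exact (F.enorm_rpow_le_diff hp0 hp1 a k).trans (add_le_add (hfC k) le_rfl)
    · simp only [hpk, if_false, add_zero]
      exact h k hk hpk
  have hIfin : I ≠ ∞ := by
    refine ENNReal.sum_ne_top.2 fun j _ => ?_
    split_ifs
    · exact ENNReal.mul_ne_top ENNReal.coe_ne_top (enorm_rpow_ne_top hp0 _)
    · exact ENNReal.zero_ne_top
  have h4 : E ≤ ∑ k ∈ A, C * f k :=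
    (ENNReal.add_le_add_iff_right hIfin).1 (h2.trans h3)
  calc _ ≤ ∑ k ∈ A, C * f k + ∑ k ∈ A, C * f k := h1.trans (add_le_add le_rfl h4)
    _ = _ := by rw [← Finset.mul_sum]; ring

/-- Parents precede their children, so only nodes of mass zero have their parent outside an initial
segment, and there the coefficient equals the increment. -/
lemma pen_diff_restr_range_le (hp0 : 0 < p) (hp1 : p ≤ 1) (n : ℕ) (a : ℕ → 𝕜) :
    pen p (F.diff 𝕜 p (restr (Finset.range n) a))
      ≤ 2 * ∑ k ∈ Finset.range n, ‖F.diff 𝕜 p a k‖ₑ ^ p := by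
  refine (F.pen_diff_restr_le hp0 hp1 (Finset.range n) a le_rfl ?_).trans (by rw [mul_one])
  intro k hk hpk
  have : F.mass k = 0 := by
    by_contra h
    have := F.parent_lt k h
    simp only [Finset.mem_range] at hk hpk
    omega
  rw [one_mul, diff_apply, F.weight_eq_zero hp0 this]; simp

/-- If the parent of `k ∈ A` is not in the greedy set `A`, its coefficient is no larger than that of
`k`. As `k` receives at most half of it, the increment at `k` accounts for at least half of `|a
k|^p`. -/
lemma pen_diff_restr_greedy_le (hp0 : 0 < p) (hp1 : p ≤ 1) (A : Finset ℕ) (a : ℕ → 𝕜)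
    (hA : ∀ n ∈ A, ∀ k ∉ A, ‖a k‖ ≤ ‖a n‖) :
    pen p (F.diff 𝕜 p (restr A a)) ≤ 4 * pen p (F.diff 𝕜 p a) := by
  have h4 : (4 : ℝ≥0∞) = 2 * 2 := by norm_num
  refine (F.pen_diff_restr_le hp0 hp1 A a (C := 2) (by norm_num) ?_).trans
    (by rw [h4]; gcongr; exact sum_le_pen _ _)
  intro k hk hpk
  have h1 := F.enorm_rpow_le_diff hp0 hp1 a k
  have h2 : ‖a (F.parent k)‖ₑ ^ p ≤ ‖a k‖ₑ ^ p := by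
    rw [enorm_rpow_eq_ofReal hp0, enorm_rpow_eq_ofReal hp0]
    exact ENNReal.ofReal_le_ofReal
      (Real.rpow_le_rpow (norm_nonneg _) (hA k hk _ hpk) hp0.le)
  have h3 : (F.mass k : ℝ≥0∞) ≤ 2⁻¹ := by
    have := F.mass_le k
    rw [one_div] at this
    have h' : ((F.mass k : NNReal) : ℝ≥0∞) ≤ ((2⁻¹ : NNReal) : ℝ≥0∞) := ENNReal.coe_le_coe.2 this
    simpa using h'
  have h5 : ‖a k‖ₑ ^ p ≤ ‖F.diff 𝕜 p a k‖ₑ ^ p + 2⁻¹ * ‖a k‖ₑ ^ p :=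
    h1.trans (add_le_add le_rfl (mul_le_mul' h3 h2))
  have hfin := enorm_rpow_ne_top hp0 (a k)
  have h6 : 2 * ‖a k‖ₑ ^ p ≤ 2 * ‖F.diff 𝕜 p a k‖ₑ ^ p + ‖a k‖ₑ ^ p := by
    calc 2 * ‖a k‖ₑ ^ p ≤ 2 * (‖F.diff 𝕜 p a k‖ₑ ^ p + 2⁻¹ * ‖a k‖ₑ ^ p) := by gcongr
      _ = _ := by
        rw [mul_add, ← mul_assoc, ENNReal.mul_inv_cancel (by norm_num) (by norm_num), one_mul]
  rw [two_mul] at h6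
  exact (ENNReal.add_le_add_iff_right hfin).1 h6

end MassForest

/-! ### Democracy, almost greediness and the upper bound for coordinate projections. -/

namespace MassForest

variable {𝕜 : Type*} [RCLike 𝕜] {p : ℝ} (F : MassForest)

lemma sum_mass_fiber_le (B : Finset ℕ) (u : ℕ) :
    ∑ k ∈ B with F.parent k = u, (F.mass k : ℝ) ≤ 1 := by
  have h := (ENNReal.sum_le_tsum B).trans (F.sum_mass_le u)
  rw [← Finset.sum_filter, ← ENNReal.ofNNReal_finsetSum] at h
  exact_mod_cast ENNReal.coe_le_one_iff.1 h

/-- Passing from a node with mass at least `2s` to its children costs at least `s`. -/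
lemma sum_max_fiber_le (B : Finset ℕ) (u : ℕ) {m s : ℝ} (hs : 0 ≤ s) (hm : 2 * s ≤ m) :
    ∑ k ∈ B with F.parent k = u, max (F.mass k * m - s) 0 ≤ m - 2 * s := by
  set S := {k ∈ B | F.parent k = u} with hS
  have hm0 : 0 ≤ m := by linarith
  have h1 : ∑ k ∈ S, max (F.mass k * m - s) 0 = ∑ k ∈ S with 0 < F.mass k * m - s,
      (F.mass k * m - s) := by
    rw [Finset.sum_filter (fun k => 0 < (F.mass k : ℝ) * m - s)]
    refine Finset.sum_congr rfl fun k _ => ?_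
    split_ifs with h
    · exact max_eq_left h.le
    · exact max_eq_right (not_lt.1 h)
  rw [h1]
  set S' := {k ∈ S | 0 < (F.mass k : ℝ) * m - s} with hS'
  have hmass : ∑ k ∈ S', (F.mass k : ℝ) ≤ 1 :=
    (Finset.sum_le_sum_of_subset_of_nonneg (Finset.filter_subset _ _)
      (fun _ _ _ => NNReal.coe_nonneg _)).trans (F.sum_mass_fiber_le B u)
  rw [Finset.sum_sub_distrib, ← Finset.sum_mul, Finset.sum_const, nsmul_eq_mul]
  have hle : (∑ k ∈ S', (F.mass k : ℝ)) * m ≤ 1 * m := by gcongr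
  -- If two or more children exceed the threshold, each of them pays `s`; if only one does, it
  -- receives at most half of `m`.
  rcases Nat.lt_or_ge 1 S'.card with hc | hc
  · have : (2 : ℝ) ≤ S'.card := by exact_mod_cast hc
    nlinarith
  · interval_cases hcard : S'.card
    · rw [Finset.card_eq_zero] at hcard
      rw [hcard]; simp; linarith
    · obtain ⟨k, hk⟩ := Finset.card_eq_one.1 hcard
      rw [hk, Finset.sum_singleton]
      have h2 : (F.mass k : ℝ) ≤ 1 / 2 := by exact_mod_cast F.mass_le k
      have h3 : (F.mass k : ℝ) * m ≤ 1 / 2 * m := by gcongr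
      push_cast
      linarith

/-- The energy controls the number of large coefficients. -/
lemma card_mul_le_pen_diff (hp0 : 0 < p) (hp1 : p ≤ 1) (B : Finset ℕ) (g : ℕ → 𝕜) {T : ℝ}
    (hT : 0 ≤ T) (hB : ∀ k ∈ B, T ≤ ‖g k‖ ^ p) (hB' : ∀ k ∉ B, ‖g k‖ ^ p ≤ T) :
    B.card * ENNReal.ofReal T ≤ 2 * pen p (F.diff 𝕜 p g) := by
  set m := fun k => ‖g k‖ ^ p with hm
  set f := fun k => ‖F.diff 𝕜 p g k‖ ^ p with hf
  have hm0 : ∀ k, 0 ≤ m k := fun k => by positivity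
  have hf0 : ∀ k, 0 ≤ f k := fun k => by positivity
  have hmf : ∀ k, m k ≤ f k + F.mass k * m (F.parent k) := by
    intro k
    have h := F.enorm_rpow_le_diff hp0 hp1 g k
    rw [enorm_rpow_eq_ofReal hp0, enorm_rpow_eq_ofReal hp0, enorm_rpow_eq_ofReal hp0,
      ← ENNReal.ofReal_coe_nnreal, ← ENNReal.ofReal_mul (by positivity),
      ← ENNReal.ofReal_add (by positivity) (by positivity)] at h
    exact (ENNReal.ofReal_le_ofReal_iff (by positivity)).1 h
  -- Every node is charged `T / 2`. By `h2` the inherited part is at most `∑_B (m u - T)`, so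
  -- comparing both sides leaves `T / 2` per node of `B` to be paid by the increments.
  have h1 : ∑ k ∈ B, (m k - T / 2)
      ≤ ∑ k ∈ B, f k + ∑ k ∈ B, max (F.mass k * m (F.parent k) - T / 2) 0 := by
    rw [← Finset.sum_add_distrib]
    refine Finset.sum_le_sum fun k _ => ?_
    have := hmf k
    have := le_max_left ((F.mass k : ℝ) * m (F.parent k) - T / 2) 0
    linarith
  have h2 : ∑ k ∈ B, max (F.mass k * m (F.parent k) - T / 2) 0
      ≤ ∑ u ∈ B, (m u - 2 * (T / 2)) := by
    have hzero : ∑ k ∈ B, max (F.mass k * m (F.parent k) - T / 2) 0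
        = ∑ k ∈ B with F.parent k ∈ B, max (F.mass k * m (F.parent k) - T / 2) 0 := by
      rw [Finset.sum_filter]
      refine Finset.sum_congr rfl fun k _ => ?_
      split_ifs with h
      · rfl
      -- A parent outside `B` carries at most `T`, so the child inherits at most `T / 2`.
      · refine max_eq_right ?_
        have h2 : (F.mass k : ℝ) ≤ 1 / 2 := by exact_mod_cast F.mass_le k
        have h3 : (F.mass k : ℝ) * m (F.parent k) ≤ 1 / 2 * T :=
          mul_le_mul h2 (hB' _ h) (hm0 _) (by norm_num)
        linarith
    rw [hzero, ← Finset.sum_fiberwise_of_maps_to (t := B) (g := F.parent)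
      (fun k hk => (Finset.mem_filter.1 hk).2)]
    refine Finset.sum_le_sum fun u hu => ?_
    have h4 := F.sum_max_fiber_le B u (m := m u) (s := T / 2) (by linarith)
      (by have := hB u hu; simp only [hm]; linarith)
    refine le_trans (le_of_eq ?_) h4
    rw [Finset.filter_filter]
    have : {k ∈ B | F.parent k ∈ B ∧ F.parent k = u} = {k ∈ B | F.parent k = u} := by
      ext k
      simp only [Finset.mem_filter]
      constructor
      · rintro ⟨h, -, h'⟩; exact ⟨h, h'⟩
      · rintro ⟨h, h'⟩; exact ⟨h, h' ▸ hu, h'⟩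
    rw [this]
    refine Finset.sum_congr rfl fun k hk => ?_
    rw [(Finset.mem_filter.1 hk).2]
  have h3 : B.card * T ≤ 2 * ∑ k ∈ B, f k := by
    rw [Finset.sum_sub_distrib, Finset.sum_const, nsmul_eq_mul] at h1 h2
    linarith
  calc (B.card : ℝ≥0∞) * ENNReal.ofReal T = ENNReal.ofReal (B.card * T) := by
        rw [ENNReal.ofReal_mul (by positivity), ENNReal.ofReal_natCast]
    _ ≤ ENNReal.ofReal (2 * ∑ k ∈ B, f k) := ENNReal.ofReal_le_ofReal h3
    _ = 2 * ∑ k ∈ B, ‖F.diff 𝕜 p g k‖ₑ ^ p := by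
        rw [ENNReal.ofReal_mul (by norm_num), ENNReal.ofReal_sum_of_nonneg (fun k _ => hf0 k)]
        simp [hf, enorm_rpow_eq_ofReal hp0]
    _ ≤ _ := by gcongr; exact sum_le_pen _ _

lemma pen_diff_restr_le_sum (hp0 : 0 < p) (hp1 : p ≤ 1) (A : Finset ℕ) (a : ℕ → 𝕜) :
    pen p (F.diff 𝕜 p (restr A a)) ≤ 2 * ∑ k ∈ A, ‖a k‖ₑ ^ p :=
  (F.pen_diff_le hp0 hp1 _).trans (by rw [pen_restr hp0])

/-- With `g = a - S_D a` one has `a - S_A a = (g - S_(A \ D) g) + S_(D \ A) a`. The set `A \ D` is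
greedy for `g`, so the first term costs `1 + 4`. The coefficients on `D \ A` are at most the
smallest one on `A \ D`, a set at least as large, so democracy bounds the second term by `4`. -/
lemma pen_diff_sub_greedy_le (hp0 : 0 < p) (hp1 : p ≤ 1) (a : ℕ → 𝕜) (A D : Finset ℕ)
    (hA : ∀ n ∈ A, ∀ k ∉ A, ‖a k‖ ≤ ‖a n‖) (hDA : D.card ≤ A.card) :
    pen p (F.diff 𝕜 p (a - restr A a)) ≤ 9 * pen p (F.diff 𝕜 p (a - restr D a)) := by
  set g := a - restr D a with hg
  have hgk : ∀ k, g k = if k ∈ D then 0 else a k := by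
    intro k; by_cases h : k ∈ D <;> simp [hg, restr_apply, h]
  have hdec : a - restr A a = (g - restr (A \ D) g) + restr (D \ A) a := by
    funext k
    by_cases h : k ∈ D <;> by_cases h' : k ∈ A <;> simp [hgk, restr_apply, h, h']
  have hgreedy : ∀ n ∈ A \ D, ∀ k ∉ A \ D, ‖g k‖ ≤ ‖g n‖ := by
    intro n hn k hk
    rw [Finset.mem_sdiff] at hn hk
    rw [hgk, hgk, if_neg hn.2]
    split_ifs with h
    · simp
    · exact hA n hn.1 k fun h' => hk ⟨h', h⟩
  have h1 : pen p (F.diff 𝕜 p (g - restr (A \ D) g)) ≤ 5 * pen p (F.diff 𝕜 p g) := by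
    rw [map_sub]
    refine (pen_sub_le hp0 hp1 _ _).trans ?_
    calc _ ≤ pen p (F.diff 𝕜 p g) + 4 * pen p (F.diff 𝕜 p g) := by
          gcongr; exact F.pen_diff_restr_greedy_le hp0 hp1 _ _ hgreedy
      _ = _ := by ring
  have h2 : pen p (F.diff 𝕜 p (restr (D \ A) a)) ≤ 4 * pen p (F.diff 𝕜 p g) := by
    refine (F.pen_diff_restr_le_sum hp0 hp1 _ _).trans ?_
    have hcard : (D \ A).card ≤ (A \ D).card := by
      have h3 := Finset.card_sdiff_add_card_inter D A
      have h4 := Finset.card_sdiff_add_card_inter A D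
      rw [Finset.inter_comm] at h4
      omega
    rcases (A \ D).eq_empty_or_nonempty with he | hne
    · have : D \ A = ∅ := by
        rw [← Finset.card_eq_zero]; rw [he] at hcard; simpa using hcard
      simp [this]
    · obtain ⟨n, hn, hmin⟩ := Finset.exists_min_image (A \ D) (fun k => ‖a k‖) hne
      have hnA := (Finset.mem_sdiff.1 hn).1
      have hnD := (Finset.mem_sdiff.1 hn).2
      have h5 := F.card_mul_le_pen_diff hp0 hp1 (A \ D) g (T := ‖a n‖ ^ p) (by positivity)
        (fun k hk => by
          rw [hgk, if_neg (Finset.mem_sdiff.1 hk).2]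
          exact Real.rpow_le_rpow (norm_nonneg _) (hmin k hk) hp0.le)
        (fun k hk => by
          refine Real.rpow_le_rpow (norm_nonneg _) ((hgreedy n hn k hk).trans ?_) hp0.le
          rw [hgk, if_neg hnD])
      calc 2 * ∑ k ∈ D \ A, ‖a k‖ₑ ^ p
          ≤ 2 * ∑ k ∈ D \ A, ENNReal.ofReal (‖a n‖ ^ p) := by
            gcongr with k hk
            rw [enorm_rpow_eq_ofReal hp0]
            exact ENNReal.ofReal_le_ofReal (Real.rpow_le_rpow (norm_nonneg _)
              (hA n hnA k (Finset.mem_sdiff.1 hk).2) hp0.le)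
        _ ≤ 2 * ((A \ D).card * ENNReal.ofReal (‖a n‖ ^ p)) := by
            rw [Finset.sum_const, nsmul_eq_mul]; gcongr
        _ ≤ 2 * (2 * pen p (F.diff 𝕜 p g)) := by gcongr
        _ = _ := by ring
  rw [hdec, map_add]
  calc _ ≤ _ := pen_add_le hp0 hp1 _ _
    _ ≤ 5 * pen p (F.diff 𝕜 p g) + 4 * pen p (F.diff 𝕜 p g) := add_le_add h1 h2
    _ = _ := by ring

/-- The fraction of its `R`-th ancestor that a node receives. -/
noncomputable def branchMass : ℕ → ℕ → ℝ≥0∞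
  | 0, _ => 1
  | R + 1, k => F.mass k * branchMass R (F.parent k)

lemma tsum_branchMass_mul_le (R : ℕ) (G : ℕ → ℝ≥0∞) :
    ∑' k, F.branchMass R k * G (F.parent^[R] k) ≤ ∑' u, G u := by
  induction R generalizing G with
  | zero => simp [branchMass]
  | succ R ih =>
    refine le_trans (le_of_eq ?_)
      ((F.tsum_mass_mul_le fun k => F.branchMass R k * G (F.parent^[R] k)).trans (ih G))
    simp [branchMass, mul_assoc]

lemma enorm_rpow_le_sum_branchMass (hp0 : 0 < p) (hp1 : p ≤ 1) (a : ℕ → 𝕜) (R k : ℕ) :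
    ‖a k‖ₑ ^ p ≤ ∑ r ∈ Finset.range R,
        F.branchMass r k * ‖F.diff 𝕜 p a (F.parent^[r] k)‖ₑ ^ p
      + F.branchMass R k * ‖a (F.parent^[R] k)‖ₑ ^ p := by
  induction R generalizing k with
  | zero => simp [branchMass]
  | succ R ih =>
    refine (F.enorm_rpow_le_diff hp0 hp1 a k).trans ?_
    rw [Finset.sum_range_succ']
    simp only [branchMass, Function.iterate_succ_apply, Function.iterate_zero, id, one_mul]
    refine (add_le_add le_rfl (mul_le_mul' le_rfl (ih (F.parent k)))).trans (le_of_eq ?_)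
    rw [mul_add, Finset.mul_sum]
    simp only [mul_assoc]
    ring

lemma enorm_rpow_le_sum_diff (hp0 : 0 < p) (hp1 : p ≤ 1) (a : ℕ → 𝕜) (k : ℕ) :
    ‖a k‖ₑ ^ p ≤ ∑ u ∈ Finset.range (k + 1), ‖F.diff 𝕜 p a u‖ₑ ^ p := by
  induction k using Nat.strong_induction_on with
  | _ k ih =>
    refine (F.enorm_rpow_le_diff hp0 hp1 a k).trans ?_
    rw [Finset.sum_range_succ, add_comm]
    refine add_le_add ?_ le_rfl
    by_cases hq : F.mass k = 0
    · simp [hq]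
    · have hlt := F.parent_lt k hq
      have h1 : (F.mass k : ℝ≥0∞) ≤ 1 := by
        have : F.mass k ≤ 1 := (F.mass_le k).trans (by norm_num)
        exact_mod_cast this
      calc _ ≤ 1 * ‖a (F.parent k)‖ₑ ^ p := by gcongr
        _ ≤ _ := by
          rw [one_mul]
          exact (ih _ hlt).trans (Finset.sum_le_sum_of_subset
            (Finset.range_subset_range.2 hlt))

lemma enorm_rpow_le_pen_diff (hp0 : 0 < p) (hp1 : p ≤ 1) (a : ℕ → 𝕜) (k : ℕ) :
    ‖a k‖ₑ ^ p ≤ pen p (F.diff 𝕜 p a) :=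
  (F.enorm_rpow_le_sum_diff hp0 hp1 a k).trans (sum_le_pen _ _)

/-- Each of the first `R` generations of ancestors contributes at most one full energy, by
conservation. What is inherited from the `R`-th ancestors is bounded pointwise, and the `|A|` such
terms add up to at most `K` energies. -/
lemma sum_enorm_rpow_le (hp0 : 0 < p) (hp1 : p ≤ 1) (A : Finset ℕ) (a : ℕ → 𝕜) (R : ℕ)
    {K : ℝ≥0∞} (hK : ∀ k, A.card * F.branchMass R k ≤ K) :
    ∑ k ∈ A, ‖a k‖ₑ ^ p ≤ (R + K) * pen p (F.diff 𝕜 p a) := by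
  set N := pen p (F.diff 𝕜 p a) with hN
  calc ∑ k ∈ A, ‖a k‖ₑ ^ p
      ≤ ∑ k ∈ A, (∑ r ∈ Finset.range R,
          F.branchMass r k * ‖F.diff 𝕜 p a (F.parent^[r] k)‖ₑ ^ p + F.branchMass R k * N) := by
        refine Finset.sum_le_sum fun k _ =>
          (F.enorm_rpow_le_sum_branchMass hp0 hp1 a R k).trans ?_
        gcongr
        exact F.enorm_rpow_le_pen_diff hp0 hp1 a _
    _ = ∑ r ∈ Finset.range R, ∑ k ∈ A,
          F.branchMass r k * ‖F.diff 𝕜 p a (F.parent^[r] k)‖ₑ ^ p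
        + ∑ k ∈ A, F.branchMass R k * N := by
        rw [Finset.sum_add_distrib, Finset.sum_comm]
    _ ≤ ∑ r ∈ Finset.range R, N + K * N := by
        gcongr with r hr
        · exact (ENNReal.sum_le_tsum A).trans
            (F.tsum_branchMass_mul_le r fun u => ‖F.diff 𝕜 p a u‖ₑ ^ p)
        · rcases A.eq_empty_or_nonempty with rfl | hne
          · simp
          · have hc0 : (A.card : ℝ≥0∞) ≠ 0 := by simp [hne.ne_empty]
            have hc1 : (A.card : ℝ≥0∞) ≠ ∞ := ENNReal.natCast_ne_top _
            calc ∑ k ∈ A, F.branchMass R k * N ≤ ∑ k ∈ A, (K / A.card) * N := by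
                  refine Finset.sum_le_sum fun k _ => ?_
                  gcongr
                  rw [ENNReal.le_div_iff_mul_le (Or.inl hc0) (Or.inl hc1), mul_comm]
                  exact hK k
              _ = K * N := by
                  rw [Finset.sum_const, nsmul_eq_mul, ← mul_assoc, ENNReal.mul_div_cancel hc0 hc1]
    _ = _ := by rw [Finset.sum_const, nsmul_eq_mul, Finset.card_range]; ring

end MassForest

/-! ### Bases of forest type -/

/-- An isomorphism of `Y` with the closed span in `ℓ_p` of the vectors of the forest `F`. -/
structure ForestModel (F : MassForest) (𝕜 : Type*) [RCLike 𝕜] (p : ℝ) (Y : Type*)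
    [AddCommGroup Y] [Module 𝕜 Y] [Norm Y] where
  toSeq : Y →ₗ[𝕜] (ℕ → 𝕜)
  const : NNReal
  one_le_const : 1 ≤ const
  norm_nonneg : ∀ f : Y, 0 ≤ ‖f‖
  pen_le : ∀ f, pen p (toSeq f) ≤ const * ENNReal.ofReal (‖f‖ ^ p)
  le_pen : ∀ f, ENNReal.ofReal (‖f‖ ^ p) ≤ const * pen p (toSeq f)
  eq_zero : ∀ f, toSeq f = 0 → f = 0
  vec : ℕ → Y
  toSeq_vec : ∀ k, toSeq (vec k) = F.diff 𝕜 p (Pi.single k 1)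
  dense : ∀ f, ∀ ε : ℝ≥0∞, ε ≠ 0 → ∃ (A : Finset ℕ) (a : ℕ → 𝕜),
    pen p (toSeq f - F.diff 𝕜 p (restr A a)) ≤ ε

namespace ForestModel

variable {F : MassForest} {𝕜 : Type*} [RCLike 𝕜] {p : ℝ} {Y : Type*} [AddCommGroup Y]
  [Module 𝕜 Y] [Norm Y] (M : ForestModel F 𝕜 p Y)

/-- The coefficients of `f` with respect to the vectors of the forest. -/
noncomputable def coef (hp0 : 0 < p) : Y →ₗ[𝕜] (ℕ → 𝕜) :=
  (F.diffEquiv 𝕜 hp0).symm.toLinearMap ∘ₗ M.toSeq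

lemma diff_coef (hp0 : 0 < p) (f : Y) : F.diff 𝕜 p (M.coef hp0 f) = M.toSeq f :=
  (F.diffEquiv 𝕜 hp0).apply_symm_apply (M.toSeq f)

lemma coef_vec (hp0 : 0 < p) (k : ℕ) : M.coef hp0 (M.vec k) = Pi.single k 1 :=
  F.eq_of_diff_eq hp0 (by rw [diff_coef, toSeq_vec])

lemma coef_sum (hp0 : 0 < p) (A : Finset ℕ) (a : ℕ → 𝕜) :
    M.coef hp0 (∑ k ∈ A, a k • M.vec k) = restr A a := by
  simp_rw [map_sum, map_smul, coef_vec, restr_eq_sum]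

lemma toSeq_sum (hp0 : 0 < p) (A : Finset ℕ) (a : ℕ → 𝕜) :
    M.toSeq (∑ k ∈ A, a k • M.vec k) = F.diff 𝕜 p (restr A a) := by
  rw [← M.diff_coef hp0, coef_sum]

lemma norm_le_of_pen_le (hp0 : 0 < p) {f g : Y} {C : NNReal}
    (h : pen p (M.toSeq f) ≤ C * pen p (M.toSeq g)) :
    ‖f‖ ≤ ((M.const * C * M.const : NNReal) : ℝ) ^ (1 / p) * ‖g‖ := by
  have h1 : ENNReal.ofReal (‖f‖ ^ p)
      ≤ ENNReal.ofReal ((M.const * C * M.const : NNReal) * ‖g‖ ^ p) := by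
    rw [ENNReal.ofReal_mul (by positivity), ENNReal.ofReal_coe_nnreal]
    push_cast
    calc _ ≤ _ := M.le_pen f
      _ ≤ M.const * (C * (M.const * ENNReal.ofReal (‖g‖ ^ p))) := by
        gcongr
        exact h.trans (by gcongr; exact M.pen_le g)
      _ = _ := by ring
  have hg := M.norm_nonneg g
  have hf := M.norm_nonneg f
  have h2 := (ENNReal.ofReal_le_ofReal_iff (by positivity)).1 h1
  have h3 := Real.rpow_le_rpow (by positivity) h2 (by positivity : 0 ≤ 1 / p)
  rw [Real.mul_rpow (by positivity) (by positivity), one_div, Real.rpow_rpow_inv hf hp0.ne',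
    Real.rpow_rpow_inv hg hp0.ne'] at h3
  rwa [one_div]

lemma tendsto_norm_iff (hp0 : 0 < p) (u : ℕ → Y) :
    Tendsto (fun n => ‖u n‖) atTop (𝓝 0) ↔ Tendsto (fun n => pen p (M.toSeq (u n))) atTop (𝓝 0) := by
  have key : Tendsto (fun n => ‖u n‖) atTop (𝓝 0) ↔
      Tendsto (fun n => ENNReal.ofReal (‖u n‖ ^ p)) atTop (𝓝 0) := by
    constructor
    · intro h
      have h1 : Tendsto (fun n => ‖u n‖ ^ p) atTop (𝓝 (0 ^ p)) := h.rpow_const (Or.inr hp0.le)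
      rw [Real.zero_rpow hp0.ne'] at h1
      simpa using ENNReal.tendsto_ofReal h1
    · intro h
      have h1 := (ENNReal.tendsto_toReal ENNReal.zero_ne_top).comp h
      have h2 : Tendsto (fun n => ‖u n‖ ^ p) atTop (𝓝 0) := by
        refine h1.congr fun n => ?_
        have := M.norm_nonneg (u n)
        simp only [Function.comp]
        rw [ENNReal.toReal_ofReal (by positivity)]
      have h3 := h2.rpow_const (p := p⁻¹) (Or.inr (by positivity))
      rw [Real.zero_rpow (by positivity)] at h3
      exact h3.congr fun n => Real.rpow_rpow_inv (M.norm_nonneg _) hp0.ne'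
  rw [key]
  constructor
  · intro h
    have h1 := ENNReal.Tendsto.const_mul h (a := (M.const : ℝ≥0∞)) (Or.inr ENNReal.coe_ne_top)
    rw [mul_zero] at h1
    exact tendsto_of_tendsto_of_tendsto_of_le_of_le tendsto_const_nhds h1 (fun _ => zero_le)
      fun n => M.pen_le _
  · intro h
    have h1 := ENNReal.Tendsto.const_mul h (a := (M.const : ℝ≥0∞)) (Or.inr ENNReal.coe_ne_top)
    rw [mul_zero] at h1
    exact tendsto_of_tendsto_of_tendsto_of_le_of_le tendsto_const_nhds h1 (fun _ => zero_le)
      fun n => M.le_pen _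

/-- A finite combination close to `f` is reproduced by all late partial sums, so only the difference
matters; the partial sum operators at most double its energy, whence `1 + 2 = 3` times `ε / 3`. -/
lemma tendsto_partial_sums (hp0 : 0 < p) (hp1 : p ≤ 1) (f : Y) :
    Tendsto (fun N : ℕ => ‖f - ∑ n ∈ Finset.range N, M.coef hp0 f n • M.vec n‖) atTop (𝓝 0) := by
  rw [M.tendsto_norm_iff hp0, ENNReal.tendsto_atTop_zero]
  intro ε hε
  obtain ⟨A, b, hA⟩ := M.dense f (ε / 3) (ENNReal.div_pos hε.ne' (by norm_num)).ne'
  refine ⟨A.sup id + 1, fun n hn => ?_⟩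
  set c := M.coef hp0 f with hc
  set c' : ℕ → 𝕜 := restr A b with hc'
  rw [map_sub, M.toSeq_sum hp0, ← M.diff_coef hp0, ← hc, ← map_sub]
  rw [← M.diff_coef hp0, ← hc, ← map_sub] at hA
  have h1 : restr (Finset.range n) c' = c' := by
    funext k
    simp only [hc', restr_apply]
    by_cases hk : k ∈ A
    · have : k ≤ A.sup id := Finset.le_sup (f := id) hk
      simp [hk]; omega
    · simp [hk]
  have h2 : c - restr (Finset.range n) c = (c - c') - restr (Finset.range n) (c - c') := by
    rw [map_sub, h1]; abel
  rw [h2, map_sub]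
  calc _ ≤ _ := pen_sub_le hp0 hp1 _ _
    _ ≤ ε / 3 + 2 * (ε / 3) := by
      gcongr
      exact (F.pen_diff_restr_range_le hp0 hp1 n _).trans
        (by gcongr; exact (sum_le_pen _ _).trans hA)
    _ = 3 * (ε / 3) := by ring
    _ = ε := ENNReal.mul_div_cancel (by norm_num) (by norm_num)

lemma pen_toSeq_vec_bounds (hp0 : 0 < p) (hp1 : p ≤ 1) (k : ℕ) :
    1 ≤ pen p (M.toSeq (M.vec k)) ∧ pen p (M.toSeq (M.vec k)) ≤ 2 := by
  rw [M.toSeq_vec]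
  constructor
  · have := F.enorm_rpow_le_pen_diff hp0 hp1 (Pi.single k (1 : 𝕜)) k
    simpa using this
  · exact (F.pen_diff_le hp0 hp1 _).trans (by rw [pen_single hp0, mul_one])

/-- The basis of `Y` given by the vectors of the forest. -/
noncomputable def basis (hp0 : 0 < p) (hp1 : p ≤ 1) : QBasis 𝕜 Y where
  vec := M.vec
  coord k := LinearMap.proj k ∘ₗ M.coef hp0
  biorthogonal i j := by
    simp [coef_vec, Pi.single_apply]
  seminormalized := by
    have hK : (0 : ℝ) < M.const := lt_of_lt_of_le one_pos (by exact_mod_cast M.one_le_const)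
    refine ⟨(1 / M.const : ℝ) ^ (1 / p), (2 * M.const : ℝ) ^ (1 / p), by positivity, fun n => ?_⟩
    obtain ⟨h1, h2⟩ := M.pen_toSeq_vec_bounds hp0 hp1 n
    have hv := M.norm_nonneg (M.vec n)
    have e : (‖M.vec n‖ ^ p) ^ (1 / p) = ‖M.vec n‖ := by
      rw [one_div]; exact Real.rpow_rpow_inv hv hp0.ne'
    constructor
    · have h3 := h1.trans (M.pen_le (M.vec n))
      rw [← ENNReal.ofReal_coe_nnreal, ← ENNReal.ofReal_mul hK.le, ENNReal.one_le_ofReal] at h3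
      rw [← e]
      refine Real.rpow_le_rpow (by positivity) ?_ (by positivity)
      rw [div_le_iff₀ hK]; linarith
    · have h3 := (M.le_pen (M.vec n)).trans (mul_le_mul' le_rfl h2)
      rw [← ENNReal.ofReal_coe_nnreal, ← ENNReal.ofReal_ofNat 2, ← ENNReal.ofReal_mul hK.le,
        ENNReal.ofReal_le_ofReal_iff (by positivity)] at h3
      rw [← e]
      refine Real.rpow_le_rpow (by positivity) ?_ (by positivity)
      linarith
  coord_bounded := by
    refine ⟨(M.const : ℝ) ^ (1 / p), fun n f => ?_⟩
    have hf := M.norm_nonneg f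
    have h1 := (F.enorm_rpow_le_pen_diff hp0 hp1 (M.coef hp0 f) n).trans
      ((M.diff_coef hp0 f).symm ▸ M.pen_le f)
    rw [enorm_rpow_eq_ofReal hp0, ← ENNReal.ofReal_coe_nnreal, ← ENNReal.ofReal_mul (by positivity),
      ENNReal.ofReal_le_ofReal_iff (by positivity)] at h1
    have h3 := Real.rpow_le_rpow (by positivity) h1 (by positivity : 0 ≤ 1 / p)
    rw [Real.mul_rpow (by positivity) (by positivity), one_div,
      Real.rpow_rpow_inv (_root_.norm_nonneg _) hp0.ne', Real.rpow_rpow_inv hf hp0.ne'] at h3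
    rw [one_div]
    exact h3
  fundamental f ε hε := by
    have h := (M.tendsto_partial_sums hp0 hp1 f).eventually (gt_mem_nhds hε)
    obtain ⟨N, hN⟩ := h.exists
    exact ⟨_, Submodule.sum_mem _ fun n _ =>
      Submodule.smul_mem _ _ (Submodule.subset_span ⟨n, rfl⟩), hN⟩
  total f hf := by
    refine M.eq_zero f ?_
    rw [← M.diff_coef hp0, show M.coef hp0 f = 0 from funext hf, map_zero]

lemma basis_proj (hp0 : 0 < p) (hp1 : p ≤ 1) (A : Finset ℕ) (f : Y) :
    (M.basis hp0 hp1).proj A f = ∑ n ∈ A, M.coef hp0 f n • M.vec n := rfl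

lemma toSeq_basis_proj (hp0 : 0 < p) (hp1 : p ≤ 1) (A : Finset ℕ) (f : Y) :
    M.toSeq ((M.basis hp0 hp1).proj A f) = F.diff 𝕜 p (restr A (M.coef hp0 f)) := by
  rw [basis_proj, toSeq_sum M hp0]

lemma basis_isSchauder (hp0 : 0 < p) (hp1 : p ≤ 1) : (M.basis hp0 hp1).IsSchauder := by
  intro f
  refine ⟨M.coef hp0 f, M.tendsto_partial_sums hp0 hp1 f, fun b hb => ?_⟩
  change Tendsto (fun N : ℕ => ‖f - ∑ n ∈ Finset.range N, b n • M.vec n‖) atTop (𝓝 0) at hb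
  rw [M.tendsto_norm_iff hp0] at hb
  funext k
  -- For `N > k` the `k`-th coefficient of the remainder is `coef k - b k`, and it is controlled by
  -- the energy of the remainder, which tends to zero.
  have h1 : ‖M.coef hp0 f k - b k‖ₑ ^ p ≤ 0 := by
    refine ge_of_tendsto hb ?_
    filter_upwards [eventually_gt_atTop k] with N hN
    have h2 := F.enorm_rpow_le_pen_diff hp0 hp1
      (M.coef hp0 (f - ∑ n ∈ Finset.range N, b n • M.vec n)) k
    rw [M.diff_coef hp0, map_sub, M.coef_sum hp0] at h2
    simpa [restr_apply, hN] using h2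
  have h2 : M.coef hp0 f k - b k = 0 := by
    simpa [ENNReal.rpow_eq_zero_iff, hp0, not_lt.2 hp0.le] using h1
  exact (sub_eq_zero.1 h2).symm

lemma basis_isAlmostGreedy (hp0 : 0 < p) (hp1 : p ≤ 1) : (M.basis hp0 hp1).IsAlmostGreedy := by
  refine ⟨((M.const * 9 * M.const : NNReal) : ℝ) ^ (1 / p), fun f A D hA hDA => ?_⟩
  refine M.norm_le_of_pen_le hp0 ?_
  rw [map_sub, map_sub, toSeq_basis_proj, toSeq_basis_proj, ← M.diff_coef hp0, ← map_sub,
    ← map_sub]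
  exact F.pen_diff_sub_greedy_le hp0 hp1 (M.coef hp0 f) A D hA hDA

lemma basis_condConst_le (hp0 : 0 < p) (hp1 : p ≤ 1) {m : ℕ} {x : ℝ} (hx : 0 ≤ x) {C : ℝ}
    (hC : 0 ≤ C)
    (h : ∀ (A : Finset ℕ) (a : ℕ → 𝕜), A.card ≤ m →
      pen p (F.diff 𝕜 p (restr A a)) ≤ ENNReal.ofReal (C * x) * pen p (F.diff 𝕜 p a)) :
    (M.basis hp0 hp1).condConst m
      ≤ ENNReal.ofReal ((M.const * C * M.const : ℝ) ^ (1 / p) * x ^ (1 / p)) := by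
  unfold QBasis.condConst
  refine iSup₂_le fun A hA => iSup₂_le fun f hf => ENNReal.ofReal_le_ofReal ?_
  have hf0 := M.norm_nonneg f
  have h1 : pen p (M.toSeq ((M.basis hp0 hp1).proj A f))
      ≤ (Real.toNNReal (C * x) : NNReal) * pen p (M.toSeq f) := by
    rw [toSeq_basis_proj]
    refine (h A _ hA).trans ?_
    rw [M.diff_coef hp0]; rfl
  refine (M.norm_le_of_pen_le hp0 h1).trans ?_
  have hCx : 0 ≤ C * x := mul_nonneg hC hx
  rw [← Real.mul_rpow (by positivity) hx]
  push_cast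
  rw [Real.coe_toNNReal _ hCx]
  calc _ ≤ ((M.const : ℝ) * (C * x) * M.const) ^ (1 / p) * 1 := by gcongr
    _ = _ := by rw [mul_one]; congr 1; ring

lemma le_basis_condConst (hp0 : 0 < p) (hp1 : p ≤ 1) {m : ℕ} {x : ℝ} (hx : 0 ≤ x)
    (s A : Finset ℕ) (a : ℕ → 𝕜) (hA : A.card ≤ m) {c : ℝ} (hc : 0 ≤ c)
    (h1 : pen p (F.diff 𝕜 p (restr s a)) ≤ 2)
    (h2 : ENNReal.ofReal (c * x) ≤ pen p (F.diff 𝕜 p (restr A (restr s a)))) :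
    ENNReal.ofReal ((c / (2 * M.const ^ 2) : ℝ) ^ (1 / p) * x ^ (1 / p))
      ≤ (M.basis hp0 hp1).condConst m := by
  have hK : (1 : ℝ) ≤ M.const := by exact_mod_cast M.one_le_const
  have hK0 : (0 : ℝ) < M.const := by linarith
  -- Scaling into the unit ball: the combination has energy at most `2`, and passing from energy to
  -- norm costs `const`.
  set t : ℝ := (1 / (2 * M.const)) ^ (1 / p) with ht
  have ht0 : 0 ≤ t := by positivity
  have htp : t ^ p = 1 / (2 * M.const) := by
    rw [ht, one_div p]; exact Real.rpow_inv_rpow (by positivity) hp0.ne'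
  have htn : ‖(t : 𝕜)‖ₑ ^ p = ENNReal.ofReal (1 / (2 * M.const)) := by
    rw [enorm_rpow_eq_ofReal hp0, RCLike.norm_ofReal, abs_of_nonneg ht0, htp]
  set f : Y := (t : 𝕜) • ∑ k ∈ s, a k • M.vec k with hf
  have hcoef : M.coef hp0 f = (t : 𝕜) • restr s a := by
    rw [hf, map_smul, coef_sum]
  have hf0 := M.norm_nonneg f
  have hfle : ‖f‖ ≤ 1 := by
    have h3 : ENNReal.ofReal (‖f‖ ^ p) ≤ 1 := by
      calc _ ≤ _ := M.le_pen f
        _ = M.const * (‖(t : 𝕜)‖ₑ ^ p * pen p (F.diff 𝕜 p (restr s a))) := by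
          rw [← M.diff_coef hp0, hcoef, map_smul, pen_smul hp0]
        _ ≤ M.const * (ENNReal.ofReal (1 / (2 * M.const)) * 2) := by
          rw [htn]; gcongr
        _ = ENNReal.ofReal (M.const * (1 / (2 * M.const) * 2)) := by
          rw [ENNReal.ofReal_mul hK0.le, ENNReal.ofReal_coe_nnreal,
            ENNReal.ofReal_mul (by positivity), ENNReal.ofReal_ofNat]
        _ = 1 := by
          rw [show (M.const : ℝ) * (1 / (2 * M.const) * 2) = 1 by field_simp]; simp
    rw [ENNReal.ofReal_le_one] at h3
    by_contra hlt
    exact absurd h3 (not_le.2 (Real.one_lt_rpow (not_le.1 hlt) hp0))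
  unfold QBasis.condConst
  refine le_trans ?_ (le_iSup₂_of_le A hA (le_iSup₂_of_le f hfle le_rfl))
  refine ENNReal.ofReal_le_ofReal ?_
  set g := (M.basis hp0 hp1).proj A f with hg
  have hg0 := M.norm_nonneg g
  have h3 : ENNReal.ofReal (1 / (2 * M.const) * (c * x)) ≤ ENNReal.ofReal (M.const * ‖g‖ ^ p) := by
    calc _ = ‖(t : 𝕜)‖ₑ ^ p * ENNReal.ofReal (c * x) := by
          rw [htn, ENNReal.ofReal_mul (by positivity)]
      _ ≤ ‖(t : 𝕜)‖ₑ ^ p * pen p (F.diff 𝕜 p (restr A (restr s a))) := by gcongr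
      _ = pen p (M.toSeq g) := by
          rw [hg, toSeq_basis_proj, hcoef, map_smul, map_smul, pen_smul hp0]
      _ ≤ _ := by
          rw [ENNReal.ofReal_mul hK0.le, ENNReal.ofReal_coe_nnreal]
          exact M.pen_le g
  rw [ENNReal.ofReal_le_ofReal_iff (by positivity)] at h3
  have h4 : c / (2 * M.const ^ 2) * x ≤ ‖g‖ ^ p := by
    rw [← mul_le_mul_iff_right₀ hK0]
    refine le_trans (le_of_eq ?_) h3
    field_simp
  have h5 := Real.rpow_le_rpow (by positivity) h4 (by positivity : 0 ≤ 1 / p)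
  rw [Real.mul_rpow (by positivity) hx] at h5
  refine h5.trans (le_of_eq ?_)
  rw [one_div]; exact Real.rpow_rpow_inv hg0 hp0.ne'

/-- The vectors of a forest form an almost greedy Schauder basis, and its conditionality constants
are governed by the combinatorics of the forest. -/
theorem exists_basis (M : ForestModel F 𝕜 p Y) (hp0 : 0 < p) (hp1 : p ≤ 1) (ψ : ℕ → ℝ) (hψ : ∀ m, 0 ≤ ψ m) {c C : ℝ}
    (hc : 0 < c) (hC : 0 < C)
    (hupper : ∀ m, 2 ≤ m → ∃ (R : ℕ) (K : NNReal), (R + K : ℝ) ≤ C * ψ m ∧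
      ∀ k, (m : ℝ≥0∞) * F.branchMass R k ≤ K)
    (hlower : ∀ m, 2 ≤ m → ∃ (s A : Finset ℕ) (a : ℕ → 𝕜), A.card ≤ m ∧
      pen p (F.diff 𝕜 p (restr s a)) ≤ 2 ∧
      ENNReal.ofReal (c * ψ m) ≤ pen p (F.diff 𝕜 p (restr A (restr s a)))) :
    ∃ B : QBasis 𝕜 Y, B.IsSchauder ∧ B.IsAlmostGreedy ∧
      B.CondConstEquiv (fun m => ψ m ^ (1 / p)) := by
  have hK : (0 : ℝ) < M.const := lt_of_lt_of_le one_pos (by exact_mod_cast M.one_le_const)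
  refine ⟨M.basis hp0 hp1, M.basis_isSchauder hp0 hp1, M.basis_isAlmostGreedy hp0 hp1,
    (c / (2 * M.const ^ 2) : ℝ) ^ (1 / p), (M.const * (2 * C) * M.const : ℝ) ^ (1 / p),
    by positivity, by positivity, fun m hm => ⟨?_, ?_⟩⟩
  · obtain ⟨s, A, a, hA, h1, h2⟩ := hlower m hm
    exact M.le_basis_condConst hp0 hp1 (hψ m) s A a hA hc.le h1 h2
  · obtain ⟨R, K, hRK, hb⟩ := hupper m hm
    refine M.basis_condConst_le hp0 hp1 (hψ m) (by positivity) fun A a hA => ?_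
    -- The crude bound without cancellation is enough: the projection has at most twice the energy
    -- of its coefficients.
    refine (F.pen_diff_restr_le_sum hp0 hp1 A a).trans ?_
    have h3 := F.sum_enorm_rpow_le hp0 hp1 A a R (K := K) fun k =>
      le_trans (by gcongr) (hb k)
    calc _ ≤ 2 * ((R + K) * pen p (F.diff 𝕜 p a)) := by gcongr
      _ = ENNReal.ofReal (2 * (R + K)) * pen p (F.diff 𝕜 p a) := by
        rw [ENNReal.ofReal_mul (by norm_num), ENNReal.ofReal_add (by positivity) (by positivity),
          ENNReal.ofReal_natCast, ENNReal.ofReal_coe_nnreal, ENNReal.ofReal_ofNat, mul_assoc]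
      _ ≤ _ := by
        refine mul_le_mul' (ENNReal.ofReal_le_ofReal ?_) le_rfl
        linarith

end ForestModel

/-! ### The trees of the Lindenstrauss spaces -/

section DeltaTree

variable {δ : ℕ → ℕ}

lemma blockStart_zero (δ : ℕ → ℕ) : blockStart δ 0 = 1 := by simp [blockStart]

lemma blockStart_succ (δ : ℕ → ℕ) (k : ℕ) : blockStart δ (k + 1) = blockStart δ k + δ k := by
  simp [blockStart, Finset.sum_range_succ, add_assoc]

lemma blockStart_strictMono (hδ : ∀ n, 2 ≤ δ n) : StrictMono (blockStart δ) :=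
  strictMono_nat_of_lt_succ fun k => by rw [blockStart_succ]; have := hδ k; omega

lemma lt_blockStart (hδ : ∀ n, 2 ≤ δ n) (k : ℕ) : k < blockStart δ k := by
  induction k with
  | zero => simp [blockStart_zero]
  | succ k ih => rw [blockStart_succ]; have := hδ k; omega

/-- The parent of a node in the tree of `X_p(δ)`. -/
def deltaParent (δ : ℕ → ℕ) (j : ℕ) : ℕ := Nat.findGreatest (fun k => blockStart δ k ≤ j) j

/-- The root is excluded: no block contains `0`, and there `Nat.findGreatest` returns its default
value `0`. -/
lemma deltaParent_spec (hδ : ∀ n, 2 ≤ δ n) {j : ℕ} (hj : j ≠ 0) :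
    blockStart δ (deltaParent δ j) ≤ j ∧ j < blockStart δ (deltaParent δ j + 1) := by
  constructor
  · exact Nat.findGreatest_spec (P := fun k => blockStart δ k ≤ j) (Nat.zero_le j)
      (by rw [blockStart_zero]; omega)
  · by_contra h
    have h1 : blockStart δ (deltaParent δ j + 1) ≤ j := not_lt.1 h
    have h2 := Nat.le_findGreatest (P := fun k => blockStart δ k ≤ j)
      ((lt_blockStart hδ _).le.trans h1) h1
    change deltaParent δ j + 1 ≤ deltaParent δ j at h2
    omega

lemma deltaParent_lt (hδ : ∀ n, 2 ≤ δ n) {j : ℕ} (hj : j ≠ 0) : deltaParent δ j < j :=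
  (lt_blockStart hδ _).trans_le (deltaParent_spec hδ hj).1

lemma deltaParent_eq_iff (hδ : ∀ n, 2 ≤ δ n) {j k : ℕ} (hj : j ≠ 0) :
    deltaParent δ j = k ↔ j ∈ Finset.Ico (blockStart δ k) (blockStart δ (k + 1)) := by
  have hs := deltaParent_spec hδ hj
  rw [Finset.mem_Ico]
  constructor
  · rintro rfl; exact hs
  · rintro ⟨h1, h2⟩
    have h3 := (blockStart_strictMono hδ).lt_iff_lt.1 (h1.trans_lt hs.2)
    have h4 := (blockStart_strictMono hδ).lt_iff_lt.1 (hs.1.trans_lt h2)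
    omega

lemma deltaParent_of_mem (hδ : ∀ n, 2 ≤ δ n) {j k : ℕ}
    (h : j ∈ Finset.Ico (blockStart δ k) (blockStart δ (k + 1))) : j ≠ 0 ∧ deltaParent δ j = k := by
  have hj : j ≠ 0 := by
    have := lt_blockStart hδ k
    have := (Finset.mem_Ico.1 h).1
    omega
  exact ⟨hj, (deltaParent_eq_iff hδ hj).2 h⟩

lemma deltaParent_lt_iff (hδ : ∀ n, 2 ≤ δ n) {j n : ℕ} (hj : j ≠ 0) :
    deltaParent δ j < n ↔ j < blockStart δ n := by
  have hs := deltaParent_spec hδ hj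
  constructor
  · intro h
    exact hs.2.trans_le ((blockStart_strictMono hδ).monotone h)
  · intro h
    exact (blockStart_strictMono hδ).lt_iff_lt.1 (hs.1.trans_lt h)

/-- The tree of `X_p(δ)`, in which every node splits its mass evenly among its children. -/
noncomputable def deltaForest (δ : ℕ → ℕ) (hδ : ∀ n, 2 ≤ δ n) : MassForest where
  parent := deltaParent δ
  mass j := if j = 0 then 0 else (δ (deltaParent δ j) : NNReal)⁻¹
  parent_lt j hj := deltaParent_lt hδ fun h => hj (if_pos h)
  mass_le j := by
    split_ifs with h
    · positivity
    · rw [one_div]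
      have : (2 : NNReal) ≤ δ (deltaParent δ j) := by exact_mod_cast hδ _
      gcongr
  sum_mass_le u := by
    have h1 : ∀ j, (if deltaParent δ j = u then
        ((if j = 0 then 0 else (δ (deltaParent δ j) : NNReal)⁻¹ : NNReal) : ℝ≥0∞) else 0)
        = if j ∈ Finset.Ico (blockStart δ u) (blockStart δ (u + 1)) then
          (((δ u : NNReal)⁻¹ : NNReal) : ℝ≥0∞) else 0 := by
      intro j
      by_cases hj : j = 0
      · subst hj
        have := lt_blockStart hδ u
        have h0 : ¬ blockStart δ u = 0 := by omega
        simp [h0]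
      · by_cases hu : deltaParent δ j = u
        · rw [if_pos hu, if_pos ((deltaParent_eq_iff hδ hj).1 hu), if_neg hj, hu]
        · rw [if_neg hu, if_neg fun h => hu ((deltaParent_eq_iff hδ hj).2 h)]
    simp_rw [h1]
    rw [ENNReal.tsum_ite_mem, Finset.sum_const, Nat.card_Ico, blockStart_succ,
      Nat.add_sub_cancel_left, nsmul_eq_mul]
    have : (δ u : NNReal) ≠ 0 := by have := hδ u; positivity
    have h2 : ((δ u : NNReal) * (δ u : NNReal)⁻¹ : NNReal) = 1 := mul_inv_cancel₀ this
    refine le_of_eq ?_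
    exact_mod_cast h2

lemma deltaForest_parent (hδ : ∀ n, 2 ≤ δ n) (j : ℕ) :
    (deltaForest δ hδ).parent j = deltaParent δ j := rfl

lemma deltaForest_mass_zero (hδ : ∀ n, 2 ≤ δ n) : (deltaForest δ hδ).mass 0 = 0 := by
  simp [deltaForest]

lemma deltaForest_mass (hδ : ∀ n, 2 ≤ δ n) {j : ℕ} (hj : j ≠ 0) :
    (deltaForest δ hδ).mass j = (δ (deltaParent δ j) : NNReal)⁻¹ := if_neg hj

lemma lindVec_apply {𝕜 : Type*} [RCLike 𝕜] {p : ℝ} (hp0 : 0 < p) (hδ : ∀ n, 2 ≤ δ n) (k : ℕ) :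
    ((lindVec 𝕜 p δ k : EllP 𝕜 p) : ℕ → 𝕜) = (deltaForest δ hδ).diff 𝕜 p (Pi.single k 1) := by
  funext j
  rw [MassForest.diff_apply]
  have h1 : ∀ i : ℕ, ((unitVec 𝕜 p i : EllP 𝕜 p) : ℕ → 𝕜) = Pi.single i 1 := fun i => by
    simp [unitVec, lp.single]
  simp only [lindVec, lp.coeFn_sub, lp.coeFn_smul, lp.coeFn_sum, Pi.sub_apply, Pi.smul_apply,
    Finset.sum_apply, smul_eq_mul, h1]
  congr 1
  have h2 : ∑ i ∈ Finset.Ico (blockStart δ k) (blockStart δ (k + 1)), (Pi.single i 1 : ℕ → 𝕜) j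
      = if j ∈ Finset.Ico (blockStart δ k) (blockStart δ (k + 1)) then 1 else 0 := by
    simp [Pi.single_apply]
  rw [h2, deltaForest_parent]
  by_cases hj : j = 0
  · subst hj
    have h3 : 0 ∉ Finset.Ico (blockStart δ k) (blockStart δ (k + 1)) := fun h =>
      (deltaParent_of_mem hδ h).1 rfl
    rw [if_neg h3, MassForest.weight_eq_zero _ hp0 (deltaForest_mass_zero hδ)]
    simp
  · by_cases hk : deltaParent δ j = k
    · rw [if_pos ((deltaParent_eq_iff hδ hj).1 hk), MassForest.weight, deltaForest_mass hδ hj, hk]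
      simp [Real.rpow_neg, Real.inv_rpow]
    · rw [if_neg fun h => hk ((deltaParent_eq_iff hδ hj).2 h)]
      simp [hk]

end DeltaTree

/-! ### Trees with prescribed level sizes -/

section LevelTree

/-- The first node of level `l`, when level `i` consists of `2 ^ n i` nodes. -/
def levelStart (n : ℕ → ℕ) (l : ℕ) : ℕ := ∑ i ∈ Finset.range l, 2 ^ n i

/-- The level of a node. -/
def nodeLevel (n : ℕ → ℕ) (k : ℕ) : ℕ := Nat.findGreatest (fun l => levelStart n l ≤ k) k

/-- The number of children of a node. -/
def levelDelta (n : ℕ → ℕ) (k : ℕ) : ℕ := 2 ^ (n (nodeLevel n k + 1) - n (nodeLevel n k))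

variable {n : ℕ → ℕ}

lemma levelStart_zero (n : ℕ → ℕ) : levelStart n 0 = 0 := rfl

lemma levelStart_succ (n : ℕ → ℕ) (l : ℕ) : levelStart n (l + 1) = levelStart n l + 2 ^ n l :=
  Finset.sum_range_succ _ _

lemma levelStart_strictMono (n : ℕ → ℕ) : StrictMono (levelStart n) :=
  strictMono_nat_of_lt_succ fun l => by
    rw [levelStart_succ]; exact Nat.lt_add_of_pos_right (by positivity)

lemma levelStart_le_pow (hn : StrictMono n) (l : ℕ) : levelStart n l ≤ 2 ^ n l := by
  induction l with
  | zero => simp [levelStart_zero]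
  | succ l ih =>
    rw [levelStart_succ]
    calc _ ≤ 2 ^ n l + 2 ^ n l := by omega
      _ = 2 ^ (n l + 1) := by ring
      _ ≤ _ := Nat.pow_le_pow_right (by norm_num) (hn (Nat.lt_succ_self l))

lemma nodeLevel_spec (n : ℕ → ℕ) (k : ℕ) :
    levelStart n (nodeLevel n k) ≤ k ∧ k < levelStart n (nodeLevel n k + 1) := by
  constructor
  · exact Nat.findGreatest_spec (P := fun l => levelStart n l ≤ k) (Nat.zero_le k)
      (by simp [levelStart_zero])
  · by_contra h
    have h1 : levelStart n (nodeLevel n k + 1) ≤ k := not_lt.1 h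
    have h2 := Nat.le_findGreatest (P := fun l => levelStart n l ≤ k)
      (((levelStart_strictMono n).id_le _).trans h1) h1
    change nodeLevel n k + 1 ≤ nodeLevel n k at h2
    omega

lemma nodeLevel_eq_iff {k l : ℕ} :
    nodeLevel n k = l ↔ levelStart n l ≤ k ∧ k < levelStart n (l + 1) := by
  have hs := nodeLevel_spec n k
  constructor
  · rintro rfl; exact hs
  · rintro ⟨h1, h2⟩
    have h3 := (levelStart_strictMono n).lt_iff_lt.1 (h1.trans_lt hs.2)
    have h4 := (levelStart_strictMono n).lt_iff_lt.1 (hs.1.trans_lt h2)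
    omega

lemma two_le_levelDelta (hn : StrictMono n) (k : ℕ) : 2 ≤ levelDelta n k := by
  have h : n (nodeLevel n k) < n (nodeLevel n k + 1) := hn (Nat.lt_succ_self _)
  calc 2 = 2 ^ 1 := rfl
    _ ≤ _ := Nat.pow_le_pow_right (by norm_num) (by omega)

/-- Levels occupy consecutive intervals of indices, and the children of the first node of a level
begin the next level. Hence `deltaParent` moves up exactly one level. -/
lemma blockStart_levelStart (hn : StrictMono n) (hn0 : n 0 = 0) (l : ℕ) :
    blockStart (levelDelta n) (levelStart n l) = levelStart n (l + 1) := by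
  induction l with
  | zero => simp [levelStart_zero, levelStart_succ, blockStart_zero, hn0]
  | succ l ih =>
    have h1 : blockStart (levelDelta n) (levelStart n (l + 1))
        = blockStart (levelDelta n) (levelStart n l)
          + ∑ j ∈ Finset.Ico (levelStart n l) (levelStart n (l + 1)), levelDelta n j := by
      unfold blockStart
      rw [add_assoc, Finset.sum_range_add_sum_Ico _
        ((levelStart_strictMono n).monotone (Nat.le_succ l))]
    have h2 : ∑ j ∈ Finset.Ico (levelStart n l) (levelStart n (l + 1)), levelDelta n j
        = 2 ^ n l * 2 ^ (n (l + 1) - n l) := by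
      rw [Finset.sum_congr rfl fun j hj => by
        rw [levelDelta, nodeLevel_eq_iff.2 (Finset.mem_Ico.1 hj)], Finset.sum_const, Nat.card_Ico,
        levelStart_succ, Nat.add_sub_cancel_left, smul_eq_mul]
    rw [h1, h2, ih, levelStart_succ n (l + 1), ← pow_add,
      Nat.add_sub_cancel' (hn (Nat.lt_succ_self l)).le]

lemma nodeLevel_zero (n : ℕ → ℕ) : nodeLevel n 0 = 0 :=
  nodeLevel_eq_iff.2 (by simp [levelStart_zero, levelStart_succ])

lemma nodeLevel_eq_succ (hn : StrictMono n) (hn0 : n 0 = 0) {j : ℕ} (hj : j ≠ 0) :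
    nodeLevel n j = nodeLevel n (deltaParent (levelDelta n) j) + 1 := by
  have hδ := two_le_levelDelta hn
  set k := deltaParent (levelDelta n) j with hk
  have h1 := deltaParent_spec hδ hj
  have h2 := nodeLevel_spec n k
  have hm := (blockStart_strictMono hδ).monotone
  rw [nodeLevel_eq_iff]
  constructor
  · rw [← blockStart_levelStart hn hn0]
    exact (hm h2.1).trans h1.1
  · rw [← blockStart_levelStart hn hn0]
    exact h1.2.trans_le (hm h2.2)

/-- The tree whose level `l` consists of `2 ^ n l` nodes. -/
noncomputable def levelForest (hn : StrictMono n) : MassForest :=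
  deltaForest (levelDelta n) (two_le_levelDelta hn)

lemma levelForest_mass_mul (hn : StrictMono n) (hn0 : n 0 = 0) {j : ℕ} (hj : j ≠ 0) :
    ((levelForest hn).mass j : ℝ≥0∞) * 2 ^ n (nodeLevel n j)
      = 2 ^ n (nodeLevel n ((levelForest hn).parent j)) := by
  have h1 := nodeLevel_eq_succ hn hn0 hj
  rw [levelForest, deltaForest_mass _ hj, deltaForest_parent, h1, levelDelta]
  set l := nodeLevel n (deltaParent (levelDelta n) j)
  have h2 : n (l + 1) = (n (l + 1) - n l) + n l := by
    have := hn (Nat.lt_succ_self l); simp only [Nat.succ_eq_add_one] at this; omega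
  have h3 : (((2 ^ (n (l + 1) - n l) : ℕ) : NNReal))⁻¹ * 2 ^ n (l + 1) = 2 ^ n l := by
    conv_lhs => rw [h2]
    rw [Nat.add_sub_cancel, pow_add]
    push_cast
    rw [inv_mul_cancel_left₀ (by positivity)]
  exact_mod_cast congrArg (fun x : NNReal => (x : ℝ≥0∞)) h3

/-- Mass is spread evenly over each level, so a node gets from its `R`-th ancestor the quotient of
the two level sizes. The factor is zero when the ancestry runs past the root, whose mass is zero. -/
lemma levelForest_branchMass (hn : StrictMono n) (hn0 : n 0 = 0) (R k : ℕ) :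
    (levelForest hn).branchMass R k * 2 ^ n (nodeLevel n k)
      = if R ≤ nodeLevel n k then 2 ^ n (nodeLevel n k - R) else 0 := by
  induction R generalizing k with
  | zero => simp [MassForest.branchMass]
  | succ R ih =>
    rw [MassForest.branchMass]
    by_cases hk : k = 0
    · subst hk
      simp [levelForest, deltaForest_mass_zero, nodeLevel_zero n]
    · have h1 : nodeLevel n k = nodeLevel n ((levelForest hn).parent k) + 1 :=
        nodeLevel_eq_succ hn hn0 hk
      rw [mul_right_comm, levelForest_mass_mul hn hn0 hk, mul_comm, ih, h1]
      simp

/-- A subtree may branch more slowly high up than further down; superadditivity says that over any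
`R` generations it branches, up to a factor `2`, at least as much as over the first `R`. -/
lemma levelForest_branchMass_le (hn : StrictMono n) (hn0 : n 0 = 0)
    (hsup : ∀ l r, n l + n r ≤ n (l + r) + 1) (R k : ℕ) :
    2 ^ n R * (levelForest hn).branchMass R k ≤ 2 := by
  have h := levelForest_branchMass hn hn0 R k
  have hpos : ∀ i : ℕ, (2 : ℝ≥0∞) ^ i ≠ 0 := fun i => by positivity
  have hfin : ∀ i : ℕ, (2 : ℝ≥0∞) ^ i ≠ ∞ := fun i => ENNReal.pow_ne_top (by norm_num)
  split_ifs at h with hR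
  · have h1 := hsup (nodeLevel n k - R) R
    rw [Nat.sub_add_cancel hR] at h1
    have h2 : (2 : ℝ≥0∞) ^ n (nodeLevel n k - R) * (2 ^ n R * (levelForest hn).branchMass R k)
        ≤ 2 ^ n (nodeLevel n k - R) * 2 := by
      calc _ = 2 ^ (n (nodeLevel n k - R) + n R) * (levelForest hn).branchMass R k := by
            rw [pow_add]; ring
        _ ≤ 2 ^ (n (nodeLevel n k) + 1) * (levelForest hn).branchMass R k := by
            gcongr; norm_num
        _ = 2 * ((levelForest hn).branchMass R k * 2 ^ n (nodeLevel n k)) := by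
            rw [pow_succ]; ring
        _ = _ := by rw [h, mul_comm]
    exact (ENNReal.mul_le_mul_iff_right (hpos _) (hfin _)).1 h2
  · have h1 : (levelForest hn).branchMass R k = 0 := by
      rcases mul_eq_zero.1 h with h | h
      · exact h
      · exact absurd h (hpos _)
    simp [h1]

/-! ### The evenly spread unit mass and the lower bound for the conditionality constants. -/

section Harmonic

variable {𝕜 : Type*} [RCLike 𝕜] {p : ℝ}

lemma levelForest_weight_zero (hp0 : 0 < p) (hn : StrictMono n) :
    (levelForest hn).weight 𝕜 p 0 = 0 :=
  MassForest.weight_eq_zero _ hp0 (deltaForest_mass_zero (two_le_levelDelta hn))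

/-- The coefficients of `e₀`, formally. -/
noncomputable def harmonicSeq (𝕜 : Type*) [RCLike 𝕜] (p : ℝ) (hn : StrictMono n) : ℕ → 𝕜 :=
  (levelForest hn).solFun 𝕜 p (Pi.single 0 1)

lemma diff_harmonicSeq (hp0 : 0 < p) (hn : StrictMono n) :
    (levelForest hn).diff 𝕜 p (harmonicSeq 𝕜 p hn) = Pi.single 0 1 :=
  (levelForest hn).diff_solFun hp0 _

lemma harmonicSeq_zero (hp0 : 0 < p) (hn : StrictMono n) : harmonicSeq 𝕜 p hn 0 = 1 := by
  have h := congrFun (diff_harmonicSeq (𝕜 := 𝕜) hp0 hn) 0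
  rw [MassForest.diff_apply, levelForest_weight_zero hp0 hn] at h
  simpa using h

lemma weight_mul_harmonicSeq (hp0 : 0 < p) (hn : StrictMono n) {j : ℕ} (hj : j ≠ 0) :
    (levelForest hn).weight 𝕜 p j * harmonicSeq 𝕜 p hn ((levelForest hn).parent j)
      = harmonicSeq 𝕜 p hn j := by
  have h := congrFun (diff_harmonicSeq (𝕜 := 𝕜) hp0 hn) j
  rw [MassForest.diff_apply, Pi.single_eq_of_ne hj, sub_eq_zero] at h
  exact h.symm

/-- The unit mass placed at the root is passed on without loss and divided evenly, so each level
carries total energy one. -/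
lemma enorm_harmonicSeq (hp0 : 0 < p) (hn : StrictMono n) (hn0 : n 0 = 0) (k : ℕ) :
    ‖harmonicSeq 𝕜 p hn k‖ₑ ^ p * 2 ^ n (nodeLevel n k) = 1 := by
  induction k using Nat.strong_induction_on with
  | _ k ih =>
    by_cases hk : k = 0
    · subst hk
      simp [harmonicSeq_zero hp0, nodeLevel_zero n, hn0]
    · rw [← weight_mul_harmonicSeq hp0 hn hk, MassForest.enorm_weight_mul_rpow _ hp0,
        mul_right_comm, levelForest_mass_mul hn hn0 hk, mul_comm]
      exact ih _ (deltaParent_lt (two_le_levelDelta hn) hk)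

lemma sum_enorm_harmonicSeq (hp0 : 0 < p) (hn : StrictMono n) (hn0 : n 0 = 0) (R : ℕ) :
    ∑ k ∈ Finset.range (levelStart n R), ‖harmonicSeq 𝕜 p hn k‖ₑ ^ p = R := by
  induction R with
  | zero => simp [levelStart_zero]
  | succ R ih =>
    rw [← Finset.sum_range_add_sum_Ico _ ((levelStart_strictMono n).monotone (Nat.le_succ R)), ih]
    have h1 : ∀ k ∈ Finset.Ico (levelStart n R) (levelStart n (R + 1)),
        ‖harmonicSeq 𝕜 p hn k‖ₑ ^ p = (2 ^ n R)⁻¹ := by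
      intro k hk
      have h := enorm_harmonicSeq (𝕜 := 𝕜) hp0 hn hn0 k
      rw [nodeLevel_eq_iff.2 (Finset.mem_Ico.1 hk)] at h
      exact ENNReal.eq_inv_of_mul_eq_one_left h
    rw [Finset.sum_congr rfl h1, Finset.sum_const, Nat.card_Ico, levelStart_succ,
      Nat.add_sub_cancel_left, nsmul_eq_mul]
    push_cast
    rw [ENNReal.mul_inv_cancel (by positivity) (ENNReal.pow_ne_top (by norm_num))]

lemma pen_diff_restr_harmonicSeq_le (hp0 : 0 < p) (hp1 : p ≤ 1) (hn : StrictMono n) (s : ℕ) :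
    pen p ((levelForest hn).diff 𝕜 p (restr (Finset.range s) (harmonicSeq 𝕜 p hn))) ≤ 2 := by
  refine ((levelForest hn).pen_diff_restr_range_le hp0 hp1 s _).trans ?_
  rw [diff_harmonicSeq hp0]
  calc _ ≤ 2 * pen p (Pi.single 0 (1 : 𝕜)) := by gcongr; exact sum_le_pen _ _
    _ = 2 := by rw [pen_single hp0, mul_one]

/-- The nodes of even level among the first `R` levels. -/
def evenNodes (n : ℕ → ℕ) (R : ℕ) : Finset ℕ :=
  {k ∈ Finset.range (levelStart n R) | Even (nodeLevel n k)}

lemma card_evenNodes_le (hn : StrictMono n) (R : ℕ) : (evenNodes n R).card ≤ 2 ^ n R :=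
  (Finset.card_filter_le _ _).trans (by rw [Finset.card_range]; exact levelStart_le_pow hn R)

lemma restr_evenNodes_restr (n : ℕ → ℕ) (R : ℕ) (a : ℕ → 𝕜) :
    restr (evenNodes n R) (restr (Finset.range (levelStart n R)) a) = restr (evenNodes n R) a := by
  funext k
  simp only [restr_apply]
  by_cases hk : k ∈ evenNodes n R
  · simp [hk, (Finset.mem_filter.1 hk).1]
  · simp [hk]

/-- Keeping even levels only, a node of even level has a parent with coefficient zero, and a node of
odd level has coefficient zero itself. In both cases one of the two cancelling terms survives, and
it has the size of the harmonic coefficient at that node. -/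
lemma le_sum_diff_restr_evenNodes (hp0 : 0 < p) (hn : StrictMono n) (hn0 : n 0 = 0) (R : ℕ) :
    (R : ℝ≥0∞) ≤ ∑ k ∈ Finset.range (levelStart n R),
      ‖(levelForest hn).diff 𝕜 p (restr (evenNodes n R) (harmonicSeq 𝕜 p hn)) k‖ₑ ^ p := by
  rw [← sum_enorm_harmonicSeq (𝕜 := 𝕜) hp0 hn hn0 R]
  refine Finset.sum_le_sum fun k hk => ?_
  rw [MassForest.diff_apply, restr_apply, restr_apply]
  by_cases hk0 : k = 0
  · subst hk0
    have h0 : 0 ∈ evenNodes n R := Finset.mem_filter.2 ⟨hk, by simp [nodeLevel_zero n]⟩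
    rw [levelForest_weight_zero hp0 hn, if_pos h0]
    simp
  · have h1 : nodeLevel n k = nodeLevel n ((levelForest hn).parent k) + 1 :=
      nodeLevel_eq_succ hn hn0 hk0
    have hlt : (levelForest hn).parent k < k := deltaParent_lt (two_le_levelDelta hn) hk0
    have hpk : (levelForest hn).parent k ∈ Finset.range (levelStart n R) :=
      Finset.mem_range.2 (hlt.trans (Finset.mem_range.1 hk))
    by_cases he : Even (nodeLevel n k)
    · have h2 : k ∈ evenNodes n R := Finset.mem_filter.2 ⟨hk, he⟩
      have h3 : (levelForest hn).parent k ∉ evenNodes n R := fun h => by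
        have := (Finset.mem_filter.1 h).2
        rw [h1, Nat.even_add_one] at he
        exact he this
      rw [if_pos h2, if_neg h3, mul_zero, sub_zero]
    · have h2 : k ∉ evenNodes n R := fun h => he (Finset.mem_filter.1 h).2
      have h3 : (levelForest hn).parent k ∈ evenNodes n R := by
        refine Finset.mem_filter.2 ⟨hpk, ?_⟩
        rw [h1, Nat.even_add_one, not_not] at he
        exact he
      rw [if_neg h2, if_pos h3, weight_mul_harmonicSeq hp0 hn hk0, zero_sub, enorm_neg]

end Harmonic

end LevelTree

/-! ### Concave growth functions -/

section Growth

variable {φ : ℝ → ℝ}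

lemma ConcaveOn.mul_le_of_le_one (hφ0 : φ 0 = 0) (hconc : ConcaveOn ℝ (Set.Ici 0) φ) {t x : ℝ}
    (ht0 : 0 ≤ t) (ht1 : t ≤ 1) (hx : 0 ≤ x) : t * φ x ≤ φ (t * x) := by
  have h := hconc.2 (Set.mem_Ici.2 hx) (Set.mem_Ici.2 le_rfl) ht0 (sub_nonneg.2 ht1)
    (by ring : t + (1 - t) = 1)
  simpa [hφ0] using h

lemma ConcaveOn.map_two_mul_le (hφ0 : φ 0 = 0) (hconc : ConcaveOn ℝ (Set.Ici 0) φ) {x : ℝ}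
    (hx : 0 ≤ x) : φ (2 * x) ≤ 2 * φ x := by
  have h := ConcaveOn.mul_le_of_le_one hφ0 hconc (t := 1 / 2) (x := 2 * x) (by norm_num)
    (by norm_num) (by positivity)
  rw [show 1 / 2 * (2 * x) = x by ring] at h
  linarith

lemma ConcaveOn.map_add_le (hφ0 : φ 0 = 0) (hconc : ConcaveOn ℝ (Set.Ici 0) φ) {x y : ℝ}
    (hx : 0 ≤ x) (hy : 0 ≤ y) : φ (x + y) ≤ φ x + φ y := by
  rcases eq_or_lt_of_le (add_nonneg hx hy) with h | h
  · have h1 : x = 0 := by linarith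
    have h2 : y = 0 := by linarith
    simp [h1, h2, hφ0]
  · have h1 := ConcaveOn.mul_le_of_le_one hφ0 hconc (t := x / (x + y)) (x := x + y)
      (by positivity) (by rw [div_le_one h]; linarith) h.le
    have h2 := ConcaveOn.mul_le_of_le_one hφ0 hconc (t := y / (x + y)) (x := x + y)
      (by positivity) (by rw [div_le_one h]; linarith) h.le
    rw [div_mul_cancel₀ _ h.ne'] at h1 h2
    have h3 : x / (x + y) * φ (x + y) + y / (x + y) * φ (x + y) = φ (x + y) := by
      field_simp
    linarith

lemma ConcaveOn.pos_of_ne_zero (hφ0 : φ 0 = 0) (hmono : MonotoneOn φ (Set.Ici 0))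
    (hconc : ConcaveOn ℝ (Set.Ici 0) φ) (hne : ∃ x, 0 ≤ x ∧ φ x ≠ 0) {t : ℝ} (ht : 0 < t) :
    0 < φ t := by
  obtain ⟨x, hx, hφx⟩ := hne
  have h0 : φ 0 ≤ φ x := hmono (Set.mem_Ici.2 le_rfl) (Set.mem_Ici.2 hx) hx
  have hpos : 0 < φ x := lt_of_le_of_ne (hφ0 ▸ h0) hφx.symm
  rcases le_total x t with h | h
  · exact hpos.trans_le (hmono (Set.mem_Ici.2 hx) (Set.mem_Ici.2 ht.le) h)
  · have hx' : 0 < x := ht.trans_le h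
    have h1 := ConcaveOn.mul_le_of_le_one hφ0 hconc (t := t / x) (x := x) (by positivity)
      (by rw [div_le_one hx']; exact h) hx
    rw [div_mul_cancel₀ _ hx'.ne'] at h1
    exact lt_of_lt_of_le (by positivity) h1

/-- The number of binary generations after which `φ` exceeds `r φ(1)`. -/
noncomputable def growthLevel (φ : ℝ → ℝ) (r : ℕ) : ℕ := sInf {n : ℕ | r * φ 1 ≤ φ n}

lemma growthLevel_spec (hmono : MonotoneOn φ (Set.Ici 0)) (hunb : ¬ BddAbove (φ '' Set.Ici 0))
    (r : ℕ) : r * φ 1 ≤ φ (growthLevel φ r) := by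
  refine Nat.sInf_mem (s := {n : ℕ | r * φ 1 ≤ φ n}) ?_
  rw [not_bddAbove_iff] at hunb
  obtain ⟨y, ⟨x, hx, rfl⟩, hy⟩ := hunb (r * φ 1)
  obtain ⟨n, hn⟩ := exists_nat_ge x
  exact ⟨n, hy.le.trans (hmono hx (Set.mem_Ici.2 (Nat.cast_nonneg n)) hn)⟩

lemma growthLevel_le_iff (hmono : MonotoneOn φ (Set.Ici 0)) (hunb : ¬ BddAbove (φ '' Set.Ici 0))
    {r n : ℕ} : growthLevel φ r ≤ n ↔ r * φ 1 ≤ φ n := by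
  constructor
  · intro h
    exact (growthLevel_spec hmono hunb r).trans (hmono (Set.mem_Ici.2 (Nat.cast_nonneg _))
      (Set.mem_Ici.2 (Nat.cast_nonneg _)) (by exact_mod_cast h))
  · intro h
    exact Nat.sInf_le (s := {n : ℕ | r * φ 1 ≤ φ n}) h

lemma growthLevel_zero (hφ0 : φ 0 = 0) : growthLevel φ 0 = 0 :=
  Nat.le_zero.1 (Nat.sInf_le (s := {n : ℕ | ((0 : ℕ) : ℝ) * φ 1 ≤ φ n}) (by simp [hφ0]))

/-- Just before their thresholds, `φ y < l φ(1)` and `φ z < r φ(1)`; subadditivity keeps `φ (y + z)`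
below `(l + r) φ(1)`. Stepping one short of both thresholds costs the additive `1`. -/
lemma growthLevel_superadd (hφ0 : φ 0 = 0) (hmono : MonotoneOn φ (Set.Ici 0))
    (hconc : ConcaveOn ℝ (Set.Ici 0) φ) (hunb : ¬ BddAbove (φ '' Set.Ici 0)) (l r : ℕ) :
    growthLevel φ l + growthLevel φ r ≤ growthLevel φ (l + r) + 1 := by
  by_contra h
  obtain ⟨y, hy⟩ : ∃ y, growthLevel φ l = y + 1 := Nat.exists_eq_succ_of_ne_zero fun h0 => by
    have h1 : growthLevel φ r ≤ growthLevel φ (l + r) := by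
      rw [growthLevel_le_iff hmono hunb]
      have h2 := growthLevel_spec hmono hunb (l + r)
      have h3 : 0 ≤ (l : ℝ) * φ 1 := by
        have : φ 0 ≤ φ 1 := hmono (Set.mem_Ici.2 le_rfl) (Set.mem_Ici.2 zero_le_one) zero_le_one
        rw [hφ0] at this
        positivity
      push_cast at h2
      linarith
    omega
  obtain ⟨z, hz⟩ : ∃ z, growthLevel φ r = z + 1 := Nat.exists_eq_succ_of_ne_zero fun h0 => by
    have h1 : growthLevel φ l ≤ growthLevel φ (l + r) := by
      rw [growthLevel_le_iff hmono hunb]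
      have h2 := growthLevel_spec hmono hunb (l + r)
      have h3 : 0 ≤ (r : ℝ) * φ 1 := by
        have : φ 0 ≤ φ 1 := hmono (Set.mem_Ici.2 le_rfl) (Set.mem_Ici.2 zero_le_one) zero_le_one
        rw [hφ0] at this
        positivity
      push_cast at h2
      linarith
    omega
  have h1 : ¬ growthLevel φ l ≤ y := by omega
  have h2 : ¬ growthLevel φ r ≤ z := by omega
  have h3 : growthLevel φ (l + r) ≤ y + z := by omega
  rw [growthLevel_le_iff hmono hunb] at h1 h2 h3
  have h4 := ConcaveOn.map_add_le hφ0 hconc (Nat.cast_nonneg y) (Nat.cast_nonneg (α := ℝ) z)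
  push_cast at h3
  linarith

/-- Thresholds are multiples of `φ 1` because a unit step of the argument raises `φ` by at most `φ
1`, so two thresholds cannot be crossed at once. -/
lemma growthLevel_strictMono (hφ0 : φ 0 = 0) (hmono : MonotoneOn φ (Set.Ici 0))
    (hconc : ConcaveOn ℝ (Set.Ici 0) φ) (hpos : 0 < φ 1) (hunb : ¬ BddAbove (φ '' Set.Ici 0)) :
    StrictMono (growthLevel φ) := by
  refine strictMono_nat_of_lt_succ fun r => ?_
  obtain ⟨y, hy⟩ : ∃ y, growthLevel φ (r + 1) = y + 1 := Nat.exists_eq_succ_of_ne_zero fun h0 => by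
    have h := growthLevel_spec hmono hunb (r + 1)
    rw [h0, Nat.cast_zero, hφ0] at h
    push_cast at h
    have : 0 ≤ (r : ℝ) * φ 1 := by positivity
    linarith
  rw [hy, Nat.lt_succ_iff, growthLevel_le_iff hmono hunb]
  have h1 := growthLevel_spec hmono hunb (r + 1)
  rw [hy] at h1
  push_cast at h1
  have h2 := ConcaveOn.map_add_le hφ0 hconc (Nat.cast_nonneg y) (zero_le_one (α := ℝ))
  linarith

/-- The number of levels of size at most `m` is comparable with `φ(log m)`. -/
lemma exists_level_bounds (hφ0 : φ 0 = 0) (hmono : MonotoneOn φ (Set.Ici 0))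
    (hconc : ConcaveOn ℝ (Set.Ici 0) φ) (hpos : 0 < φ 1) (hunb : ¬ BddAbove (φ '' Set.Ici 0))
    {m : ℕ} (hm : 2 ≤ m) : ∃ L : ℕ, 2 ^ growthLevel φ L ≤ m ∧ m ≤ 2 ^ growthLevel φ (L + 1) ∧
      (L + 3 : ℝ) ≤ 8 / φ 1 * φ (Real.log m) ∧ 1 / (4 * φ 1) * φ (Real.log m) ≤ L := by
  set N := Nat.log 2 m with hN
  have hN1 : 1 ≤ N := Nat.log_pos (by norm_num) hm
  have hN1' : (1 : ℝ) ≤ N := by exact_mod_cast hN1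
  have hm0 : (0 : ℝ) < m := by positivity
  have hle : (2 : ℝ) ^ N ≤ m := by exact_mod_cast Nat.pow_log_le_self 2 (by omega)
  have hlt : (m : ℝ) < 2 ^ (N + 1) := by exact_mod_cast Nat.lt_pow_succ_log_self (by norm_num) m
  have hl2 := Real.log_two_gt_d9
  have hl2' := Real.log_two_lt_d9
  have hlog1 : (N : ℝ) * Real.log 2 ≤ Real.log m := by
    rw [← Real.log_pow]; exact Real.log_le_log (by positivity) hle
  have hlog2 : Real.log m ≤ (N + 1 : ℝ) * Real.log 2 := by
    have := Real.log_le_log hm0 hlt.le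
    rw [Real.log_pow] at this
    exact_mod_cast this
  have hlog0 : 0 ≤ Real.log m := Real.log_nonneg (by exact_mod_cast (by omega : 1 ≤ m))
  have hφN : φ N ≤ 2 * φ (Real.log m) := by
    refine le_trans (hmono (Set.mem_Ici.2 (by positivity)) (Set.mem_Ici.2 (by positivity)) ?_)
      (ConcaveOn.map_two_mul_le hφ0 hconc hlog0)
    nlinarith
  have hφN' : φ (Real.log m) ≤ 2 * φ N := by
    refine le_trans (hmono (Set.mem_Ici.2 hlog0) (Set.mem_Ici.2 (by positivity)) ?_)
      (ConcaveOn.map_two_mul_le hφ0 hconc (Nat.cast_nonneg N))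
    nlinarith
  have hφ1N : φ 1 ≤ φ N := hmono (Set.mem_Ici.2 zero_le_one) (Set.mem_Ici.2 (by positivity)) hN1'
  have hx1 : 1 ≤ φ N / φ 1 := by rwa [one_le_div hpos]
  -- The largest `L` with `L φ(1) ≤ φ(N)`, that is, with `growthLevel φ L ≤ N`.
  set L := ⌊φ N / φ 1⌋₊ with hL
  have hL1 : (L : ℝ) ≤ φ N / φ 1 := Nat.floor_le (by linarith)
  have hL2 : φ N / φ 1 < L + 1 := Nat.lt_floor_add_one _
  have hL3 : (1 : ℝ) ≤ L := by exact_mod_cast Nat.one_le_floor_iff _ |>.2 hx1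
  refine ⟨L, ?_, ?_, ?_, ?_⟩
  · have h : growthLevel φ L ≤ N := by
      rw [growthLevel_le_iff hmono hunb]
      rwa [le_div_iff₀ hpos] at hL1
    exact (Nat.pow_le_pow_right (by norm_num) h).trans (Nat.pow_log_le_self 2 (by omega))
  · have h : ¬ growthLevel φ (L + 1) ≤ N := by
      rw [growthLevel_le_iff hmono hunb]
      rw [div_lt_iff₀ hpos] at hL2
      push_cast
      linarith
    exact (Nat.lt_pow_succ_log_self (by norm_num) m).le.trans
      (Nat.pow_le_pow_right (by norm_num) (by omega))
  -- The summand `3` leaves room for `R = L + 1` and `K = 2`. It is absorbed since `φ N / φ 1 ≥ 1`;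
  -- replacing `N` by `log m` costs another factor `2`.
  · have h1 : (L + 3 : ℝ) ≤ 4 * (φ N / φ 1) := by linarith
    calc _ ≤ _ := h1
      _ ≤ 4 * (2 * φ (Real.log m) / φ 1) := by gcongr
      _ = _ := by ring
  · calc 1 / (4 * φ 1) * φ (Real.log m) ≤ 1 / (4 * φ 1) * (2 * φ N) := by gcongr
      _ = (φ N / φ 1) / 2 := by field_simp; norm_num
      _ ≤ L := by linarith

end Growth

/-! ### Forests of finite trees and `ℓ_p` -/

section EllP

variable {𝕜 : Type*} [RCLike 𝕜] {p : ℝ}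

lemma EllP.ofReal_norm_rpow (hp0 : 0 < p) (f : EllP 𝕜 p) :
    ENNReal.ofReal (‖f‖ ^ p) = pen p (f : ℕ → 𝕜) := by
  have hp : (ENNReal.ofReal p).toReal = p := ENNReal.toReal_ofReal hp0.le
  have hp' : 0 < (ENNReal.ofReal p).toReal := by rwa [hp]
  have h1 := lp.norm_rpow_eq_tsum hp' f
  have h2 := (memℓp_gen_iff hp').1 (lp.memℓp f)
  rw [hp] at h1 h2
  rw [h1, ENNReal.ofReal_tsum_of_nonneg (fun _ => by positivity) h2]
  exact tsum_congr fun j => (enorm_rpow_eq_ofReal hp0 _).symm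

lemma EllP.pen_ne_top (hp0 : 0 < p) (f : EllP 𝕜 p) : pen p (f : ℕ → 𝕜) ≠ ∞ := by
  rw [← EllP.ofReal_norm_rpow hp0]; exact ENNReal.ofReal_ne_top

/-- A sequence of finite energy as an element of `ℓ_p`. -/
def EllP.mk (hp0 : 0 < p) (f : ℕ → 𝕜) (hf : pen p f ≠ ∞) : EllP 𝕜 p :=
  ⟨f, by
    have hp : (ENNReal.ofReal p).toReal = p := ENNReal.toReal_ofReal hp0.le
    have h : Memℓp f (ENNReal.ofReal p) := by
      rw [memℓp_gen_iff (by rwa [hp]), hp]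
      have h1 := ENNReal.summable_toReal hf
      refine h1.congr fun j => ?_
      rw [enorm_rpow_eq_ofReal hp0, ENNReal.toReal_ofReal (by positivity)]
    exact h⟩

lemma EllP.norm_lt_of_pen_lt (hp0 : 0 < p) (f : EllP 𝕜 p) {ε : ℝ} (hε : 0 < ε)
    (h : pen p (f : ℕ → 𝕜) < ENNReal.ofReal (ε ^ p)) : ‖f‖ < ε := by
  rw [← EllP.ofReal_norm_rpow hp0, ENNReal.ofReal_lt_ofReal_iff (by positivity)] at h
  exact (Real.rpow_lt_rpow_iff (lp.norm_nonneg' f) hε.le hp0).1 h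

lemma EllP.pen_le_of_norm_lt (hp0 : 0 < p) (f : EllP 𝕜 p) {ε : ℝ} (h : ‖f‖ < ε) :
    pen p (f : ℕ → 𝕜) ≤ ENNReal.ofReal (ε ^ p) := by
  rw [← EllP.ofReal_norm_rpow hp0]
  exact ENNReal.ofReal_le_ofReal (Real.rpow_le_rpow (lp.norm_nonneg' f) h.le hp0.le)

lemma MassForest.pen_diff_single_ne_top (F : MassForest) (hp0 : 0 < p) (hp1 : p ≤ 1) (k : ℕ) :
    pen p (F.diff 𝕜 p (Pi.single k 1)) ≠ ∞ :=
  ne_top_of_le_ne_top (by rw [pen_single hp0]; norm_num) (F.pen_diff_le hp0 hp1 _)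

/-- If all trees of a forest are finite, its vectors span `ℓ_p`. -/
noncomputable def ellpModel (𝕜 : Type*) [RCLike 𝕜] (F : MassForest) (hp0 : 0 < p) (hp1 : p ≤ 1)
    (hF : ∀ A₀ : Finset ℕ, ∃ A, A₀ ⊆ A ∧ ∀ k, F.mass k ≠ 0 → (k ∈ A ↔ F.parent k ∈ A)) :
    ForestModel F 𝕜 p (EllP 𝕜 p) where
  toSeq :=
    { toFun := fun f => (f : ℕ → 𝕜)
      map_add' := fun f g => lp.coeFn_add f g
      map_smul' := fun c f => lp.coeFn_smul c f }
  const := 1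
  one_le_const := le_rfl
  norm_nonneg := lp.norm_nonneg'
  pen_le f := by simp [EllP.ofReal_norm_rpow hp0]
  le_pen f := by simp [EllP.ofReal_norm_rpow hp0]
  eq_zero f hf := lp.ext hf
  vec k := EllP.mk hp0 _ (F.pen_diff_single_ne_top hp0 hp1 k)
  toSeq_vec k := rfl
  dense f ε hε := by
    have h := (ENNReal.tendsto_nhds_zero.1 (tendsto_pen_sub_restr hp0 (EllP.pen_ne_top hp0 f))) ε
      (pos_iff_ne_zero.2 hε)
    obtain ⟨A₀, hA₀⟩ := eventually_atTop.1 h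
    obtain ⟨A, hA, hAF⟩ := hF A₀
    refine ⟨A, F.solFun 𝕜 p f, ?_⟩
    -- `A` is a union of whole trees, so no edge joins it to its complement and `diff` commutes with
    -- the restriction to `A`.
    have h1 : F.diff 𝕜 p (restr A (F.solFun 𝕜 p f)) = restr A (f : ℕ → 𝕜) := by
      conv_rhs => rw [← F.diff_solFun hp0 (f : ℕ → 𝕜)]
      funext k
      simp only [MassForest.diff_apply, restr_apply]
      by_cases hq : F.mass k = 0
      · rw [F.weight_eq_zero hp0 hq]; simp
      · have := hAF k hq
        by_cases hk : k ∈ A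
        · simp [hk, this.1 hk]
        · have h2 : F.parent k ∉ A := fun h' => hk (this.2 h')
          simp [hk, h2]
    rw [h1]
    exact hA₀ A hA

lemma ENNReal.tsum_eq_tsum_pair (g : ℕ → ℝ≥0∞) : ∑' k, g k = ∑' i, ∑' c, g (Nat.pair i c) := by
  rw [← Nat.pairEquiv.tsum_eq]
  exact ENNReal.tsum_prod (f := fun i c => g (Nat.pair i c))

/-- The forest without edges. -/
def edgelessForest : MassForest where
  parent := id
  mass _ := 0
  parent_lt k h := absurd rfl h
  mass_le _ := by positivity
  sum_mass_le u := by simp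

/-- Disjoint copies of a tree, the `i`-th copy being truncated at `cut i`. -/
noncomputable def MassForest.copies (F : MassForest) (cut : ℕ → ℕ) : MassForest where
  parent k := Nat.pair k.unpair.1 (F.parent k.unpair.2)
  mass k := if k.unpair.2 < cut k.unpair.1 then F.mass k.unpair.2 else 0
  parent_lt k hk := by
    have h : F.mass k.unpair.2 ≠ 0 := fun h => hk (by simp [h])
    conv_rhs => rw [← Nat.pair_unpair k]
    exact Nat.pair_lt_pair_right _ (F.parent_lt _ h)
  mass_le k := by
    split_ifs
    · exact F.mass_le _
    · positivity
  sum_mass_le u := by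
    rw [ENNReal.tsum_eq_tsum_pair]
    simp only [Nat.unpair_pair]
    rw [tsum_eq_single u.unpair.1]
    · refine le_trans (ENNReal.tsum_le_tsum fun c => ?_) (F.sum_mass_le u.unpair.2)
      by_cases h : Nat.pair u.unpair.1 (F.parent c) = u
      · have h' : F.parent c = u.unpair.2 := by rw [← h]; simp
        rw [if_pos h, if_pos h']
        split_ifs
        · exact le_rfl
        · simp
      · rw [if_neg h]; exact zero_le
    · intro i hi
      refine ENNReal.tsum_eq_zero.2 fun c => if_neg fun h => hi ?_
      rw [← h]; simp

lemma MassForest.copies_parent (F : MassForest) (cut : ℕ → ℕ) (i c : ℕ) :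
    (F.copies cut).parent (Nat.pair i c) = Nat.pair i (F.parent c) := by
  simp [MassForest.copies]

lemma MassForest.copies_mass (F : MassForest) (cut : ℕ → ℕ) (i c : ℕ) :
    (F.copies cut).mass (Nat.pair i c) = if c < cut i then F.mass c else 0 := by
  simp [MassForest.copies]

/-- A rectangle covering the first `M` copies beyond all of their cuts contains each edge of these
copies entirely and meets no edge of the others. -/
lemma MassForest.copies_finite (F : MassForest) (cut : ℕ → ℕ) (A₀ : Finset ℕ) :
    ∃ A, A₀ ⊆ A ∧ ∀ k, (F.copies cut).mass k ≠ 0 → (k ∈ A ↔ (F.copies cut).parent k ∈ A) := by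
  set M := A₀.sup id + 1 with hM
  set L := M + ∑ i ∈ Finset.range M, cut i with hL
  refine ⟨(Finset.range M ×ˢ Finset.range L).image fun x => Nat.pair x.1 x.2, fun k hk => ?_,
    fun k hk => ?_⟩
  · have h1 : k ≤ A₀.sup id := Finset.le_sup (f := id) hk
    have h2 := Nat.unpair_left_le k
    have h3 := Nat.unpair_right_le k
    exact Finset.mem_image.2 ⟨k.unpair, Finset.mem_product.2
      ⟨Finset.mem_range.2 (by omega), Finset.mem_range.2 (by omega)⟩, Nat.pair_unpair k⟩
  · obtain ⟨i, c, rfl⟩ : ∃ i c, Nat.pair i c = k := ⟨_, _, Nat.pair_unpair k⟩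
    rw [F.copies_mass] at hk
    rw [F.copies_parent]
    have hmem : ∀ i c, Nat.pair i c ∈ (Finset.range M ×ˢ Finset.range L).image
        (fun x => Nat.pair x.1 x.2) ↔ i < M ∧ c < L := by
      intro i c
      simp only [Finset.mem_image, Finset.mem_product, Finset.mem_range, Prod.exists]
      constructor
      · rintro ⟨a, b, h, h'⟩
        obtain ⟨rfl, rfl⟩ := Nat.pair_eq_pair.1 h'
        exact h
      · intro h; exact ⟨i, c, h, rfl⟩
    rw [hmem, hmem]
    split_ifs at hk with hc
    · have hlt := F.parent_lt c hk
      refine and_congr_right fun hi => ?_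
      have : cut i ≤ ∑ i ∈ Finset.range M, cut i :=
        Finset.single_le_sum (f := cut) (fun _ _ => Nat.zero_le _) (Finset.mem_range.2 hi)
      constructor <;> intro <;> omega
    · exact absurd rfl hk

lemma MassForest.copies_branchMass_le (F : MassForest) (cut : ℕ → ℕ) (R i c : ℕ) :
    (F.copies cut).branchMass R (Nat.pair i c) ≤ F.branchMass R c := by
  induction R generalizing c with
  | zero => exact le_rfl
  | succ R ih =>
    simp only [MassForest.branchMass, F.copies_parent, F.copies_mass]
    refine mul_le_mul' ?_ (ih _)
    split_ifs
    · exact le_rfl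
    · simp

/-- A sequence placed in the `i`-th copy. -/
def copySeq (i : ℕ) (a : ℕ → 𝕜) (k : ℕ) : 𝕜 := if k.unpair.1 = i then a k.unpair.2 else 0

lemma restr_copySeq (i : ℕ) (A : Finset ℕ) (a : ℕ → 𝕜) :
    restr (A.image (Nat.pair i)) (copySeq i a) = copySeq i (restr A a) := by
  funext k
  obtain ⟨j, c, rfl⟩ : ∃ i c, Nat.pair i c = k := ⟨_, _, Nat.pair_unpair k⟩
  simp only [restr_apply, copySeq, Nat.unpair_pair, Finset.mem_image, Nat.pair_eq_pair]
  by_cases hj : j = i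
  · subst hj; simp
  · simp [hj]

/-- Nodes at or beyond the cut are isolated, so nothing is passed on to them and only the energy
below the cut remains. -/
lemma pen_diff_copySeq (F : MassForest) (hp0 : 0 < p) (cut : ℕ → ℕ) (i : ℕ) (a : ℕ → 𝕜)
    (ha : ∀ c, cut i ≤ c → a c = 0) :
    pen p ((F.copies cut).diff 𝕜 p (copySeq i a))
      = ∑ c ∈ Finset.range (cut i), ‖F.diff 𝕜 p a c‖ₑ ^ p := by
  unfold pen
  rw [ENNReal.tsum_eq_tsum_pair, tsum_eq_single i, ← ENNReal.tsum_ite_mem]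
  · refine tsum_congr fun c => ?_
    simp only [MassForest.diff_apply,
      F.copies_parent, MassForest.weight, F.copies_mass, copySeq, Nat.unpair_pair,
      Finset.mem_range, if_true]
    by_cases hc : c < cut i
    · simp [hc]
    · simp [hc, ha c (not_lt.1 hc), hp0, hp0.ne']
  · intro j hj
    refine ENNReal.tsum_eq_zero.2 fun c => ?_
    simp [MassForest.diff_apply, F.copies_parent, copySeq, hj, hp0]

/-- The first part of the theorem, for unbounded growth functions. -/
theorem ellp_exists_basis_of_not_bddAbove (hp0 : 0 < p) (hp1 : p ≤ 1) {φ : ℝ → ℝ} (hφ0 : φ 0 = 0)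
    (hmono : MonotoneOn φ (Set.Ici 0)) (hconc : ConcaveOn ℝ (Set.Ici 0) φ)
    (hne : ∃ x, 0 ≤ x ∧ φ x ≠ 0) (hunb : ¬ BddAbove (φ '' Set.Ici 0)) :
    ∃ B : QBasis 𝕜 (EllP 𝕜 p), B.IsSchauder ∧ B.IsAlmostGreedy ∧
      B.CondConstEquiv (fun m : ℕ => φ (Real.log m) ^ (1 / p)) := by
  have hpos := ConcaveOn.pos_of_ne_zero hφ0 hmono hconc hne one_pos
  set n := growthLevel φ with hn
  have hn0 : n 0 = 0 := growthLevel_zero hφ0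
  have hnm : StrictMono n := growthLevel_strictMono hφ0 hmono hconc hpos hunb
  set F := levelForest hnm
  have M := ellpModel 𝕜 (F.copies (levelStart n)) hp0 hp1 (F.copies_finite _)
  have hψ : ∀ m : ℕ, 0 ≤ φ (Real.log m) := fun m => by
    rw [← hφ0]
    exact hmono (Set.mem_Ici.2 le_rfl) (Set.mem_Ici.2 (Real.log_natCast_nonneg m))
      (Real.log_natCast_nonneg m)
  refine M.exists_basis hp0 hp1 (fun m => φ (Real.log m)) hψ (c := 1 / (4 * φ 1)) (C := 8 / φ 1)
    (by positivity) (by positivity) (fun m hm => ?_) (fun m hm => ?_)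
  · obtain ⟨L, -, h2, h3, -⟩ := exists_level_bounds hφ0 hmono hconc hpos hunb hm
    refine ⟨L + 1, 2, by push_cast; linarith, fun k => ?_⟩
    obtain ⟨i, c, rfl⟩ : ∃ i c, Nat.pair i c = k := ⟨_, _, Nat.pair_unpair k⟩
    calc (m : ℝ≥0∞) * (F.copies (levelStart n)).branchMass (L + 1) (Nat.pair i c)
        ≤ 2 ^ n (L + 1) * F.branchMass (L + 1) c := by
          refine mul_le_mul' ?_ (F.copies_branchMass_le _ _ _ _)
          exact_mod_cast h2
      _ ≤ 2 := levelForest_branchMass_le hnm hn0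
          (growthLevel_superadd hφ0 hmono hconc hunb) _ _
  · obtain ⟨L, h1, -, -, h4⟩ := exists_level_bounds hφ0 hmono hconc hpos hunb hm
    set h := harmonicSeq 𝕜 p hnm
    set s := Finset.range (levelStart n L) with hs
    -- The `L`-th copy consists of exactly `L` levels, which is what the alternating projection
    -- needs.
    refine ⟨s.image (Nat.pair L), (evenNodes n L).image (Nat.pair L), copySeq L h,
      Finset.card_image_le.trans ((card_evenNodes_le hnm L).trans h1), ?_, ?_⟩
    · rw [restr_copySeq, pen_diff_copySeq F hp0]
      · exact (sum_le_pen _ _).trans (pen_diff_restr_harmonicSeq_le hp0 hp1 hnm _)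
      · intro c hc
        simp [restr_apply, hs, hc]
    · rw [restr_copySeq, restr_copySeq, hs, restr_evenNodes_restr, pen_diff_copySeq F hp0]
      · refine le_trans ?_ (le_sum_diff_restr_evenNodes hp0 hnm hn0 L)
        rw [← ENNReal.ofReal_natCast]
        exact ENNReal.ofReal_le_ofReal h4
      · intro c hc
        have : c ∉ evenNodes n L := fun h' => by
          have := Finset.mem_range.1 (Finset.mem_filter.1 h').1
          omega
        simp [restr_apply, this]

/-- The first part of the theorem, for bounded growth functions. -/
theorem ellp_exists_basis_of_bddAbove (hp0 : 0 < p) (hp1 : p ≤ 1) {φ : ℝ → ℝ} (hφ0 : φ 0 = 0)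
    (hmono : MonotoneOn φ (Set.Ici 0)) (hconc : ConcaveOn ℝ (Set.Ici 0) φ)
    (hne : ∃ x, 0 ≤ x ∧ φ x ≠ 0) (hbdd : BddAbove (φ '' Set.Ici 0)) :
    ∃ B : QBasis 𝕜 (EllP 𝕜 p), B.IsSchauder ∧ B.IsAlmostGreedy ∧
      B.CondConstEquiv (fun m : ℕ => φ (Real.log m) ^ (1 / p)) := by
  obtain ⟨b, hb⟩ := hbdd
  have hl2 : 0 < Real.log 2 := Real.log_pos (by norm_num)
  have hpos := ConcaveOn.pos_of_ne_zero hφ0 hmono hconc hne hl2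
  have hφb : ∀ x, 0 ≤ x → φ x ≤ b := fun x hx => hb ⟨x, hx, rfl⟩
  have hb0 : 0 < b := hpos.trans_le (hφb _ hl2.le)
  have M := ellpModel 𝕜 edgelessForest hp0 hp1
    (fun A₀ => ⟨A₀, subset_rfl, fun k hk => absurd rfl hk⟩)
  have hlog : ∀ m : ℕ, 0 ≤ Real.log m := Real.log_natCast_nonneg
  have hψ : ∀ m : ℕ, 0 ≤ φ (Real.log m) := fun m => by
    rw [← hφ0]
    exact hmono (Set.mem_Ici.2 le_rfl) (Set.mem_Ici.2 (hlog m)) (hlog m)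
  refine M.exists_basis hp0 hp1 (fun m => φ (Real.log m)) hψ (c := 1 / b)
    (C := 1 / φ (Real.log 2)) (by positivity) (by positivity) (fun m hm => ?_) (fun m hm => ?_)
  -- Without edges nothing is inherited after one generation, so the constants stay bounded, as does
  -- `φ(log m)` between `φ(log 2)` and `b`.
  · refine ⟨1, 0, ?_, fun k => ?_⟩
    · rw [one_div, inv_mul_eq_div, le_div_iff₀ hpos]
      simp only [Nat.cast_one, NNReal.coe_zero, add_zero, one_mul]
      exact hmono (Set.mem_Ici.2 hl2.le) (Set.mem_Ici.2 (hlog m))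
        (Real.log_le_log (by norm_num) (by exact_mod_cast hm))
    · simp [MassForest.branchMass, edgelessForest]
  · have h1 : edgelessForest.diff 𝕜 p (restr {0} (Pi.single 0 1)) = Pi.single 0 1 := by
      funext k
      rw [MassForest.diff_apply, MassForest.weight_eq_zero _ hp0 rfl]
      by_cases hk : k = 0 <;> simp [restr_apply, hk]
    have h2 : restr {0} (restr {0} (Pi.single 0 (1 : 𝕜))) = restr {0} (Pi.single 0 1) := by
      funext k
      by_cases hk : k = 0 <;> simp [restr_apply, hk]
    refine ⟨{0}, {0}, Pi.single 0 1, by simp; omega, ?_, ?_⟩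
    · rw [h1, pen_single hp0]; norm_num
    · rw [h2, h1, pen_single hp0, ENNReal.ofReal_le_one, one_div, inv_mul_eq_div, div_le_one hb0]
      exact hφb _ (hlog m)

end EllP

/-! ### Intervals attached to the nodes of a tree -/

section Intervals

/-- The length of the interval of a node. -/
noncomputable def nodeMass (δ : ℕ → ℕ) (k : ℕ) : ℝ :=
  if deltaParent δ k < k then nodeMass δ (deltaParent δ k) / δ (deltaParent δ k) else 1
termination_by k

/-- The left end point of the interval of a node. -/
noncomputable def nodeLeft (δ : ℕ → ℕ) (k : ℕ) : ℝ :=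
  if deltaParent δ k < k then nodeLeft δ (deltaParent δ k) +
    ((k : ℝ) - blockStart δ (deltaParent δ k)) * nodeMass δ k else 0
termination_by k

/-- The interval of a node; the intervals of the children of a node partition it evenly. -/
def nodeSet (δ : ℕ → ℕ) (k : ℕ) : Set ℝ :=
  Set.Ico (nodeLeft δ k) (nodeLeft δ k + nodeMass δ k)

/-- The indicator function of the interval of a node. -/
noncomputable def nodeInd (δ : ℕ → ℕ) (k : ℕ) (t : ℝ) : ℝ := (nodeSet δ k).indicator 1 t

variable {δ : ℕ → ℕ}

lemma nodeMass_zero (δ : ℕ → ℕ) : nodeMass δ 0 = 1 := by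
  rw [nodeMass, if_neg (by omega)]

lemma nodeLeft_zero (δ : ℕ → ℕ) : nodeLeft δ 0 = 0 := by
  rw [nodeLeft, if_neg (by omega)]

lemma nodeMass_of_ne_zero (hδ : ∀ n, 2 ≤ δ n) {k : ℕ} (hk : k ≠ 0) :
    nodeMass δ k = nodeMass δ (deltaParent δ k) / δ (deltaParent δ k) := by
  conv_lhs => rw [nodeMass, if_pos (deltaParent_lt hδ hk)]

lemma nodeLeft_of_ne_zero (hδ : ∀ n, 2 ≤ δ n) {k : ℕ} (hk : k ≠ 0) :
    nodeLeft δ k = nodeLeft δ (deltaParent δ k) +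
      ((k : ℝ) - blockStart δ (deltaParent δ k)) * nodeMass δ k := by
  conv_lhs => rw [nodeLeft, if_pos (deltaParent_lt hδ hk)]

lemma nodeMass_pos (hδ : ∀ n, 2 ≤ δ n) (k : ℕ) : 0 < nodeMass δ k := by
  induction k using Nat.strong_induction_on with
  | _ k ih =>
    by_cases hk : k = 0
    · rw [hk, nodeMass_zero]; norm_num
    · rw [nodeMass_of_ne_zero hδ hk]
      have h1 := ih _ (deltaParent_lt hδ hk)
      have h2 : (2 : ℝ) ≤ δ (deltaParent δ k) := by exact_mod_cast hδ _
      positivity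

lemma nodeMass_le_half (hδ : ∀ n, 2 ≤ δ n) {k : ℕ} (hk : k ≠ 0) :
    nodeMass δ k ≤ nodeMass δ (deltaParent δ k) / 2 := by
  rw [nodeMass_of_ne_zero hδ hk]
  have h1 := nodeMass_pos hδ (deltaParent δ k)
  have h2 : (2 : ℝ) ≤ δ (deltaParent δ k) := by exact_mod_cast hδ _
  gcongr

lemma nodeMass_le_one (hδ : ∀ n, 2 ≤ δ n) (k : ℕ) : nodeMass δ k ≤ 1 := by
  induction k using Nat.strong_induction_on with
  | _ k ih =>
    by_cases hk : k = 0
    · rw [hk, nodeMass_zero]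
    · have h1 := ih _ (deltaParent_lt hδ hk)
      have h2 := nodeMass_le_half hδ hk
      linarith

/-- All nodes from `blockStart δ N` on have their parent at `N` or later, and each generation at
least halves the length. -/
lemma exists_nodeMass_le_pow (hδ : ∀ n, 2 ≤ δ n) (i : ℕ) :
    ∃ N, ∀ k, N ≤ k → nodeMass δ k ≤ (1 / 2) ^ i := by
  induction i with
  | zero => exact ⟨0, fun k _ => by simpa using nodeMass_le_one hδ k⟩
  | succ i ih =>
    obtain ⟨N, hN⟩ := ih
    refine ⟨blockStart δ N, fun k hk => ?_⟩
    have hk0 : k ≠ 0 := by have := lt_blockStart hδ N; omega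
    have h1 : N ≤ deltaParent δ k := by
      by_contra h
      have := (deltaParent_lt_iff hδ hk0).1 (not_le.1 h)
      omega
    have h2 := hN _ h1
    have h3 := nodeMass_le_half hδ hk0
    rw [pow_succ]
    linarith

lemma exists_nodeMass_lt (hδ : ∀ n, 2 ≤ δ n) {ε : ℝ} (hε : 0 < ε) :
    ∃ N, ∀ k, N ≤ k → nodeMass δ k < ε := by
  obtain ⟨i, hi⟩ := exists_pow_lt_of_lt_one hε (by norm_num : (1 / 2 : ℝ) < 1)
  obtain ⟨N, hN⟩ := exists_nodeMass_le_pow hδ i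
  exact ⟨N, fun k hk => (hN k hk).trans_lt hi⟩

open Classical in
lemma nodeInd_eq (δ : ℕ → ℕ) (k : ℕ) (t : ℝ) :
    nodeInd δ k t = if t ∈ nodeSet δ k then 1 else 0 := by
  simp [nodeInd, Set.indicator_apply]

lemma nodeInd_nonneg (δ : ℕ → ℕ) (k : ℕ) (t : ℝ) : 0 ≤ nodeInd δ k t := by
  rw [nodeInd_eq]; split_ifs <;> norm_num

lemma sum_indicator_Ico (l m : ℝ) (hm : 0 ≤ m) (d : ℕ) (t : ℝ) :
    ∑ i ∈ Finset.range d, (Set.Ico (l + i * m) (l + i * m + m)).indicator (1 : ℝ → ℝ) t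
      = (Set.Ico l (l + d * m)).indicator 1 t := by
  induction d with
  | zero => simp
  | succ d ih =>
    rw [Finset.sum_range_succ, ih]
    have h1 : (Set.Ico l (l + (d + 1 : ℕ) * m))
        = Set.Ico l (l + d * m) ∪ Set.Ico (l + d * m) (l + d * m + m) := by
      rw [Set.Ico_union_Ico_eq_Ico (by nlinarith [(Nat.cast_nonneg d : (0 : ℝ) ≤ d)])
        (by linarith)]
      congr 1; push_cast; ring
    rw [h1, Set.indicator_union_of_disjoint]
    rw [Set.disjoint_left]
    rintro x ⟨-, hx⟩ ⟨hx', -⟩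
    linarith

lemma sum_nodeInd_children (hδ : ∀ n, 2 ≤ δ n) (k : ℕ) (t : ℝ) :
    ∑ j ∈ Finset.Ico (blockStart δ k) (blockStart δ (k + 1)), nodeInd δ j t = nodeInd δ k t := by
  have hpos := nodeMass_pos hδ k
  have hd : (0 : ℝ) < δ k := by have := hδ k; positivity
  rw [Finset.sum_Ico_eq_sum_range, blockStart_succ, Nat.add_sub_cancel_left]
  have h := sum_indicator_Ico (nodeLeft δ k) (nodeMass δ k / δ k) (by positivity) (δ k) t
  rw [mul_div_cancel₀ _ hd.ne'] at h
  unfold nodeInd nodeSet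
  rw [← h]
  refine Finset.sum_congr rfl fun i hi => ?_
  obtain ⟨hj, hp⟩ := deltaParent_of_mem hδ (k := k) (j := blockStart δ k + i)
    (Finset.mem_Ico.2 ⟨Nat.le_add_right _ _, by
      rw [blockStart_succ]; have := Finset.mem_range.1 hi; omega⟩)
  have hm : nodeMass δ (blockStart δ k + i) = nodeMass δ k / δ k := by
    rw [nodeMass_of_ne_zero hδ hj, hp]
  have hl : nodeLeft δ (blockStart δ k + i) = nodeLeft δ k + i * (nodeMass δ k / δ k) := by
    rw [nodeLeft_of_ne_zero hδ hj, hp, hm]; push_cast; ring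
  rw [hl, hm]

lemma nodeSet_subset_parent (hδ : ∀ n, 2 ≤ δ n) {j : ℕ} (hj : j ≠ 0) :
    nodeSet δ j ⊆ nodeSet δ (deltaParent δ j) := by
  intro t ht
  have h := sum_nodeInd_children hδ (deltaParent δ j) t
  have h1 : nodeInd δ j t ≤ nodeInd δ (deltaParent δ j) t := by
    rw [← h]
    exact Finset.single_le_sum (f := fun j => nodeInd δ j t) (fun i _ => nodeInd_nonneg δ i t)
      ((deltaParent_eq_iff hδ hj).1 rfl)
  rw [nodeInd_eq, nodeInd_eq, if_pos ht] at h1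
  by_contra hn
  rw [if_neg hn] at h1
  norm_num at h1

lemma nodeSet_subset_root (hδ : ∀ n, 2 ≤ δ n) (k : ℕ) : nodeSet δ k ⊆ Set.Ico 0 1 := by
  induction k using Nat.strong_induction_on with
  | _ k ih =>
    by_cases hk : k = 0
    · rw [hk, nodeSet, nodeLeft_zero, nodeMass_zero, zero_add]
    · exact (nodeSet_subset_parent hδ hk).trans (ih _ (deltaParent_lt hδ hk))

/-- Replacing the node `N` by its children in the `N`-th boundary of the tree. -/
lemma sum_boundary_succ {M : Type*} [AddCommGroup M] (hδ : ∀ n, 2 ≤ δ n) (f : ℕ → M) (N : ℕ) :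
    ∑ j ∈ Finset.Ico (N + 1) (blockStart δ (N + 1)), f j
      = ∑ j ∈ Finset.Ico N (blockStart δ N), f j - f N
        + ∑ j ∈ Finset.Ico (blockStart δ N) (blockStart δ (N + 1)), f j := by
  have h1 := lt_blockStart hδ N
  have h2 := (blockStart_strictMono hδ) (Nat.lt_succ_self N)
  rw [Finset.sum_eq_sum_Ico_succ_bot h1, add_sub_cancel_left,
    Finset.sum_Ico_consecutive _ h1 h2.le]

/-- The `N`-th boundary of the tree partitions `[0,1)`. -/
lemma sum_nodeInd_boundary (hδ : ∀ n, 2 ≤ δ n) (N : ℕ) (t : ℝ) :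
    ∑ j ∈ Finset.Ico N (blockStart δ N), nodeInd δ j t = nodeInd δ 0 t := by
  induction N with
  | zero => simp [blockStart_zero]
  | succ N ih => rw [sum_boundary_succ hδ, ih, sum_nodeInd_children hδ]; ring

lemma eq_of_mem_boundary (hδ : ∀ n, 2 ≤ δ n) {N i j : ℕ} {t : ℝ}
    (hi : i ∈ Finset.Ico N (blockStart δ N)) (hj : j ∈ Finset.Ico N (blockStart δ N))
    (hti : t ∈ nodeSet δ i) (htj : t ∈ nodeSet δ j) : i = j := by
  by_contra hne
  have h := sum_nodeInd_boundary hδ N t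
  have h1 : nodeInd δ i t + nodeInd δ j t ≤ nodeInd δ 0 t := by
    rw [← h, ← Finset.sum_pair (f := fun k => nodeInd δ k t) hne]
    exact Finset.sum_le_sum_of_subset_of_nonneg
      (Finset.insert_subset hi (Finset.singleton_subset_iff.2 hj))
      fun k _ _ => nodeInd_nonneg δ k t
  have h2 : nodeInd δ 0 t ≤ 1 := by rw [nodeInd_eq]; split_ifs <;> norm_num
  rw [nodeInd_eq δ i, nodeInd_eq δ j, if_pos hti, if_pos htj] at h1
  linarith

lemma measurable_nodeInd (δ : ℕ → ℕ) (k : ℕ) : Measurable (nodeInd δ k) :=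
  measurable_one.indicator measurableSet_Ico

/-! ### Normalized indicator functions and summation by parts. -/

section NodeFun

variable {𝕜 : Type*} [RCLike 𝕜] {p : ℝ}

/-- The indicator function of the interval of a node, normalized in `L_p`. -/
noncomputable def nodeFun (𝕜 : Type*) [RCLike 𝕜] (p : ℝ) (δ : ℕ → ℕ) (k : ℕ) (t : ℝ) : 𝕜 :=
  ((nodeMass δ k ^ (-(1 / p)) * nodeInd δ k t : ℝ) : 𝕜)

lemma measurable_nodeFun (δ : ℕ → ℕ) (k : ℕ) : Measurable (nodeFun 𝕜 p δ k) :=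
  RCLike.measurable_ofReal.comp ((measurable_nodeInd δ k).const_mul _)

lemma enorm_nodeFun_rpow (hp0 : 0 < p) (hδ : ∀ n, 2 ≤ δ n) (k : ℕ) (t : ℝ) :
    ‖nodeFun 𝕜 p δ k t‖ₑ ^ p
      = (nodeSet δ k).indicator (fun _ => ENNReal.ofReal (nodeMass δ k)⁻¹) t := by
  have hm := nodeMass_pos hδ k
  rw [nodeFun, enorm_rpow_eq_ofReal hp0, RCLike.norm_ofReal,
    abs_of_nonneg (mul_nonneg (by positivity) (nodeInd_nonneg δ k t)), nodeInd_eq]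
  by_cases h : t ∈ nodeSet δ k
  · rw [if_pos h, Set.indicator_of_mem h, mul_one, ← Real.rpow_mul hm.le]
    rw [show -(1 / p) * p = -1 by field_simp, Real.rpow_neg_one]
  · rw [if_neg h, Set.indicator_of_notMem h, mul_zero, Real.zero_rpow hp0.ne', ENNReal.ofReal_zero]

lemma lintegral_enorm_nodeFun_rpow (hp0 : 0 < p) (hδ : ∀ n, 2 ≤ δ n) (k : ℕ) :
    ∫⁻ t, ‖nodeFun 𝕜 p δ k t‖ₑ ^ p = 1 := by
  simp_rw [enorm_nodeFun_rpow hp0 hδ]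
  have hm := nodeMass_pos hδ k
  have hmeas : MeasurableSet (nodeSet δ k) := measurableSet_Ico
  rw [MeasureTheory.lintegral_indicator_const hmeas, nodeSet, Real.volume_Ico, add_sub_cancel_left,
    ← ENNReal.ofReal_mul (by positivity), inv_mul_cancel₀ hm.ne', ENNReal.ofReal_one]

lemma weight_mul_nodeFun (hδ : ∀ n, 2 ≤ δ n) {j : ℕ} (hj : j ≠ 0) (t : ℝ) :
    (deltaForest δ hδ).weight 𝕜 p j * nodeFun 𝕜 p δ j t
      = ((nodeMass δ (deltaParent δ j) ^ (-(1 / p)) * nodeInd δ j t : ℝ) : 𝕜) := by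
  have hm := nodeMass_pos hδ (deltaParent δ j)
  have hd : (0 : ℝ) < δ (deltaParent δ j) := by have := hδ (deltaParent δ j); positivity
  rw [MassForest.weight, nodeFun, deltaForest_mass hδ hj, nodeMass_of_ne_zero hδ hj]
  rw [← RCLike.ofReal_mul, ← mul_assoc]
  congr 2
  push_cast
  rw [Real.div_rpow hm.le hd.le, Real.inv_rpow hd.le, Real.rpow_neg hd.le (1 / p)]
  have : (0 : ℝ) < (δ (deltaParent δ j) : ℝ) ^ (1 / p) := by positivity
  field_simp

lemma sum_weight_mul_nodeFun (hδ : ∀ n, 2 ≤ δ n) (k : ℕ) (t : ℝ) :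
    ∑ j ∈ Finset.Ico (blockStart δ k) (blockStart δ (k + 1)),
      (deltaForest δ hδ).weight 𝕜 p j * nodeFun 𝕜 p δ j t = nodeFun 𝕜 p δ k t := by
  rw [Finset.sum_congr rfl fun j hj => by
    rw [weight_mul_nodeFun hδ (deltaParent_of_mem hδ hj).1, (deltaParent_of_mem hδ hj).2]]
  rw [nodeFun, ← sum_nodeInd_children hδ k t, Finset.mul_sum]
  push_cast
  rfl

/-- Summation by parts along the tree. -/
lemma sum_diff_mul_nodeFun (hp0 : 0 < p) (hδ : ∀ n, 2 ≤ δ n) (a : ℕ → 𝕜) (N : ℕ) (t : ℝ) :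
    ∑ j ∈ Finset.range N, (deltaForest δ hδ).diff 𝕜 p a j * nodeFun 𝕜 p δ j t
      = ∑ j ∈ Finset.Ico N (blockStart δ N),
        (deltaForest δ hδ).weight 𝕜 p j * a (deltaParent δ j) * nodeFun 𝕜 p δ j t := by
  induction N with
  | zero =>
    simp [blockStart_zero, MassForest.weight_eq_zero _ hp0 (deltaForest_mass_zero hδ)]
  | succ N ih =>
    rw [Finset.sum_range_succ, sum_boundary_succ hδ, ih]
    have h1 : ∑ j ∈ Finset.Ico (blockStart δ N) (blockStart δ (N + 1)),
        (deltaForest δ hδ).weight 𝕜 p j * a (deltaParent δ j) * nodeFun 𝕜 p δ j t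
        = a N * nodeFun 𝕜 p δ N t := by
      rw [← sum_weight_mul_nodeFun hδ N t, Finset.mul_sum]
      refine Finset.sum_congr rfl fun j hj => ?_
      rw [(deltaParent_of_mem hδ hj).2]; ring
    rw [h1, MassForest.diff_apply, deltaForest_parent]
    ring

/-- The intervals of a boundary are disjoint, so at most one summand is nonzero at `t`. After
integration the boundary functions span an isometric copy of a finite-dimensional `ℓ_p`. -/
lemma enorm_sum_boundary_rpow (hp0 : 0 < p) (hδ : ∀ n, 2 ≤ δ n) (z : ℕ → 𝕜) (N : ℕ) (t : ℝ) :
    ‖∑ j ∈ Finset.Ico N (blockStart δ N), z j * nodeFun 𝕜 p δ j t‖ₑ ^ p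
      = ∑ j ∈ Finset.Ico N (blockStart δ N), ‖z j‖ₑ ^ p * ‖nodeFun 𝕜 p δ j t‖ₑ ^ p := by
  have hzero : ∀ j, t ∉ nodeSet δ j → nodeFun 𝕜 p δ j t = 0 := fun j h => by
    simp [nodeFun, nodeInd_eq, h]
  by_cases h : ∃ i ∈ Finset.Ico N (blockStart δ N), t ∈ nodeSet δ i
  · obtain ⟨i, hi, hti⟩ := h
    have h1 : ∀ j ∈ Finset.Ico N (blockStart δ N), j ≠ i → nodeFun 𝕜 p δ j t = 0 :=
      fun j hj hji => hzero j fun htj => hji (eq_of_mem_boundary hδ hj hi htj hti)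
    rw [Finset.sum_eq_single_of_mem i hi fun j hj hji => by rw [h1 j hj hji, mul_zero],
      Finset.sum_eq_single_of_mem i hi fun j hj hji => by
        rw [h1 j hj hji, enorm_zero_rpow hp0, mul_zero],
      enorm_mul, ENNReal.mul_rpow_of_nonneg _ _ hp0.le]
  · push Not at h
    rw [Finset.sum_eq_zero fun j hj => by rw [hzero j (h j hj), mul_zero],
      Finset.sum_eq_zero fun j hj => by rw [hzero j (h j hj), enorm_zero_rpow hp0, mul_zero],
      enorm_zero_rpow hp0]

lemma lintegral_enorm_sum_boundary_rpow (hp0 : 0 < p) (hδ : ∀ n, 2 ≤ δ n) (z : ℕ → 𝕜) (N : ℕ) :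
    ∫⁻ t, ‖∑ j ∈ Finset.Ico N (blockStart δ N), z j * nodeFun 𝕜 p δ j t‖ₑ ^ p
      = ∑ j ∈ Finset.Ico N (blockStart δ N), ‖z j‖ₑ ^ p := by
  simp_rw [enorm_sum_boundary_rpow hp0 hδ]
  rw [MeasureTheory.lintegral_finsetSum]
  · refine Finset.sum_congr rfl fun j _ => ?_
    rw [MeasureTheory.lintegral_const_mul, lintegral_enorm_nodeFun_rpow hp0 hδ, mul_one]
    exact (measurable_nodeFun δ j).enorm.pow_const p
  · intro j _
    exact ((measurable_nodeFun δ j).enorm.pow_const p).const_mul _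

end NodeFun

end Intervals

/-! ### `X_p(δ)` as a space of null combinations -/

section Null

variable {𝕜 : Type*} [RCLike 𝕜] {p : ℝ} {δ : ℕ → ℕ}

lemma summable_of_tsum_enorm_rpow_ne_top {ι : Type*} (hp0 : 0 < p) (hp1 : p ≤ 1) {z : ι → 𝕜}
    (h : ∑' i, ‖z i‖ₑ ^ p ≠ ∞) : Summable z := by
  have h1 : (∑' i, ‖z i‖ₑ) ^ p ≠ ∞ :=
    ne_top_of_le_ne_top h (ENNReal.tsum_rpow_le_tsum_rpow hp0 hp1 _)
  have h2 : ∑' i, ‖z i‖ₑ ≠ ∞ := fun h' => h1 (by rw [h']; exact ENNReal.top_rpow_of_pos hp0)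
  exact Summable.of_norm ((ENNReal.summable_toReal h2).congr fun i => toReal_enorm _)

lemma measurable_enorm_mul_nodeFun_rpow (z : 𝕜) (δ : ℕ → ℕ) (k : ℕ) :
    Measurable fun t => ‖z * nodeFun 𝕜 p δ k t‖ₑ ^ p :=
  ((measurable_nodeFun δ k).const_mul z).enorm.pow_const p

lemma lintegral_enorm_mul_nodeFun_rpow (hp0 : 0 < p) (hδ : ∀ n, 2 ≤ δ n) (z : 𝕜) (k : ℕ) :
    ∫⁻ t, ‖z * nodeFun 𝕜 p δ k t‖ₑ ^ p = ‖z‖ₑ ^ p := by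
  simp_rw [enorm_mul, ENNReal.mul_rpow_of_nonneg _ _ hp0.le]
  rw [MeasureTheory.lintegral_const_mul _ ((measurable_nodeFun δ k).enorm.pow_const p),
    lintegral_enorm_nodeFun_rpow hp0 hδ, mul_one]

lemma lintegral_tsum_enorm_mul_nodeFun_rpow (hp0 : 0 < p) (hδ : ∀ n, 2 ≤ δ n) (α : ℕ → 𝕜) :
    ∫⁻ t, ∑' j, ‖α j * nodeFun 𝕜 p δ j t‖ₑ ^ p = pen p α := by
  rw [MeasureTheory.lintegral_tsum fun j =>
    (measurable_enorm_mul_nodeFun_rpow (α j) δ j).aemeasurable]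
  exact tsum_congr fun j => lintegral_enorm_mul_nodeFun_rpow hp0 hδ _ _

lemma ae_summable_mul_nodeFun (hp0 : 0 < p) (hp1 : p ≤ 1) (hδ : ∀ n, 2 ≤ δ n) {α : ℕ → 𝕜}
    (hα : pen p α ≠ ∞) : ∀ᵐ t, Summable fun j => α j * nodeFun 𝕜 p δ j t := by
  have h : ∀ᵐ t, ∑' j, ‖α j * nodeFun 𝕜 p δ j t‖ₑ ^ p < ∞ :=
    MeasureTheory.ae_lt_top
      (Measurable.tsum fun j => measurable_enorm_mul_nodeFun_rpow (α j) δ j)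
      (by rwa [lintegral_tsum_enorm_mul_nodeFun_rpow hp0 hδ])
  filter_upwards [h] with t ht
  exact summable_of_tsum_enorm_rpow_ne_top hp0 hp1 ht.ne

/-- The function represented by a sequence of coefficients. -/
noncomputable def synth (p : ℝ) (δ : ℕ → ℕ) (α : ℕ → 𝕜) (t : ℝ) : 𝕜 :=
  ∑' j, α j * nodeFun 𝕜 p δ j t

lemma synth_add (hp0 : 0 < p) (hp1 : p ≤ 1) (hδ : ∀ n, 2 ≤ δ n) {α β : ℕ → 𝕜}
    (hα : pen p α ≠ ∞) (hβ : pen p β ≠ ∞) :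
    ∀ᵐ t, synth p δ (α + β) t = synth p δ α t + synth p δ β t := by
  filter_upwards [ae_summable_mul_nodeFun hp0 hp1 hδ hα, ae_summable_mul_nodeFun hp0 hp1 hδ hβ]
    with t h1 h2
  unfold synth
  rw [← h1.tsum_add h2]
  exact tsum_congr fun j => by rw [Pi.add_apply]; ring

lemma synth_smul (c : 𝕜) (α : ℕ → 𝕜) (t : ℝ) : synth p δ (c • α) t = c * synth p δ α t := by
  unfold synth
  rw [← tsum_mul_left]
  exact tsum_congr fun j => by rw [Pi.smul_apply, smul_eq_mul]; ring

lemma synth_sub (hp0 : 0 < p) (hp1 : p ≤ 1) (hδ : ∀ n, 2 ≤ δ n) {α β : ℕ → 𝕜}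
    (hα : pen p α ≠ ∞) (hβ : pen p β ≠ ∞) :
    ∀ᵐ t, synth p δ (α - β) t = synth p δ α t - synth p δ β t := by
  filter_upwards [ae_summable_mul_nodeFun hp0 hp1 hδ hα, ae_summable_mul_nodeFun hp0 hp1 hδ hβ]
    with t h1 h2
  unfold synth
  rw [← h1.tsum_sub h2]
  exact tsum_congr fun j => by rw [Pi.sub_apply]; ring

lemma synth_restr (A : Finset ℕ) (α : ℕ → 𝕜) (t : ℝ) :
    synth p δ (restr A α) t = ∑ j ∈ A, α j * nodeFun 𝕜 p δ j t := by
  unfold synth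
  rw [tsum_eq_sum (s := A) fun j hj => by rw [restr_apply, if_neg hj, zero_mul]]
  exact Finset.sum_congr rfl fun j hj => by rw [restr_apply, if_pos hj]

/-- The combination with coefficients `α` vanishes almost everywhere. -/
def IsNull (p : ℝ) (δ : ℕ → ℕ) (α : ℕ → 𝕜) : Prop := ∀ᵐ t, synth p δ α t = 0

lemma pen_restr_ne_top (hp0 : 0 < p) (A : Finset ℕ) (α : ℕ → 𝕜) : pen p (restr A α) ≠ ∞ := by
  rw [pen_restr hp0]
  exact ENNReal.sum_ne_top.2 fun j _ => enorm_rpow_ne_top hp0 _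

/-- The boundary mass of a null combination is controlled by its tail. -/
lemma pen_diff_sub_restr_le (hp0 : 0 < p) (hp1 : p ≤ 1) (hδ : ∀ n, 2 ≤ δ n) {a : ℕ → 𝕜}
    (hfin : pen p ((deltaForest δ hδ).diff 𝕜 p a) ≠ ∞)
    (hnull : IsNull p δ ((deltaForest δ hδ).diff 𝕜 p a)) (N : ℕ) :
    pen p ((deltaForest δ hδ).diff 𝕜 p (a - restr (Finset.range N) a))
      ≤ 2 * pen p ((deltaForest δ hδ).diff 𝕜 p a
        - restr (Finset.range N) ((deltaForest δ hδ).diff 𝕜 p a)) := by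
  set F := deltaForest δ hδ
  set α := F.diff 𝕜 p a with hα
  set τ := α - restr (Finset.range N) α with hτ
  -- Cutting off the first `N` coefficients changes the increments beyond `N` only at nodes whose
  -- parent is cut off, that is, on the `N`-th boundary, where `α j` becomes `a j`.
  have h1 : ∀ j, ‖F.diff 𝕜 p (a - restr (Finset.range N) a) j‖ₑ ^ p ≤ ‖τ j‖ₑ ^ p +
      if j ∈ Finset.Ico N (blockStart δ N) then
        ‖F.weight 𝕜 p j * a (deltaParent δ j)‖ₑ ^ p else 0 := by
    intro j
    have hτj : τ j = if j < N then 0 else α j := by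
      by_cases hj : j < N <;> simp [hτ, restr_apply, hj]
    have hαj : α j = a j - F.weight 𝕜 p j * a (deltaParent δ j) := rfl
    rw [MassForest.diff_apply, deltaForest_parent, hτj]
    simp only [Pi.sub_apply, restr_apply, Finset.mem_range, Finset.mem_Ico]
    by_cases hj0 : j = 0
    · have hw : F.weight 𝕜 p j = 0 := by
        rw [hj0]; exact MassForest.weight_eq_zero _ hp0 (deltaForest_mass_zero hδ)
      rw [hw, zero_mul, sub_zero] at hαj
      rw [hw, zero_mul, zero_mul, sub_zero]
      by_cases hjN : j < N <;> simp [hjN, hαj, hp0]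
    · have hlt := deltaParent_lt hδ hj0
      by_cases hjN : j < N
      · have : deltaParent δ j < N := hlt.trans hjN
        simp [hjN, this, hp0]
      · by_cases hpN : deltaParent δ j < N
        · have hb := (deltaParent_lt_iff hδ hj0).1 hpN
          have e : a j = α j + F.weight 𝕜 p j * a (deltaParent δ j) := by rw [hαj]; ring
          simp only [hjN, hpN, hb, not_lt.1 hjN, if_true, if_false, sub_zero, sub_self, mul_zero,
            and_self]
          conv_lhs => rw [e]
          exact enorm_add_rpow_le hp0 hp1 _ _
        · simp only [hjN, hpN, if_false, sub_zero]
          rw [← hαj]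
          exact le_self_add
  -- The boundary sum is the `p`-integral of the `N`-th partial sum of the synthesis. The full sum
  -- vanishes, so this is minus the tail, whose integral is at most the energy of `τ`.
  have h2 : ∑ j ∈ Finset.Ico N (blockStart δ N), ‖F.weight 𝕜 p j * a (deltaParent δ j)‖ₑ ^ p
      ≤ pen p τ := by
    rw [← lintegral_enorm_sum_boundary_rpow hp0 hδ, ← lintegral_tsum_enorm_mul_nodeFun_rpow hp0 hδ]
    refine MeasureTheory.lintegral_mono_ae ?_
    filter_upwards [hnull, synth_sub hp0 hp1 hδ hfin
      (pen_restr_ne_top hp0 (Finset.range N) α)] with t ht1 ht2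
    rw [← sum_diff_mul_nodeFun hp0 hδ, ← synth_restr]
    rw [ht1, zero_sub] at ht2
    rw [← enorm_neg, ← ht2]
    exact enorm_tsum_rpow_le hp0 hp1 _
  calc _ ≤ _ := ENNReal.tsum_le_tsum h1
    _ = pen p τ + ∑ j ∈ Finset.Ico N (blockStart δ N),
        ‖F.weight 𝕜 p j * a (deltaParent δ j)‖ₑ ^ p := by
      rw [ENNReal.tsum_add, ENNReal.tsum_ite_mem]; rfl
    _ ≤ pen p τ + pen p τ := by gcongr
    _ = _ := (two_mul _).symm

lemma tendsto_pen_diff_sub_restr (hp0 : 0 < p) (hp1 : p ≤ 1) (hδ : ∀ n, 2 ≤ δ n) {a : ℕ → 𝕜}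
    (hfin : pen p ((deltaForest δ hδ).diff 𝕜 p a) ≠ ∞)
    (hnull : IsNull p δ ((deltaForest δ hδ).diff 𝕜 p a)) :
    Tendsto (fun N => pen p ((deltaForest δ hδ).diff 𝕜 p (a - restr (Finset.range N) a)))
      atTop (𝓝 0) := by
  have h1 := (tendsto_pen_sub_restr hp0 hfin).comp tendsto_finset_range
  have h2 := ENNReal.Tendsto.const_mul h1 (a := 2) (Or.inr (by norm_num))
  rw [mul_zero] at h2
  exact tendsto_of_tendsto_of_tendsto_of_le_of_le tendsto_const_nhds h2 (fun _ => zero_le)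
    fun N => pen_diff_sub_restr_le hp0 hp1 hδ hfin hnull N

/-- Null combinations are closed under approximation. -/
lemma isNull_of_approx (hp0 : 0 < p) (hp1 : p ≤ 1) (hδ : ∀ n, 2 ≤ δ n) {α : ℕ → 𝕜}
    (hα : pen p α ≠ ∞)
    (h : ∀ ε : ℝ≥0∞, ε ≠ 0 → ∃ κ : ℕ → 𝕜, pen p κ ≠ ∞ ∧ IsNull p δ κ ∧ pen p (α - κ) ≤ ε) :
    IsNull p δ α := by
  -- For `n = 0` the bound is `∞` and harmless. The function `|synth α|^p` lies below every `H n`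
  -- almost everywhere, and the infimum of the `H n` has integral zero.
  choose κ hκ1 hκ2 hκ3 using fun n : ℕ => h ((n : ℝ≥0∞)⁻¹) (by simp)
  set H : ℕ → ℝ → ℝ≥0∞ := fun n t => ∑' j, ‖(α - κ n) j * nodeFun 𝕜 p δ j t‖ₑ ^ p with hH
  have hmeas : ∀ n, Measurable (H n) := fun n =>
    Measurable.tsum fun j => measurable_enorm_mul_nodeFun_rpow _ δ j
  have hint : ∫⁻ t, ⨅ n, H n t = 0 := by
    refine le_antisymm ?_ zero_le
    have h1 : ∀ n : ℕ, ∫⁻ t, ⨅ n, H n t ≤ (n : ℝ≥0∞)⁻¹ := fun n =>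
      (MeasureTheory.lintegral_mono fun t => iInf_le _ n).trans
        ((lintegral_tsum_enorm_mul_nodeFun_rpow hp0 hδ (α - κ n)).le.trans (hκ3 n))
    exact ge_of_tendsto' ENNReal.tendsto_inv_nat_nhds_zero h1
  have h0 := (MeasureTheory.lintegral_eq_zero_iff (Measurable.iInf hmeas)).1 hint
  have hle : ∀ᵐ t, ∀ n, ‖synth p δ α t‖ₑ ^ p ≤ H n t := by
    rw [MeasureTheory.ae_all_iff]
    intro n
    filter_upwards [hκ2 n, synth_sub hp0 hp1 hδ hα (hκ1 n)] with t h1 h2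
    rw [h1, sub_zero] at h2
    rw [← h2]
    exact enorm_tsum_rpow_le hp0 hp1 _
  filter_upwards [h0, hle] with t h1 h2
  have h3 : ‖synth p δ α t‖ₑ ^ p ≤ 0 := (le_iInf h2).trans h1.le
  simpa [ENNReal.rpow_eq_zero_iff, hp0, not_lt.2 hp0.le] using h3

/-- The indicator of a node is the sum of those of its children, with the right weights. In the
summation by parts formula, the boundary taken far enough out contains no child of `k`. -/
lemma isNull_diff_single (hp0 : 0 < p) (hδ : ∀ n, 2 ≤ δ n) (k : ℕ) :
    IsNull p δ ((deltaForest δ hδ).diff 𝕜 p (Pi.single k 1)) := by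
  refine Eventually.of_forall fun t => ?_
  have h1 : (deltaForest δ hδ).diff 𝕜 p (Pi.single k 1)
      = restr (Finset.range (blockStart δ (k + 1)))
        ((deltaForest δ hδ).diff 𝕜 p (Pi.single k (1 : 𝕜))) := by
    funext j
    rw [restr_apply]
    split_ifs with hj
    · rfl
    · rw [Finset.mem_range] at hj
      have hb := lt_blockStart hδ (k + 1)
      have hj0 : j ≠ 0 := by omega
      have hp : ¬ deltaParent δ j < k + 1 := fun h => hj ((deltaParent_lt_iff hδ hj0).1 h)
      rw [MassForest.diff_apply, deltaForest_parent, Pi.single_eq_of_ne (by omega),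
        Pi.single_eq_of_ne (by omega)]
      simp
  rw [h1, synth_restr, sum_diff_mul_nodeFun hp0 hδ]
  refine Finset.sum_eq_zero fun j hj => ?_
  have hb := lt_blockStart hδ (blockStart δ (k + 1))
  have hb' := lt_blockStart hδ (k + 1)
  have hj1 := (Finset.mem_Ico.1 hj).1
  have hp : ¬ deltaParent δ j < k + 1 := fun h => by
    have := (deltaParent_lt_iff hδ (by omega)).1 h
    omega
  rw [Pi.single_eq_of_ne (by omega)]
  simp

lemma IsNull.add (hp0 : 0 < p) (hp1 : p ≤ 1) (hδ : ∀ n, 2 ≤ δ n) {α β : ℕ → 𝕜}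
    (hα : pen p α ≠ ∞) (hβ : pen p β ≠ ∞) (h1 : IsNull p δ α) (h2 : IsNull p δ β) :
    IsNull p δ (α + β) := by
  filter_upwards [h1, h2, synth_add hp0 hp1 hδ hα hβ] with t ht1 ht2 ht3
  rw [ht3, ht1, ht2, add_zero]

lemma IsNull.smul (c : 𝕜) {α : ℕ → 𝕜} (h : IsNull p δ α) : IsNull p δ (c • α) := by
  filter_upwards [h] with t ht
  rw [synth_smul, ht, mul_zero]

/-- `X_p(δ)` consists of the null combinations. -/
theorem mem_lindSpace_iff (hp0 : 0 < p) (hp1 : p ≤ 1) (hδ : ∀ n, 2 ≤ δ n) (f : EllP 𝕜 p) :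
    f ∈ LindSpace 𝕜 p δ ↔ IsNull p δ (f : ℕ → 𝕜) := by
  constructor
  · intro hf
    -- The null combinations form a closed subspace containing the generators.
    let V : Submodule 𝕜 (EllP 𝕜 p) :=
      { carrier := {f | IsNull p δ (f : ℕ → 𝕜)}
        zero_mem' := by
          change IsNull p δ ((0 : EllP 𝕜 p) : ℕ → 𝕜)
          exact Eventually.of_forall fun t => by simp [synth]
        add_mem' := fun {f g} hf hg => by
          have := IsNull.add hp0 hp1 hδ (EllP.pen_ne_top hp0 f) (EllP.pen_ne_top hp0 g) hf hg
          rwa [← lp.coeFn_add] at this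
        smul_mem' := fun c f hf => by
          have := IsNull.smul c hf
          rwa [← lp.coeFn_smul] at this }
    refine (Submodule.mem_sInf.1 hf) V ⟨?_, fun g hg => ?_⟩
    · rintro _ ⟨k, rfl⟩
      change IsNull p δ ((lindVec 𝕜 p δ k : EllP 𝕜 p) : ℕ → 𝕜)
      rw [lindVec_apply hp0 hδ]
      exact isNull_diff_single hp0 hδ k
    · refine isNull_of_approx hp0 hp1 hδ (EllP.pen_ne_top hp0 g) fun ε hε => ?_
      obtain ⟨r, hr0, hr⟩ : ∃ r : ℝ, 0 < r ∧ ENNReal.ofReal (r ^ p) ≤ ε := by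
        rcases eq_or_ne ε ∞ with rfl | hε'
        · exact ⟨1, one_pos, le_top⟩
        · refine ⟨ε.toReal ^ (1 / p), ?_, ?_⟩
          · have := ENNReal.toReal_pos hε hε'
            positivity
          · rw [one_div, Real.rpow_inv_rpow ENNReal.toReal_nonneg hp0.ne', ENNReal.ofReal_toReal hε']
      obtain ⟨κ, hκ, hlt⟩ := hg r hr0
      refine ⟨κ, EllP.pen_ne_top hp0 κ, hκ, ?_⟩
      have := EllP.pen_le_of_norm_lt hp0 _ hlt
      rw [lp.coeFn_sub] at this
      exact this.trans hr
  · intro hf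
    -- The formal coefficients `a` of `f` exist for every sequence; nullness makes their partial
    -- sums converge to `f`.
    refine Submodule.mem_sInf.2 fun V hV => hV.2 f fun ε hε => ?_
    set a := (deltaForest δ hδ).solFun 𝕜 p f with ha
    have hd : (deltaForest δ hδ).diff 𝕜 p a = f := MassForest.diff_solFun _ hp0 _
    have ht := tendsto_pen_diff_sub_restr hp0 hp1 hδ (a := a)
      (by rw [hd]; exact EllP.pen_ne_top hp0 f) (by rw [hd]; exact hf)
    have hpos : 0 < ENNReal.ofReal (ε ^ p) := by
      rw [ENNReal.ofReal_pos]; positivity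
    obtain ⟨N, hN⟩ := (ht.eventually (gt_mem_nhds hpos)).exists
    refine ⟨∑ k ∈ Finset.range N, a k • lindVec 𝕜 p δ k, V.sum_mem fun k _ =>
      V.smul_mem _ (hV.1 ⟨k, rfl⟩), EllP.norm_lt_of_pen_lt hp0 _ hε ?_⟩
    convert hN using 2
    rw [lp.coeFn_sub, map_sub, hd, restr_eq_sum, lp.coeFn_sum, map_sum]
    congr 1
    refine Finset.sum_congr rfl fun k _ => ?_
    rw [lp.coeFn_smul, lindVec_apply hp0 hδ, map_smul]

end Null

/-! ### Lifting between two trees -/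

section Lift

variable {𝕜 : Type*} [RCLike 𝕜] {p : ℝ} {δ δ' : ℕ → ℕ}

open Classical in
/-- Whether the interval of the node `j` is contained in `I`. -/
noncomputable def nodeIn (δ : ℕ → ℕ) (I : Set ℝ) (j : ℕ) : ℝ :=
  if nodeSet δ j ⊆ I then 1 else 0

/-- Whether the interval of the node `j` is a maximal one contained in `I`. -/
noncomputable def nodeMaxIn (δ : ℕ → ℕ) (I : Set ℝ) (j : ℕ) : ℝ :=
  nodeIn δ I j - if j = 0 then 0 else nodeIn δ I (deltaParent δ j)

lemma nodeMaxIn_eq_zero_or_one (hδ : ∀ n, 2 ≤ δ n) (I : Set ℝ) (j : ℕ) :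
    nodeMaxIn δ I j = 0 ∨ nodeMaxIn δ I j = 1 := by
  unfold nodeMaxIn nodeIn
  by_cases hj : j = 0
  · simp only [hj, if_true, sub_zero]
    split_ifs <;> simp
  · simp only [hj, if_false]
    by_cases h : nodeSet δ (deltaParent δ j) ⊆ I
    · rw [if_pos h, if_pos ((nodeSet_subset_parent hδ hj).trans h)]; simp
    · rw [if_neg h]; split_ifs <;> simp

lemma nodeMaxIn_mul_nodeInd_nonneg (hδ : ∀ n, 2 ≤ δ n) (I : Set ℝ) (j : ℕ) (t : ℝ) :
    0 ≤ nodeMaxIn δ I j * nodeInd δ j t := by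
  rcases nodeMaxIn_eq_zero_or_one hδ I j with h | h <;> simp [h, nodeInd_nonneg]

/-- Maximality is a difference between a node and its parent, so the sum telescopes: what remains
are the boundary nodes whose parent already lies in `I`. -/
lemma sum_nodeMaxIn_mul_nodeInd (hδ : ∀ n, 2 ≤ δ n) (I : Set ℝ) (N : ℕ) (t : ℝ) :
    ∑ j ∈ Finset.range N, nodeMaxIn δ I j * nodeInd δ j t
      = ∑ j ∈ Finset.Ico N (blockStart δ N),
        (if j = 0 then 0 else nodeIn δ I (deltaParent δ j)) * nodeInd δ j t := by
  induction N with
  | zero => simp [blockStart_zero]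
  | succ N ih =>
    rw [Finset.sum_range_succ, sum_boundary_succ hδ, ih]
    have h1 : ∑ j ∈ Finset.Ico (blockStart δ N) (blockStart δ (N + 1)),
        (if j = 0 then 0 else nodeIn δ I (deltaParent δ j)) * nodeInd δ j t
        = nodeIn δ I N * nodeInd δ N t := by
      rw [← sum_nodeInd_children hδ N t, Finset.mul_sum]
      refine Finset.sum_congr rfl fun j hj => ?_
      rw [if_neg (deltaParent_of_mem hδ hj).1, (deltaParent_of_mem hδ hj).2]
    rw [h1, nodeMaxIn]
    ring

open Classical in
lemma sum_nodeMaxIn_mul_nodeInd_le (hδ : ∀ n, 2 ≤ δ n) (I : Set ℝ) (N : ℕ) (t : ℝ) :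
    ∑ j ∈ Finset.range N, nodeMaxIn δ I j * nodeInd δ j t ≤ if t ∈ I then 1 else 0 := by
  rw [sum_nodeMaxIn_mul_nodeInd hδ]
  have hle : ∀ j, (if j = 0 then 0 else nodeIn δ I (deltaParent δ j)) * nodeInd δ j t
      ≤ nodeInd δ j t := by
    intro j
    refine mul_le_of_le_one_left (nodeInd_nonneg δ j t) ?_
    unfold nodeIn
    split_ifs <;> norm_num
  split_ifs with ht
  · calc _ ≤ ∑ j ∈ Finset.Ico N (blockStart δ N), nodeInd δ j t := Finset.sum_le_sum fun j _ => hle j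
      _ = nodeInd δ 0 t := sum_nodeInd_boundary hδ N t
      _ ≤ 1 := by rw [nodeInd_eq]; split_ifs <;> norm_num
  · refine (Finset.sum_eq_zero fun j _ => ?_).le
    by_cases hj : j = 0
    · simp [hj]
    · rw [if_neg hj, nodeIn]
      split_ifs with hs
      · rw [nodeInd_eq, if_neg fun h => ht (hs (nodeSet_subset_parent hδ hj h)), mul_zero]
      · rw [zero_mul]

/-- Interval lengths tend to zero, so far out in the tree the parent of the boundary node containing
`t` is shorter than the distance of `t` to both ends and lies inside `[l, r)`. -/
lemma tendsto_sum_nodeMaxIn_mul_nodeInd (hδ : ∀ n, 2 ≤ δ n) {l r t : ℝ} (hl : l < t) (hr : t < r)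
    (ht : t ∈ Set.Ico (0 : ℝ) 1) :
    Tendsto (fun N => ∑ j ∈ Finset.range N, nodeMaxIn δ (Set.Ico l r) j * nodeInd δ j t) atTop
      (𝓝 1) := by
  obtain ⟨N, hN⟩ := exists_nodeMass_lt hδ (lt_min (sub_pos.2 hl) (sub_pos.2 hr))
  refine tendsto_const_nhds.congr' ?_
  filter_upwards [eventually_ge_atTop (blockStart δ N)] with M hM
  rw [sum_nodeMaxIn_mul_nodeInd hδ]
  have h0 : nodeInd δ 0 t = 1 := by
    rw [nodeInd_eq, if_pos]
    rw [nodeSet, nodeLeft_zero, nodeMass_zero]; simpa using ht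
  rw [← h0, ← sum_nodeInd_boundary hδ M t]
  refine Finset.sum_congr rfl fun j hj => ?_
  by_cases htj : t ∈ nodeSet δ j
  · have hjM := (Finset.mem_Ico.1 hj).1
    have hb := lt_blockStart hδ N
    have hj0 : j ≠ 0 := by omega
    have hp : N ≤ deltaParent δ j := by
      by_contra h
      have := (deltaParent_lt_iff hδ hj0).1 (not_le.1 h)
      omega
    have htp := nodeSet_subset_parent hδ hj0 htj
    have hm := hN _ hp
    have hm1 := hm.trans_le (min_le_left _ _)
    have hm2 := hm.trans_le (min_le_right _ _)
    have hsub : nodeSet δ (deltaParent δ j) ⊆ Set.Ico l r := by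
      intro x hx
      obtain ⟨a1, a2⟩ := htp
      obtain ⟨b1, b2⟩ := hx
      constructor <;> linarith
    rw [if_neg hj0, nodeIn, if_pos hsub, one_mul]
  · rw [nodeInd_eq, if_neg htj, mul_zero]

/-- The left end point is excluded because every interval of the other tree that contains it may
stick out to the left. -/
lemma hasSum_nodeMaxIn_mul_nodeInd (hδ : ∀ n, 2 ≤ δ n) (hδ' : ∀ n, 2 ≤ δ' n) (i : ℕ) {t : ℝ}
    (ht : t ≠ nodeLeft δ' i) :
    HasSum (fun j => nodeMaxIn δ (nodeSet δ' i) j * nodeInd δ j t) (nodeInd δ' i t) := by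
  rw [hasSum_iff_tendsto_nat_of_nonneg fun j => nodeMaxIn_mul_nodeInd_nonneg hδ _ _ _]
  by_cases h : t ∈ nodeSet δ' i
  · rw [nodeInd_eq δ', if_pos h]
    exact tendsto_sum_nodeMaxIn_mul_nodeInd hδ (lt_of_le_of_ne h.1 ht.symm) h.2
      (nodeSet_subset_root hδ' i h)
  · rw [nodeInd_eq δ', if_neg h]
    refine tendsto_const_nhds.congr fun N => ?_
    refine le_antisymm (Finset.sum_nonneg fun j _ => nodeMaxIn_mul_nodeInd_nonneg hδ _ _ _) ?_
    exact (sum_nodeMaxIn_mul_nodeInd_le hδ _ N t).trans (by rw [if_neg h])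

/-- The coefficients of the normalized indicator function of the node `i` of the tree of `δ'`
with respect to the tree of `δ`. -/
noncomputable def liftCol (𝕜 : Type*) [RCLike 𝕜] (p : ℝ) (δ δ' : ℕ → ℕ) (i j : ℕ) : 𝕜 :=
  ((nodeMaxIn δ (nodeSet δ' i) j * (nodeMass δ j / nodeMass δ' i) ^ (1 / p) : ℝ) : 𝕜)

lemma liftCol_mul_nodeFun (hδ : ∀ n, 2 ≤ δ n) (hδ' : ∀ n, 2 ≤ δ' n) (i j : ℕ) (t : ℝ) :
    liftCol 𝕜 p δ δ' i j * nodeFun 𝕜 p δ j t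
      = ((nodeMass δ' i ^ (-(1 / p)) * (nodeMaxIn δ (nodeSet δ' i) j * nodeInd δ j t) : ℝ) : 𝕜) := by
  have h1 := nodeMass_pos hδ j
  have h2 := nodeMass_pos hδ' i
  rw [liftCol, nodeFun, ← RCLike.ofReal_mul]
  congr 1
  rw [Real.div_rpow h1.le h2.le, Real.rpow_neg h1.le, Real.rpow_neg h2.le]
  have : 0 < nodeMass δ j ^ (1 / p) := by positivity
  field_simp

lemma synth_liftCol (hδ : ∀ n, 2 ≤ δ n) (hδ' : ∀ n, 2 ≤ δ' n) (i : ℕ) {t : ℝ}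
    (ht : t ≠ nodeLeft δ' i) : synth p δ (liftCol 𝕜 p δ δ' i) t = nodeFun 𝕜 p δ' i t := by
  unfold synth
  simp_rw [liftCol_mul_nodeFun hδ hδ']
  rw [nodeFun, ← (hasSum_nodeMaxIn_mul_nodeInd hδ hδ' i ht).tsum_eq, ← tsum_mul_left,
    RCLike.ofReal_tsum]

lemma enorm_liftCol_mul_nodeFun_rpow (hp0 : 0 < p) (hδ : ∀ n, 2 ≤ δ n) (hδ' : ∀ n, 2 ≤ δ' n)
    (i j : ℕ) (t : ℝ) : ‖liftCol 𝕜 p δ δ' i j * nodeFun 𝕜 p δ j t‖ₑ ^ p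
      = ENNReal.ofReal (nodeMass δ' i)⁻¹
        * ENNReal.ofReal (nodeMaxIn δ (nodeSet δ' i) j * nodeInd δ j t) := by
  have h2 := nodeMass_pos hδ' i
  rw [liftCol_mul_nodeFun hδ hδ', enorm_rpow_eq_ofReal hp0, RCLike.norm_ofReal,
    abs_of_nonneg (mul_nonneg (by positivity) (nodeMaxIn_mul_nodeInd_nonneg hδ _ _ _)),
    Real.mul_rpow (by positivity) (nodeMaxIn_mul_nodeInd_nonneg hδ _ _ _),
    ← Real.rpow_mul h2.le, show -(1 / p) * p = -1 by field_simp, Real.rpow_neg_one,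
    ENNReal.ofReal_mul (by positivity)]
  congr 2
  rw [nodeInd_eq]
  rcases nodeMaxIn_eq_zero_or_one hδ (nodeSet δ' i) j with h | h <;> rw [h] <;> split_ifs <;>
    simp [hp0.ne']

/-- The maximal intervals inside the given one are disjoint, so their lengths add up to at most its
length. This makes the lifting a contraction on `ℓ_p`, since `p ≤ 1`. -/
lemma pen_liftCol_le (hp0 : 0 < p) (hδ : ∀ n, 2 ≤ δ n) (hδ' : ∀ n, 2 ≤ δ' n) (i : ℕ) :
    pen p (liftCol 𝕜 p δ δ' i) ≤ 1 := by
  rw [← lintegral_tsum_enorm_mul_nodeFun_rpow hp0 hδ,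
    ← lintegral_enorm_nodeFun_rpow (𝕜 := 𝕜) hp0 hδ' i]
  refine MeasureTheory.lintegral_mono fun t => ?_
  simp only
  simp_rw [enorm_liftCol_mul_nodeFun_rpow hp0 hδ hδ']
  rw [ENNReal.tsum_mul_left, enorm_nodeFun_rpow hp0 hδ']
  have h1 : ∑' j, ENNReal.ofReal (nodeMaxIn δ (nodeSet δ' i) j * nodeInd δ j t)
      ≤ ENNReal.ofReal (nodeInd δ' i t) := by
    refine ENNReal.tsum_le_of_sum_range_le fun N => ?_
    rw [← ENNReal.ofReal_sum_of_nonneg fun j _ => nodeMaxIn_mul_nodeInd_nonneg hδ _ _ _,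
      nodeInd_eq δ']
    exact ENNReal.ofReal_le_ofReal (sum_nodeMaxIn_mul_nodeInd_le hδ _ N t)
  refine (mul_le_mul' le_rfl h1).trans (le_of_eq ?_)
  rw [nodeInd_eq]
  by_cases h : t ∈ nodeSet δ' i <;> simp [h]

/-- The sequence over the tree of `δ` that represents the same function as the sequence `α`
over the tree of `δ'`. -/
noncomputable def liftSeq (p : ℝ) (δ δ' : ℕ → ℕ) (α : ℕ → 𝕜) (j : ℕ) : 𝕜 :=
  ∑' i, α i * liftCol 𝕜 p δ δ' i j

lemma tsum_tsum_liftCol_le (hp0 : 0 < p) (hδ : ∀ n, 2 ≤ δ n) (hδ' : ∀ n, 2 ≤ δ' n) (α : ℕ → 𝕜) :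
    ∑' j, ∑' i, ‖α i * liftCol 𝕜 p δ δ' i j‖ₑ ^ p ≤ pen p α := by
  rw [ENNReal.tsum_comm]
  refine ENNReal.tsum_le_tsum fun i => ?_
  simp_rw [enorm_mul, ENNReal.mul_rpow_of_nonneg _ _ hp0.le]
  rw [ENNReal.tsum_mul_left]
  exact (mul_le_mul' le_rfl (pen_liftCol_le hp0 hδ hδ' i)).trans (mul_one _).le

lemma pen_liftSeq_le (hp0 : 0 < p) (hp1 : p ≤ 1) (hδ : ∀ n, 2 ≤ δ n) (hδ' : ∀ n, 2 ≤ δ' n)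
    (α : ℕ → 𝕜) : pen p (liftSeq p δ δ' α) ≤ pen p α :=
  (ENNReal.tsum_le_tsum fun _ => enorm_tsum_rpow_le hp0 hp1 _).trans
    (tsum_tsum_liftCol_le hp0 hδ hδ' α)

lemma summable_liftSeq (hp0 : 0 < p) (hp1 : p ≤ 1) (hδ : ∀ n, 2 ≤ δ n) (hδ' : ∀ n, 2 ≤ δ' n)
    {α : ℕ → 𝕜} (hα : pen p α ≠ ∞) (j : ℕ) : Summable fun i => α i * liftCol 𝕜 p δ δ' i j :=
  summable_of_tsum_enorm_rpow_ne_top hp0 hp1 <| ne_top_of_le_ne_top hα <|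
    (ENNReal.le_tsum j).trans (tsum_tsum_liftCol_le hp0 hδ hδ' α)

/-- For almost every `t` the double series is absolutely summable and `t` avoids the countably many
left end points. Exchanging the sums then reduces the claim to single nodes. -/
lemma synth_liftSeq (hp0 : 0 < p) (hp1 : p ≤ 1) (hδ : ∀ n, 2 ≤ δ n) (hδ' : ∀ n, 2 ≤ δ' n)
    {α : ℕ → 𝕜} (hα : pen p α ≠ ∞) :
    ∀ᵐ t, synth p δ (liftSeq p δ δ' α) t = synth p δ' α t := by
  have hmeas : ∀ x : ℕ × ℕ, Measurable fun t =>
      ‖α x.2 * liftCol 𝕜 p δ δ' x.2 x.1 * nodeFun 𝕜 p δ x.1 t‖ₑ ^ p := fun x =>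
    measurable_enorm_mul_nodeFun_rpow _ δ _
  have hint : ∫⁻ t, ∑' x : ℕ × ℕ,
      ‖α x.2 * liftCol 𝕜 p δ δ' x.2 x.1 * nodeFun 𝕜 p δ x.1 t‖ₑ ^ p ≠ ∞ := by
    rw [MeasureTheory.lintegral_tsum fun x => (hmeas x).aemeasurable]
    simp_rw [lintegral_enorm_mul_nodeFun_rpow hp0 hδ]
    rw [ENNReal.tsum_prod (f := fun j i => ‖α i * liftCol 𝕜 p δ δ' i j‖ₑ ^ p)]
    exact ne_top_of_le_ne_top hα (tsum_tsum_liftCol_le hp0 hδ hδ' α)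
  have hae := MeasureTheory.ae_lt_top (Measurable.tsum hmeas) hint
  have hne : ∀ᵐ t : ℝ, ∀ i, t ≠ nodeLeft δ' i := by
    rw [MeasureTheory.ae_all_iff]
    intro i
    exact MeasureTheory.Measure.ae_ne _ _
  filter_upwards [hae, hne] with t ht hnt
  have hsum : Summable (Function.uncurry fun j i : ℕ =>
      α i * liftCol 𝕜 p δ δ' i j * nodeFun 𝕜 p δ j t) :=
    summable_of_tsum_enorm_rpow_ne_top hp0 hp1 ht.ne
  calc synth p δ (liftSeq p δ δ' α) t
      = ∑' j, ∑' i, α i * liftCol 𝕜 p δ δ' i j * nodeFun 𝕜 p δ j t :=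
        tsum_congr fun j => by rw [liftSeq, tsum_mul_right]
    _ = ∑' i, ∑' j, α i * liftCol 𝕜 p δ δ' i j * nodeFun 𝕜 p δ j t := hsum.tsum_comm.symm
    _ = ∑' i, α i * nodeFun 𝕜 p δ' i t := by
        refine tsum_congr fun i => ?_
        rw [← synth_liftCol hδ hδ' i (hnt i), synth, ← tsum_mul_left]
        exact tsum_congr fun j => by ring
    _ = synth p δ' α t := rfl

end Lift

/-! ### The spaces `X_p(δ)` are mutually isomorphic -/

section Isomorphism

variable {𝕜 : Type*} [RCLike 𝕜] {p : ℝ} {δ δ' : ℕ → ℕ}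

/-- The operator on `ℓ_p` given by an operator on sequences that is linear and bounded on `ℓ_p`. -/
def EllP.mapOf (hp0 : 0 < p) (L : (ℕ → 𝕜) → (ℕ → 𝕜)) (C : NNReal)
    (hL : ∀ a, pen p (L a) ≤ C * pen p a)
    (hadd : ∀ a b, pen p a ≠ ∞ → pen p b ≠ ∞ → L (a + b) = L a + L b)
    (hsmul : ∀ (c : 𝕜) a, L (c • a) = c • L a) : EllP 𝕜 p →ₗ[𝕜] EllP 𝕜 p where
  toFun f := EllP.mk hp0 (L f) (ne_top_of_le_ne_top
    (ENNReal.mul_ne_top ENNReal.coe_ne_top (EllP.pen_ne_top hp0 f)) (hL f))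
  map_add' f g := lp.ext (by
    change L (f + g : EllP 𝕜 p) = L f + L g
    rw [lp.coeFn_add]
    exact hadd _ _ (EllP.pen_ne_top hp0 f) (EllP.pen_ne_top hp0 g))
  map_smul' c f := lp.ext (by
    change L (c • f : EllP 𝕜 p) = c • L f
    rw [lp.coeFn_smul]
    exact hsmul _ _)

/-- The operator on `ℓ_p` given by `liftSeq`. -/
noncomputable def liftOp (𝕜 : Type*) [RCLike 𝕜] (hp0 : 0 < p) (hp1 : p ≤ 1) (hδ : ∀ n, 2 ≤ δ n)
    (hδ' : ∀ n, 2 ≤ δ' n) : EllP 𝕜 p →ₗ[𝕜] EllP 𝕜 p :=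
  EllP.mapOf hp0 (liftSeq p δ δ') 1
    (fun a => by rw [ENNReal.coe_one, one_mul]; exact pen_liftSeq_le hp0 hp1 hδ hδ' a)
    (fun a b ha hb => by
      funext j
      simp only [liftSeq, Pi.add_apply, add_mul]
      exact (summable_liftSeq hp0 hp1 hδ hδ' ha j).tsum_add (summable_liftSeq hp0 hp1 hδ hδ' hb j))
    (fun c a => by
      funext j
      simp only [liftSeq, Pi.smul_apply, smul_eq_mul, mul_assoc]
      exact tsum_mul_left)

lemma pen_liftOp_le (hp0 : 0 < p) (hp1 : p ≤ 1) (hδ : ∀ n, 2 ≤ δ n) (hδ' : ∀ n, 2 ≤ δ' n)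
    (f : EllP 𝕜 p) : pen p (liftOp 𝕜 hp0 hp1 hδ hδ' f : ℕ → 𝕜) ≤ pen p (f : ℕ → 𝕜) :=
  pen_liftSeq_le hp0 hp1 hδ hδ' _

lemma synth_liftOp (hp0 : 0 < p) (hp1 : p ≤ 1) (hδ : ∀ n, 2 ≤ δ n) (hδ' : ∀ n, 2 ≤ δ' n)
    (f : EllP 𝕜 p) : ∀ᵐ t, synth p δ (liftOp 𝕜 hp0 hp1 hδ hδ' f : ℕ → 𝕜) t = synth p δ' f t :=
  synth_liftSeq hp0 hp1 hδ hδ' (EllP.pen_ne_top hp0 f)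

/-- An isomorphism of `ℓ_p` with `ℓ_p ⊕ ℓ_p` that restricts to an isomorphism of `X_p(δ)` with
`X_p(δ) ⊕ ℓ_p`. -/
structure Absorption (𝕜 : Type*) [RCLike 𝕜] (p : ℝ) (δ : ℕ → ℕ) where
  fst : EllP 𝕜 p →ₗ[𝕜] EllP 𝕜 p
  snd : EllP 𝕜 p →ₗ[𝕜] EllP 𝕜 p
  inl : EllP 𝕜 p →ₗ[𝕜] EllP 𝕜 p
  inr : EllP 𝕜 p →ₗ[𝕜] EllP 𝕜 p
  const : NNReal
  pen_fst : ∀ f, pen p (fst f : ℕ → 𝕜) ≤ const * pen p (f : ℕ → 𝕜)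
  pen_snd : ∀ f, pen p (snd f : ℕ → 𝕜) ≤ const * pen p (f : ℕ → 𝕜)
  pen_inl : ∀ f, pen p (inl f : ℕ → 𝕜) ≤ const * pen p (f : ℕ → 𝕜)
  pen_inr : ∀ f, pen p (inr f : ℕ → 𝕜) ≤ const * pen p (f : ℕ → 𝕜)
  fst_inl : ∀ f, fst (inl f) = f
  snd_inr : ∀ f, snd (inr f) = f
  fst_inr : ∀ f, fst (inr f) = 0
  snd_inl : ∀ f, snd (inl f) = 0
  inl_fst_add : ∀ f, inl (fst f) + inr (snd f) = f
  synth_fst : ∀ f, ∀ᵐ t, synth p δ (fst f : ℕ → 𝕜) t = synth p δ f t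
  synth_inl : ∀ f, ∀ᵐ t, synth p δ (inl f : ℕ → 𝕜) t = synth p δ f t
  synth_inr : ∀ f, ∀ᵐ t, synth p δ (inr f : ℕ → 𝕜) t = 0

/-- A sequence of nodes none of which is the parent of another one. -/
def sparseNode (δ : ℕ → ℕ) : ℕ → ℕ
  | 0 => 1
  | i + 1 => blockStart δ (sparseNode δ i + 1)

lemma sparseNode_strictMono (hδ : ∀ n, 2 ≤ δ n) : StrictMono (sparseNode δ) :=
  strictMono_nat_of_lt_succ fun i => by
    have := lt_blockStart hδ (sparseNode δ i + 1)
    rw [sparseNode]; omega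

/-- Each node after the first is the first child of the successor of the previous one, so its parent
lies strictly between two consecutive members of the sequence. -/
lemma deltaParent_sparseNode_ne (hδ : ∀ n, 2 ≤ δ n) (i j : ℕ) :
    deltaParent δ (sparseNode δ i) ≠ sparseNode δ j := by
  have hm := sparseNode_strictMono hδ
  cases i with
  | zero =>
    have h1 : deltaParent δ (sparseNode δ 0) < 1 := deltaParent_lt hδ one_ne_zero
    have h2 : 1 ≤ sparseNode δ j := hm.monotone (Nat.zero_le j)
    omega
  | succ i =>
    have h1 : deltaParent δ (sparseNode δ (i + 1)) = sparseNode δ i + 1 :=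
      (deltaParent_of_mem hδ (Finset.mem_Ico.2 ⟨le_rfl, blockStart_strictMono hδ
        (Nat.lt_succ_self _)⟩)).2
    rw [h1]
    intro h
    have h2 : i < j := hm.lt_iff_lt.1 (by omega)
    have h3 : sparseNode δ (i + 1) ≤ sparseNode δ j := hm.monotone h2
    have h4 := lt_blockStart hδ (sparseNode δ i + 1)
    rw [sparseNode] at h3
    omega

lemma pen_comp_le (a : ℕ → 𝕜) {v : ℕ → ℕ} (hv : Function.Injective v) :
    pen p (a ∘ v) ≤ pen p a :=
  ENNReal.tsum_comp_le_tsum_of_injective hv fun j => ‖a j‖ₑ ^ p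

lemma pen_extend (hp0 : 0 < p) (b : ℕ → 𝕜) {v : ℕ → ℕ} (hv : Function.Injective v) :
    pen p (Function.extend v b 0) = pen p b := by
  unfold pen
  rw [← hv.tsum_eq (f := fun j => ‖Function.extend v b 0 j‖ₑ ^ p)]
  · exact tsum_congr fun i => by rw [hv.extend_apply]
  · intro j hj
    by_contra h
    refine hj ?_
    simp [Function.extend_apply' _ _ _ h, hp0]

lemma isNull_diff (hp0 : 0 < p) (hp1 : p ≤ 1) (hδ : ∀ n, 2 ≤ δ n) {c : ℕ → 𝕜}
    (hc : pen p c ≠ ∞) : IsNull p δ ((deltaForest δ hδ).diff 𝕜 p c) := by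
  have hfin : ∀ a : ℕ → 𝕜, pen p a ≠ ∞ → pen p ((deltaForest δ hδ).diff 𝕜 p a) ≠ ∞ :=
    fun a ha => ne_top_of_le_ne_top (ENNReal.mul_ne_top (by norm_num) ha)
      (MassForest.pen_diff_le _ hp0 hp1 a)
  refine isNull_of_approx hp0 hp1 hδ (hfin c hc) fun ε hε => ?_
  have h := (tendsto_pen_sub_restr hp0 hc).eventually
    (gt_mem_nhds (ENNReal.div_pos hε (by norm_num : (2 : ℝ≥0∞) ≠ ∞)))
  obtain ⟨A, hA⟩ := h.exists
  refine ⟨(deltaForest δ hδ).diff 𝕜 p (restr A c), hfin _ (pen_restr_ne_top hp0 A c), ?_, ?_⟩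
  · rw [restr_eq_sum]
    clear hA
    induction A using Finset.induction_on with
    | empty => exact Eventually.of_forall fun t => by simp [synth]
    | insert k A hk ih =>
      rw [Finset.sum_insert hk, map_add, map_smul]
      refine IsNull.add hp0 hp1 hδ ?_ ?_ (IsNull.smul _ (isNull_diff_single hp0 hδ k)) ih
      · rw [pen_smul hp0]
        exact ENNReal.mul_ne_top (enorm_rpow_ne_top hp0 _)
          (MassForest.pen_diff_single_ne_top _ hp0 hp1 k)
      · rw [← restr_eq_sum]
        exact hfin _ (pen_restr_ne_top hp0 A c)
  · rw [← map_sub]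
    calc _ ≤ 2 * pen p (c - restr A c) := MassForest.pen_diff_le _ hp0 hp1 _
      _ ≤ 2 * (ε / 2) := by gcongr
      _ = ε := ENNReal.mul_div_cancel (by norm_num) (by norm_num)

/-- The combination of the vectors of the sparse nodes with given coefficients. -/
noncomputable def sparseSum (𝕜 : Type*) [RCLike 𝕜] (p : ℝ) (hδ : ∀ n, 2 ≤ δ n) :
    (ℕ → 𝕜) →ₗ[𝕜] (ℕ → 𝕜) :=
  (deltaForest δ hδ).diff 𝕜 p ∘ₗ Function.ExtendByZero.linearMap 𝕜 (sparseNode δ)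

/-- Sparse nodes do not interact, so the coefficients reappear as coordinates. Hence the vectors at
the sparse nodes span a complemented copy of `ℓ_p` inside `X_p(δ)`, with projection `a ↦ sparseSum
(a ∘ sparseNode)`. -/
lemma sparseSum_comp (hδ : ∀ n, 2 ≤ δ n) (b : ℕ → 𝕜) :
    sparseSum 𝕜 p hδ b ∘ sparseNode δ = b := by
  funext i
  have hinj := (sparseNode_strictMono hδ).injective
  change (deltaForest δ hδ).diff 𝕜 p (Function.extend (sparseNode δ) b 0) (sparseNode δ i) = b i
  rw [MassForest.diff_apply, hinj.extend_apply, deltaForest_parent, Function.extend_apply' _ _ _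
    (by rintro ⟨j, hj⟩; exact deltaParent_sparseNode_ne hδ i j hj.symm)]
  simp

lemma pen_sparseSum_le (hp0 : 0 < p) (hp1 : p ≤ 1) (hδ : ∀ n, 2 ≤ δ n) (b : ℕ → 𝕜) :
    pen p (sparseSum 𝕜 p hδ b) ≤ 2 * pen p b := by
  refine (MassForest.pen_diff_le _ hp0 hp1 _).trans (le_of_eq ?_)
  congr 1
  exact pen_extend hp0 b (sparseNode_strictMono hδ).injective

lemma isNull_sparseSum (hp0 : 0 < p) (hp1 : p ≤ 1) (hδ : ∀ n, 2 ≤ δ n) {b : ℕ → 𝕜}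
    (hb : pen p b ≠ ∞) : IsNull p δ (sparseSum 𝕜 p hδ b) := by
  refine isNull_diff hp0 hp1 hδ ?_
  change pen p (Function.extend (sparseNode δ) b 0) ≠ ∞
  rwa [pen_extend hp0 b (sparseNode_strictMono hδ).injective]

/-- Changing the coefficients at the sparse nodes by means of an operator `E`. -/
noncomputable def sparseChange (hδ : ∀ n, 2 ≤ δ n) (E : (ℕ → 𝕜) →ₗ[𝕜] (ℕ → 𝕜)) (p : ℝ) :
    (ℕ → 𝕜) →ₗ[𝕜] (ℕ → 𝕜) :=
  LinearMap.id + sparseSum 𝕜 p hδ ∘ₗ (E - LinearMap.id) ∘ₗ LinearMap.funLeft 𝕜 𝕜 (sparseNode δ)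

lemma sparseChange_apply (hδ : ∀ n, 2 ≤ δ n) (E : (ℕ → 𝕜) →ₗ[𝕜] (ℕ → 𝕜)) (a : ℕ → 𝕜) :
    sparseChange hδ E p a
      = a + sparseSum 𝕜 p hδ (E (a ∘ sparseNode δ) - a ∘ sparseNode δ) := rfl

lemma sparseChange_comp (hδ : ∀ n, 2 ≤ δ n) (E : (ℕ → 𝕜) →ₗ[𝕜] (ℕ → 𝕜)) (a : ℕ → 𝕜) :
    sparseChange hδ E p a ∘ sparseNode δ = E (a ∘ sparseNode δ) := by
  have h := sparseSum_comp (p := p) hδ (E (a ∘ sparseNode δ) - a ∘ sparseNode δ)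
  rw [sparseChange_apply]
  funext i
  have := congrFun h i
  simp only [Function.comp, Pi.add_apply, Pi.sub_apply] at this ⊢
  rw [this]; ring

lemma pen_sparse_le (hp0 : 0 < p) (hp1 : p ≤ 1) (hδ : ∀ n, 2 ≤ δ n)
    {E : (ℕ → 𝕜) →ₗ[𝕜] (ℕ → 𝕜)} (hE : ∀ b, pen p (E b) ≤ pen p b) (a : ℕ → 𝕜) :
    pen p (E (a ∘ sparseNode δ) - a ∘ sparseNode δ) ≤ 2 * pen p a := by
  have h := pen_comp_le (p := p) a (sparseNode_strictMono hδ).injective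
  calc _ ≤ pen p (a ∘ sparseNode δ) + pen p (a ∘ sparseNode δ) :=
        (pen_sub_le hp0 hp1 _ _).trans (add_le_add (hE _) le_rfl)
    _ ≤ pen p a + pen p a := add_le_add h h
    _ = _ := (two_mul _).symm

lemma pen_sparseChange_le (hp0 : 0 < p) (hp1 : p ≤ 1) (hδ : ∀ n, 2 ≤ δ n)
    {E : (ℕ → 𝕜) →ₗ[𝕜] (ℕ → 𝕜)} (hE : ∀ b, pen p (E b) ≤ pen p b) (a : ℕ → 𝕜) :
    pen p (sparseChange hδ E p a) ≤ (5 : NNReal) * pen p a := by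
  rw [sparseChange_apply]
  calc _ ≤ _ := pen_add_le hp0 hp1 _ _
    _ ≤ pen p a + 2 * (2 * pen p a) := by
      gcongr
      exact (pen_sparseSum_le hp0 hp1 hδ _).trans (by gcongr; exact pen_sparse_le hp0 hp1 hδ hE a)
    _ = _ := by rw [ENNReal.coe_ofNat]; ring

lemma synth_sparseChange (hp0 : 0 < p) (hp1 : p ≤ 1) (hδ : ∀ n, 2 ≤ δ n)
    {E : (ℕ → 𝕜) →ₗ[𝕜] (ℕ → 𝕜)} (hE : ∀ b, pen p (E b) ≤ pen p b) {a : ℕ → 𝕜}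
    (ha : pen p a ≠ ∞) : ∀ᵐ t, synth p δ (sparseChange hδ E p a) t = synth p δ a t := by
  have h1 : pen p (E (a ∘ sparseNode δ) - a ∘ sparseNode δ) ≠ ∞ :=
    ne_top_of_le_ne_top (ENNReal.mul_ne_top (by norm_num) ha) (pen_sparse_le hp0 hp1 hδ hE a)
  have h2 : pen p (sparseSum 𝕜 p hδ (E (a ∘ sparseNode δ) - a ∘ sparseNode δ)) ≠ ∞ :=
    ne_top_of_le_ne_top (ENNReal.mul_ne_top (by norm_num) h1) (pen_sparseSum_le hp0 hp1 hδ _)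
  filter_upwards [synth_add hp0 hp1 hδ ha h2, isNull_sparseSum hp0 hp1 hδ h1] with t ht1 ht2
  rw [sparseChange_apply, ht1, ht2, add_zero]

/-- Every `X_p(δ)` absorbs `ℓ_p`. -/
noncomputable def absorption (𝕜 : Type*) [RCLike 𝕜] (hp0 : 0 < p) (hp1 : p ≤ 1)
    (hδ : ∀ n, 2 ≤ δ n) : Absorption 𝕜 p δ :=
  -- The complemented copy of `ℓ_p` is split into its even and odd coordinates: the even half is
  -- reindexed to fill the copy again and the odd half is split off as the new summand.
  let ev : ℕ → ℕ := fun i => 2 * i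
  let od : ℕ → ℕ := fun i => 2 * i + 1
  have hev : Function.Injective ev := fun i j h => by simp only [ev] at h; omega
  have hod : Function.Injective od := fun i j h => by simp only [od] at h; omega
  let Ev : (ℕ → 𝕜) →ₗ[𝕜] (ℕ → 𝕜) := LinearMap.funLeft 𝕜 𝕜 ev
  let Od : (ℕ → 𝕜) →ₗ[𝕜] (ℕ → 𝕜) := LinearMap.funLeft 𝕜 𝕜 od
  let Ev' : (ℕ → 𝕜) →ₗ[𝕜] (ℕ → 𝕜) := Function.ExtendByZero.linearMap 𝕜 ev
  let Od' : (ℕ → 𝕜) →ₗ[𝕜] (ℕ → 𝕜) := Function.ExtendByZero.linearMap 𝕜 od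
  have hEv : ∀ b, pen p (Ev b) ≤ pen p b := fun b => pen_comp_le b hev
  have hOd : ∀ b, pen p (Od b) ≤ pen p b := fun b => pen_comp_le b hod
  have hEv' : ∀ b, pen p (Ev' b) ≤ pen p b := fun b => (pen_extend hp0 b hev).le
  have hOd' : ∀ b, pen p (Od' b) ≤ pen p b := fun b => (pen_extend hp0 b hod).le
  have e1 : ∀ b, Ev (Ev' b) = b := fun b => funext fun i => hev.extend_apply b 0 i
  have e2 : ∀ b, Od (Od' b) = b := fun b => funext fun i => hod.extend_apply b 0 i
  have e3 : ∀ b, Ev (Od' b) = 0 := fun b => funext fun i => Function.extend_apply' _ _ _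
    (by rintro ⟨j, hj⟩; simp only [od, ev] at hj; omega)
  have e4 : ∀ b, Od (Ev' b) = 0 := fun b => funext fun i => Function.extend_apply' _ _ _
    (by rintro ⟨j, hj⟩; simp only [od, ev] at hj; omega)
  have e5 : ∀ b, Ev' (Ev b) + Od' (Od b) = b := fun b => funext fun i => by
    change Function.extend ev (b ∘ ev) 0 i + Function.extend od (b ∘ od) 0 i = b i
    rcases Nat.even_or_odd' i with ⟨k, rfl | rfl⟩
    · rw [show 2 * k = ev k from rfl, hev.extend_apply, Function.extend_apply' _ _ _
        (by rintro ⟨j, hj⟩; simp only [od, ev] at hj; omega)]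
      simp
    · rw [show 2 * k + 1 = od k from rfl, hod.extend_apply, Function.extend_apply' _ _ _
        (by rintro ⟨j, hj⟩; simp only [od, ev] at hj; omega)]
      simp
  have hc : ∀ E : (ℕ → 𝕜) →ₗ[𝕜] (ℕ → 𝕜), (∀ b, pen p (E b) ≤ pen p b) →
      ∀ a, pen p (sparseChange hδ E p a) ≤ (5 : NNReal) * pen p a :=
    fun E hE a => pen_sparseChange_le hp0 hp1 hδ hE a
  have hone : (1 : ℝ≥0∞) ≤ (5 : NNReal) := by norm_num
  have htwo : (2 : ℝ≥0∞) ≤ (5 : NNReal) := by norm_num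
  have hZ : ∀ a, pen p (Od (a ∘ sparseNode δ)) ≤ (5 : NNReal) * pen p a := fun a =>
    ((hOd _).trans (pen_comp_le a (sparseNode_strictMono hδ).injective)).trans
      (le_mul_of_one_le_left' hone)
  have hX : ∀ b, pen p (sparseSum 𝕜 p hδ (Od' b)) ≤ (5 : NNReal) * pen p b := fun b =>
    (pen_sparseSum_le hp0 hp1 hδ _).trans (mul_le_mul' htwo (hOd' b))
  { fst := EllP.mapOf hp0 (sparseChange hδ Ev p) 5 (hc Ev hEv)
      (fun _ _ _ _ => map_add _ _ _) (fun _ _ => map_smul _ _ _)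
    snd := EllP.mapOf hp0 (fun a => Od (a ∘ sparseNode δ)) 5 hZ
      (fun _ _ _ _ => rfl) (fun _ _ => rfl)
    inl := EllP.mapOf hp0 (sparseChange hδ Ev' p) 5 (hc Ev' hEv')
      (fun _ _ _ _ => map_add _ _ _) (fun _ _ => map_smul _ _ _)
    inr := EllP.mapOf hp0 (fun b => sparseSum 𝕜 p hδ (Od' b)) 5 hX
      (fun _ _ _ _ => by rw [map_add, map_add]) (fun _ _ => by rw [map_smul, map_smul])
    const := 5
    pen_fst := fun f => hc Ev hEv f
    pen_snd := fun f => hZ f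
    pen_inl := fun f => hc Ev' hEv' f
    pen_inr := fun f => hX f
    fst_inl := fun f => lp.ext (by
      change sparseChange hδ Ev p (sparseChange hδ Ev' p f) = f
      rw [sparseChange_apply, sparseChange_comp, e1, sparseChange_apply, add_assoc, ← map_add]
      simp)
    snd_inr := fun f => lp.ext (by
      change Od (sparseSum 𝕜 p hδ (Od' f) ∘ sparseNode δ) = f
      rw [sparseSum_comp, e2])
    fst_inr := fun f => lp.ext (by
      change sparseChange hδ Ev p (sparseSum 𝕜 p hδ (Od' f)) = 0
      rw [sparseChange_apply, sparseSum_comp, e3, ← map_add]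
      simp)
    snd_inl := fun f => lp.ext (by
      change Od (sparseChange hδ Ev' p f ∘ sparseNode δ) = 0
      rw [sparseChange_comp, e4])
    inl_fst_add := fun f => lp.ext (by
      change sparseChange hδ Ev' p (sparseChange hδ Ev p f)
        + sparseSum 𝕜 p hδ (Od' (Od (f ∘ sparseNode δ))) = f
      rw [sparseChange_apply, sparseChange_comp, sparseChange_apply, add_assoc, add_assoc,
        ← map_add, ← map_add]
      have : Ev (f ∘ sparseNode δ) - f ∘ sparseNode δ + (Ev' (Ev (f ∘ sparseNode δ))
          - Ev (f ∘ sparseNode δ) + Od' (Od (f ∘ sparseNode δ))) = 0 := by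
        have h := e5 (f ∘ sparseNode δ)
        calc _ = (Ev' (Ev (f ∘ sparseNode δ)) + Od' (Od (f ∘ sparseNode δ)))
              - f ∘ sparseNode δ := by abel
          _ = 0 := by rw [h, sub_self]
      rw [this, map_zero, add_zero])
    synth_fst := fun f => synth_sparseChange hp0 hp1 hδ hEv (EllP.pen_ne_top hp0 f)
    synth_inl := fun f => synth_sparseChange hp0 hp1 hδ hEv' (EllP.pen_ne_top hp0 f)
    synth_inr := fun f => isNull_sparseSum hp0 hp1 hδ
      (ne_top_of_le_ne_top (EllP.pen_ne_top hp0 f) (hOd' f)) }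

/-! ### The pull-back of two synthesis maps and the resulting isomorphism. -/

section Transfer

variable (hp0 : 0 < p) (hp1 : p ≤ 1) (hδ : ∀ n, 2 ≤ δ n) (hδ' : ∀ n, 2 ≤ δ' n)

/-- The `ℓ_p` component over the tree of `δ` of the pull-back of the two trees. -/
noncomputable def pullback (𝕜 : Type*) [RCLike 𝕜] : EllP 𝕜 p →ₗ[𝕜] EllP 𝕜 p :=
  (absorption 𝕜 hp0 hp1 hδ).fst + liftOp 𝕜 hp0 hp1 hδ hδ' ∘ₗ (absorption 𝕜 hp0 hp1 hδ).snd

/-- An automorphism of `ℓ_p` that maps `X_p(δ)` onto `X_p(δ')`. -/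
noncomputable def transfer (𝕜 : Type*) [RCLike 𝕜] : EllP 𝕜 p →ₗ[𝕜] EllP 𝕜 p :=
  (absorption 𝕜 hp0 hp1 hδ').inl ∘ₗ ((absorption 𝕜 hp0 hp1 hδ).snd
    - liftOp 𝕜 hp0 hp1 hδ' hδ ∘ₗ pullback hp0 hp1 hδ hδ' 𝕜)
  + (absorption 𝕜 hp0 hp1 hδ').inr ∘ₗ pullback hp0 hp1 hδ hδ' 𝕜

lemma transfer_apply (f : EllP 𝕜 p) : transfer hp0 hp1 hδ hδ' 𝕜 f
    = (absorption 𝕜 hp0 hp1 hδ').inl ((absorption 𝕜 hp0 hp1 hδ).snd f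
      - liftOp 𝕜 hp0 hp1 hδ' hδ (pullback hp0 hp1 hδ hδ' 𝕜 f))
    + (absorption 𝕜 hp0 hp1 hδ').inr (pullback hp0 hp1 hδ hδ' 𝕜 f) := rfl

lemma pullback_apply (f : EllP 𝕜 p) : pullback hp0 hp1 hδ hδ' 𝕜 f
    = (absorption 𝕜 hp0 hp1 hδ).fst f
      + liftOp 𝕜 hp0 hp1 hδ hδ' ((absorption 𝕜 hp0 hp1 hδ).snd f) := rfl

lemma snd_transfer (f : EllP 𝕜 p) : (absorption 𝕜 hp0 hp1 hδ').snd (transfer hp0 hp1 hδ hδ' 𝕜 f)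
    = pullback hp0 hp1 hδ hδ' 𝕜 f := by
  rw [transfer_apply, map_add, Absorption.snd_inl, Absorption.snd_inr, zero_add]

lemma pullback_transfer (f : EllP 𝕜 p) :
    pullback hp0 hp1 hδ' hδ 𝕜 (transfer hp0 hp1 hδ hδ' 𝕜 f) = (absorption 𝕜 hp0 hp1 hδ).snd f := by
  rw [pullback_apply, snd_transfer, transfer_apply, map_add, Absorption.fst_inl,
    Absorption.fst_inr, add_zero, sub_add_cancel]

/-- A pair consists of the pull-back component over `δ` and the summand split off, which plays the
component over `δ'`. `transfer` reads the same pair with the roles exchanged, so a second exchange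
restores it. -/
lemma transfer_transfer (f : EllP 𝕜 p) :
    transfer hp0 hp1 hδ' hδ 𝕜 (transfer hp0 hp1 hδ hδ' 𝕜 f) = f := by
  rw [transfer_apply hp0 hp1 hδ' hδ, pullback_transfer, snd_transfer, pullback_apply,
    add_sub_cancel_right, Absorption.inl_fst_add]

lemma EllP.pen_add_le (hp0 : 0 < p) (hp1 : p ≤ 1) (f g : EllP 𝕜 p) :
    pen p ((f + g : EllP 𝕜 p) : ℕ → 𝕜) ≤ pen p (f : ℕ → 𝕜) + pen p (g : ℕ → 𝕜) := by
  rw [lp.coeFn_add]; exact _root_.pen_add_le hp0 hp1 _ _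

lemma EllP.pen_sub_le (hp0 : 0 < p) (hp1 : p ≤ 1) (f g : EllP 𝕜 p) :
    pen p ((f - g : EllP 𝕜 p) : ℕ → 𝕜) ≤ pen p (f : ℕ → 𝕜) + pen p (g : ℕ → 𝕜) := by
  rw [lp.coeFn_sub]; exact _root_.pen_sub_le hp0 hp1 _ _

lemma pen_transfer_le (f : EllP 𝕜 p) :
    pen p (transfer hp0 hp1 hδ hδ' 𝕜 f : ℕ → 𝕜) ≤ (125 : NNReal) * pen p (f : ℕ → 𝕜) := by
  set P := pen p (f : ℕ → 𝕜) with hP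
  have h5 : ((5 : NNReal) : ℝ≥0∞) = 5 := ENNReal.coe_ofNat 5
  have hfst : pen p ((absorption 𝕜 hp0 hp1 hδ).fst f : ℕ → 𝕜) ≤ (5 : NNReal) * P :=
    (absorption 𝕜 hp0 hp1 hδ).pen_fst f
  have hsnd : pen p ((absorption 𝕜 hp0 hp1 hδ).snd f : ℕ → 𝕜) ≤ (5 : NNReal) * P :=
    (absorption 𝕜 hp0 hp1 hδ).pen_snd f
  have hinl : ∀ g, pen p ((absorption 𝕜 hp0 hp1 hδ').inl g : ℕ → 𝕜)
      ≤ (5 : NNReal) * pen p (g : ℕ → 𝕜) := (absorption 𝕜 hp0 hp1 hδ').pen_inl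
  have hinr : ∀ g, pen p ((absorption 𝕜 hp0 hp1 hδ').inr g : ℕ → 𝕜)
      ≤ (5 : NNReal) * pen p (g : ℕ → 𝕜) := (absorption 𝕜 hp0 hp1 hδ').pen_inr
  have h1 : pen p (pullback hp0 hp1 hδ hδ' 𝕜 f : ℕ → 𝕜) ≤ 10 * P := by
    rw [pullback_apply]
    refine (EllP.pen_add_le hp0 hp1 _ _).trans ((add_le_add hfst
      ((pen_liftOp_le hp0 hp1 hδ hδ' _).trans hsnd)).trans (le_of_eq ?_))
    rw [h5]; ring
  have h2 : pen p (((absorption 𝕜 hp0 hp1 hδ).snd f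
      - liftOp 𝕜 hp0 hp1 hδ' hδ (pullback hp0 hp1 hδ hδ' 𝕜 f) : EllP 𝕜 p) : ℕ → 𝕜) ≤ 15 * P := by
    refine (EllP.pen_sub_le hp0 hp1 _ _).trans ((add_le_add hsnd
      ((pen_liftOp_le hp0 hp1 hδ' hδ _).trans h1)).trans (le_of_eq ?_))
    rw [h5]; ring
  rw [transfer_apply]
  refine (EllP.pen_add_le hp0 hp1 _ _).trans ((add_le_add
    ((hinl _).trans (mul_le_mul' le_rfl h2)) ((hinr _).trans (mul_le_mul' le_rfl h1))).trans
    (le_of_eq ?_))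
  -- The constant is `5 * 15 + 5 * 10 = 125`.
  rw [h5, ENNReal.coe_ofNat]; ring

/-- With `b` and `α` as below, `α` represents the function of `f` plus that of `b`, while `b -
liftOp α` represents that of `b` minus that of `α`. Hence `transfer` turns the represented function
into its negative, and null stays null. -/
lemma isNull_transfer {f : EllP 𝕜 p} (hf : IsNull p δ (f : ℕ → 𝕜)) :
    IsNull p δ' (transfer hp0 hp1 hδ hδ' 𝕜 f : ℕ → 𝕜) := by
  set b := (absorption 𝕜 hp0 hp1 hδ).snd f with hb
  set α := pullback hp0 hp1 hδ hδ' 𝕜 f with hα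
  set k := b - liftOp 𝕜 hp0 hp1 hδ' hδ α with hk
  set A' := absorption 𝕜 hp0 hp1 hδ' with hA'
  have e1 := synth_add hp0 hp1 hδ' (EllP.pen_ne_top hp0 (A'.inl k)) (EllP.pen_ne_top hp0 (A'.inr α))
  have e2 := synth_sub hp0 hp1 hδ' (EllP.pen_ne_top hp0 b)
    (EllP.pen_ne_top hp0 (liftOp 𝕜 hp0 hp1 hδ' hδ α))
  have e3 := synth_add hp0 hp1 hδ (EllP.pen_ne_top hp0 ((absorption 𝕜 hp0 hp1 hδ).fst f))
    (EllP.pen_ne_top hp0 (liftOp 𝕜 hp0 hp1 hδ hδ' b))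
  have e4 := synth_liftOp hp0 hp1 hδ' hδ α
  have e5 := synth_liftOp hp0 hp1 hδ hδ' b
  filter_upwards [hf, e1, e2, e3, e4, e5, A'.synth_inl k, A'.synth_inr α,
    (absorption 𝕜 hp0 hp1 hδ).synth_fst f] with t h0 h1 h2 h3 h4 h5 h6 h7 h8
  rw [transfer_apply, lp.coeFn_add, h1, h7, h6, hk, lp.coeFn_sub, h2, h4, hα, pullback_apply,
    lp.coeFn_add, h3, h5, h8, h0]
  simp

lemma transfer_mem {f : EllP 𝕜 p} (hf : f ∈ LindSpace 𝕜 p δ) :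
    transfer hp0 hp1 hδ hδ' 𝕜 f ∈ LindSpace 𝕜 p δ' :=
  (mem_lindSpace_iff hp0 hp1 hδ' _).2
    (isNull_transfer hp0 hp1 hδ hδ' ((mem_lindSpace_iff hp0 hp1 hδ _).1 hf))

lemma lindVec_mem (δ : ℕ → ℕ) (k : ℕ) : lindVec 𝕜 p δ k ∈ LindSpace 𝕜 p δ :=
  Submodule.mem_sInf.2 fun _ hV => hV.1 ⟨k, rfl⟩

/-- Every `X_p(δ)` is isomorphic to the closed span of the vectors of any other tree `δ'`. -/
noncomputable def lindModel (𝕜 : Type*) [RCLike 𝕜] :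
    ForestModel (deltaForest δ' hδ') 𝕜 p (LindSpace 𝕜 p δ) where
  toSeq :=
    { toFun := fun f => (transfer hp0 hp1 hδ hδ' 𝕜 f : ℕ → 𝕜)
      map_add' := fun f g => by
        rw [Submodule.coe_add, map_add]; exact lp.coeFn_add _ _
      map_smul' := fun c f => by
        rw [Submodule.coe_smul, map_smul]; exact lp.coeFn_smul _ _ }
  const := 125
  one_le_const := by norm_num
  norm_nonneg f := lp.norm_nonneg' (f : EllP 𝕜 p)
  pen_le f := by
    change _ ≤ _ * ENNReal.ofReal (‖(f : EllP 𝕜 p)‖ ^ p)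
    rw [EllP.ofReal_norm_rpow hp0]
    exact pen_transfer_le hp0 hp1 hδ hδ' _
  le_pen f := by
    change ENNReal.ofReal (‖(f : EllP 𝕜 p)‖ ^ p) ≤ _
    rw [EllP.ofReal_norm_rpow hp0]
    have h := pen_transfer_le hp0 hp1 hδ' hδ (transfer hp0 hp1 hδ hδ' 𝕜 (f : EllP 𝕜 p))
    rw [transfer_transfer] at h
    exact h
  eq_zero f hf := by
    have h1 : transfer hp0 hp1 hδ hδ' 𝕜 (f : EllP 𝕜 p) = 0 := lp.ext hf
    have h2 := transfer_transfer hp0 hp1 hδ hδ' (f : EllP 𝕜 p)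
    rw [h1, map_zero] at h2
    exact Subtype.ext h2.symm
  vec k := ⟨transfer hp0 hp1 hδ' hδ 𝕜 (lindVec 𝕜 p δ' k),
    transfer_mem hp0 hp1 hδ' hδ (lindVec_mem δ' k)⟩
  toSeq_vec k := by
    change ((transfer hp0 hp1 hδ hδ' 𝕜 (transfer hp0 hp1 hδ' hδ 𝕜 (lindVec 𝕜 p δ' k)) :
      EllP 𝕜 p) : ℕ → 𝕜) = _
    rw [transfer_transfer, lindVec_apply hp0 hδ']
  dense f ε hε := by
    set g := transfer hp0 hp1 hδ hδ' 𝕜 (f : EllP 𝕜 p) with hg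
    have hnull : IsNull p δ' (g : ℕ → 𝕜) :=
      isNull_transfer hp0 hp1 hδ hδ' ((mem_lindSpace_iff hp0 hp1 hδ _).1 f.2)
    set a := (deltaForest δ' hδ').solFun 𝕜 p g with ha
    have hd : (deltaForest δ' hδ').diff 𝕜 p a = g := MassForest.diff_solFun _ hp0 _
    have ht := tendsto_pen_diff_sub_restr hp0 hp1 hδ' (a := a)
      (by rw [hd]; exact EllP.pen_ne_top hp0 g) (by rw [hd]; exact hnull)
    obtain ⟨N, hN⟩ := (ht.eventually (gt_mem_nhds (pos_iff_ne_zero.2 hε))).exists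
    refine ⟨Finset.range N, a, ?_⟩
    rw [map_sub, hd] at hN
    exact hN.le

end Transfer

/-- The second part of the theorem. -/
theorem lindSpace_exists_basis (hp0 : 0 < p) (hp1 : p ≤ 1) {φ : ℝ → ℝ} (hφ0 : φ 0 = 0)
    (hmono : MonotoneOn φ (Set.Ici 0)) (hconc : ConcaveOn ℝ (Set.Ici 0) φ)
    (hne : ∃ x, 0 ≤ x ∧ φ x ≠ 0) (hunb : ¬ BddAbove (φ '' Set.Ici 0)) (hδ : ∀ n, 2 ≤ δ n) :
    ∃ B : QBasis 𝕜 (LindSpace 𝕜 p δ), B.IsSchauder ∧ B.IsAlmostGreedy ∧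
      B.CondConstEquiv (fun m : ℕ => φ (Real.log m) ^ (1 / p)) := by
  have hpos := ConcaveOn.pos_of_ne_zero hφ0 hmono hconc hne one_pos
  set n := growthLevel φ with hn
  have hn0 : n 0 = 0 := growthLevel_zero hφ0
  have hnm : StrictMono n := growthLevel_strictMono hφ0 hmono hconc hpos hunb
  -- The tree with prescribed levels is itself the tree of a sequence `levelDelta`, so no truncation
  -- is needed once `X_p(δ)` is identified with the span of its vectors.
  have M := lindModel hp0 hp1 hδ (two_le_levelDelta hnm) 𝕜
  have hψ : ∀ m : ℕ, 0 ≤ φ (Real.log m) := fun m => by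
    rw [← hφ0]
    exact hmono (Set.mem_Ici.2 le_rfl) (Set.mem_Ici.2 (Real.log_natCast_nonneg m))
      (Real.log_natCast_nonneg m)
  refine M.exists_basis hp0 hp1 (fun m => φ (Real.log m)) hψ (c := 1 / (4 * φ 1)) (C := 8 / φ 1)
    (by positivity) (by positivity) (fun m hm => ?_) (fun m hm => ?_)
  · obtain ⟨L, -, h2, h3, -⟩ := exists_level_bounds hφ0 hmono hconc hpos hunb hm
    refine ⟨L + 1, 2, by push_cast; linarith, fun k => ?_⟩
    calc (m : ℝ≥0∞) * (levelForest hnm).branchMass (L + 1) k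
        ≤ 2 ^ n (L + 1) * (levelForest hnm).branchMass (L + 1) k := by
          refine mul_le_mul' ?_ le_rfl
          exact_mod_cast h2
      _ ≤ 2 := levelForest_branchMass_le hnm hn0
          (growthLevel_superadd hφ0 hmono hconc hunb) _ _
  · obtain ⟨L, h1, -, -, h4⟩ := exists_level_bounds hφ0 hmono hconc hpos hunb hm
    refine ⟨Finset.range (levelStart n L), evenNodes n L, harmonicSeq 𝕜 p hnm,
      (card_evenNodes_le hnm L).trans h1, pen_diff_restr_harmonicSeq_le hp0 hp1 hnm _, ?_⟩
    rw [restr_evenNodes_restr]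
    refine le_trans ?_ ((le_sum_diff_restr_evenNodes hp0 hnm hn0 L).trans (sum_le_pen _ _))
    rw [← ENNReal.ofReal_natCast]
    exact ENNReal.ofReal_le_ofReal h4

end Isomorphism

theorem mainTheorem3 (𝕜 : Type*) [RCLike 𝕜] (p : ℝ) (hp0 : 0 < p) (hp1 : p ≤ 1)
    (φ : ℝ → ℝ) (hφ0 : φ 0 = 0) (hmono : MonotoneOn φ (Set.Ici 0))
    (hconc : ConcaveOn ℝ (Set.Ici 0) φ) (hne : ∃ x, 0 ≤ x ∧ φ x ≠ 0) :
    (∃ B : QBasis 𝕜 (EllP 𝕜 p), B.IsSchauder ∧ B.IsAlmostGreedy ∧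
      B.CondConstEquiv (fun m : ℕ => φ (Real.log m) ^ (1 / p))) ∧
    (¬ BddAbove (φ '' Set.Ici 0) →
      ∀ δ : ℕ → ℕ, (∀ n, 2 ≤ δ n) →
        ∃ B : QBasis 𝕜 (LindSpace 𝕜 p δ), B.IsSchauder ∧ B.IsAlmostGreedy ∧
          B.CondConstEquiv (fun m : ℕ => φ (Real.log m) ^ (1 / p))) := by
  refine ⟨?_, fun hunb δ hδ => lindSpace_exists_basis hp0 hp1 hφ0 hmono hconc hne hunb hδ⟩
  -- A tree with infinitely many levels requires `φ` to exceed every multiple of `φ 1`; bounded `φ`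
  -- calls for an unconditional basis instead.
  by_cases hb : BddAbove (φ '' Set.Ici 0)
  · exact ellp_exists_basis_of_bddAbove hp0 hp1 hφ0 hmono hconc hne hb
  · exact ellp_exists_basis_of_not_bddAbove hp0 hp1 hφ0 hmono hconc hne hb
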